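/- Let $n\ge 1$ and let $S\in M_n(\mathbb Z)$ be symmetric, positive definite and even ($x^tSx\in 2\mathbb Z$ for all $x\in\mathbb Z^n$). Put $$S_0=\begin{pmatrix}&&1\\&-S&\\1&&\end{pmatrix},\qquad S_1=\begin{pmatrix}&&1\\&S_0&\\1&&\end{pmatrix},\qquad Q_0[y]=\tfrac12\,y^tS_0y,$$ and write $A[B]=B^tAB$ for real matrices. Let $\mathcal H_S$ be the set of $Z=(\omega,z,\tau)\in\mathbb C\times\mathbb C^n\times\mathbb C$ such that $y=\operatorname{Im}Z$ has positive first coordinate and $Q_0[y]>0$; write $Z_2=\tau$ and $I=(i,0,\dots,0,i)\in\mathcal H_S$. Let $G_{\mathbb R}=\{g\in \mathrm{SL}_{n+4}(\mathbb R): g^tS_1g=S_1\}$ with identity component $G^0_{\mathbb R}$, which acts on $\mathcal H_S$ by $$g\langle Z\rangle=\frac{-\frac12(Z^tS_0Z)\,b+AZ+c}{-\frac12(Z^tS_0Z)\,\gamma+d^tZ+\delta},\qquad g=\begin{pmatrix}\alpha&a^t&\beta\\b&A&c\\\gamma&d^t&\delta\end{pmatrix}.$$ Let $\Gamma_S=G^0_{\mathbb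 R}\cap \mathrm{SL}_{n+4}(\mathbb Z)$, and let $\Gamma_{S,J}$ be the subgroup of the matrices $\begin{pmatrix}*&*\\0&D\end{pmatrix}\in\Gamma_S$ with $D\in\mathbb Z^{2\times2}$. Let $\mathcal C^1(\Gamma_S)$ be the set of $\Gamma_S$-orbits of two-dimensional subspaces of $\mathbb Q^{n+4}$ that are totally isotropic for $S_1$. For $Z\in\mathcal H_S$ and $\operatorname{Re}(s)>n+1$ let $$E(Z,s)=\sum_{\gamma\in\Gamma_{S,J}\backslash\Gamma_S}\left(\frac{Q_0[\operatorname{Im}(\gamma\langle Z\rangle)]}{\operatorname{Im}((\gamma\langle Z\rangle)_2)}\right)^{s}.$$ Let $\mathfrak H=\{R\in M_{n+4}(\mathbb R): R=R^t,\ RS_1^{-1}R=S_1,\ R>0\}$ be the space of majorants of $S_1$, and let $R_I=\operatorname{diag}(1,1,S,1,1)$. Let $X$ be the set of integral $(n+4)\times2$ matrices $\ell$ that are primitive (all elementary divisors are $1$) and satisfy $S_1[\ell]=0$. Suppose that $\#\mathcal C^1(\Gamma_S)=1$, and let $Z\in\mathcal H_S$. Then the summands of $E(Z,s)$ depend only on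 the coset of $\gamma$. There is a well-defined majorant $R_Z\in\mathfrak H$, namely $R_Z=R_I[\delta^{-1}]$ for any $\delta\in G^0_{\mathbb R}$ with $\delta\langle I\rangle=Z$ (such $\delta$ exist, and $R_Z$ does not depend on the choice), such that for all $s\in\mathbb C$ with $\operatorname{Re}(s)>n+1$ $$E(Z,s)=\sum_{\gamma\in\Gamma_{S,J}\backslash\Gamma_S}\left(\frac{\operatorname{Im}((\gamma\langle Z\rangle)_2)}{Q_0[\operatorname{Im}(\gamma\langle Z\rangle)]}\right)^{-s}=\sum_{\ell\in X/\mathrm{GL}_2(\mathbb Z)}\bigl(\det(R_Z[\ell])\bigr)^{-s/2},$$ where all the series converge absolutely. -/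

import Mathlib

namespace OrthogonalEisenstein

open Matrix

/-- The index set `{first} ∪ ι ∪ {last}` of the matrices that have one more row and column than
`ι` at either end. -/
abbrev Ends (ι : Type) : Type := Unit ⊕ (ι ⊕ Unit)

/-- Coordinates `(ω, z₁, …, zₙ, τ)` of the `n + 2`-dimensional space `V₀`. -/
abbrev Idx0 (n : ℕ) : Type := Ends (Fin n)

/-- Coordinates of the `n + 4`-dimensional space `V₁`. -/
abbrev Idx1 (n : ℕ) : Type := Ends (Idx0 n)

/-- The block matrix with rows `(0, 0, 1)`, `(0, T, 0)`, `(1, 0, 0)`. -/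
def hyp {ι R : Type} [Zero R] [One R] (T : Matrix ι ι R) : Matrix (Ends ι) (Ends ι) R :=
  fromBlocks 0 (fromCols 0 1) (fromRows 0 1) (fromBlocks T 0 0 0)

/-- `S₀`, with rows `(0, 0, 1)`, `(0, -S, 0)`, `(1, 0, 0)`, over a ring `R`. -/
def S0 {n : ℕ} (S : Matrix (Fin n) (Fin n) ℤ) (R : Type) [Ring R] :
    Matrix (Idx0 n) (Idx0 n) R :=
  hyp (-(S.map (fun k : ℤ => (k : R))))

/-- `S₁`, with rows `(0, 0, 1)`, `(0, S₀, 0)`, `(1, 0, 0)`, over a ring `R`. -/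
def S1 {n : ℕ} (S : Matrix (Fin n) (Fin n) ℤ) (R : Type) [Ring R] :
    Matrix (Idx1 n) (Idx1 n) R :=
  hyp (S0 S R)

/-- `A[B] = Bᵗ A B` (used for real, rational and integral matrices). -/
def bracket {ι κ R : Type} [Fintype ι] [CommRing R] (A : Matrix ι ι R) (B : Matrix ι κ R) :
    Matrix κ κ R :=
  Bᵀ * A * B

/-- `Q₀[y] = φ₀[y] = (1/2) yᵗ S₀ y` for real `y`. -/
noncomputable def Q0 {n : ℕ} (S : Matrix (Fin n) (Fin n) ℤ) (y : Idx0 n → ℝ) : ℝ :=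
  (1 / 2) * (y ⬝ᵥ (S0 S ℝ *ᵥ y))

/-- The imaginary part of a complex vector. -/
def imPart {n : ℕ} (Z : Idx0 n → ℂ) : Idx0 n → ℝ := fun i => (Z i).im

/-- The tube domain `ℋ_S`: the complex vectors whose imaginary part `y` has first coordinate
positive and `Q₀[y] > 0`. -/
def tubeDomain {n : ℕ} (S : Matrix (Fin n) (Fin n) ℤ) : Set (Idx0 n → ℂ) :=
  {Z | 0 < imPart Z (Sum.inl ()) ∧ 0 < Q0 S (imPart Z)}

/-- The last coordinate `τ` of `Z = (ω, z, τ)`. -/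
def lastCoord {n : ℕ} (Z : Idx0 n → ℂ) : ℂ := Z (Sum.inr (Sum.inr ()))

/-- The point `I = (i, 0, …, 0, i)`. -/
noncomputable def basePoint (n : ℕ) : Idx0 n → ℂ :=
  Sum.elim (fun _ => Complex.I) (Sum.elim (fun _ => 0) (fun _ => Complex.I))

/-- The vector `(-(1/2) Zᵗ S₀ Z, Z, 1)` of `ℂ^(n+4)`. -/
noncomputable def hat {n : ℕ} (S : Matrix (Fin n) (Fin n) ℤ) (Z : Idx0 n → ℂ) : Idx1 n → ℂ :=
  Sum.elim (fun _ => -(1 / 2) * (Z ⬝ᵥ (S0 S ℂ *ᵥ Z))) (Sum.elim Z (fun _ => 1))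

/-- The factor of automorphy `j(g, Z) = -(1/2) S₀[Z] γ + dᵗ Z + δ`, where `(γ, dᵗ, δ)` is the
last row of `g`. -/
noncomputable def autFactor {n : ℕ} (S : Matrix (Fin n) (Fin n) ℤ)
    (g : Matrix (Idx1 n) (Idx1 n) ℝ) (Z : Idx0 n → ℂ) : ℂ :=
  (g.map (fun x : ℝ => (x : ℂ)) *ᵥ hat S Z) (Sum.inr (Sum.inr ()))

/-- `g⟨Z⟩ = (-(1/2) S₀[Z] b + A Z + c) / j(g, Z)`, where `(b, A, c)` are the rows of `g` between
the first and the last. -/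
noncomputable def act {n : ℕ} (S : Matrix (Fin n) (Fin n) ℤ)
    (g : Matrix (Idx1 n) (Idx1 n) ℝ) (Z : Idx0 n → ℂ) : Idx0 n → ℂ :=
  fun i => (g.map (fun x : ℝ => (x : ℂ)) *ᵥ hat S Z) (Sum.inr (Sum.inl i)) / autFactor S g Z

/-- The special orthogonal group `{g ∈ SL(R) | T[g] = T}` of a matrix `T`. -/
def specialOrthogonal {ι R : Type} [Fintype ι] [DecidableEq ι] [CommRing R] (T : Matrix ι ι R) :
    Subgroup (SpecialLinearGroup ι R) where
  carrier := {g | bracket T (g : Matrix ι ι R) = T}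
  one_mem' := by simp [bracket]
  mul_mem' := by
    intro a b ha hb
    change bracket T (a : Matrix ι ι R) = T at ha
    change bracket T (b : Matrix ι ι R) = T at hb
    change bracket T ((a : Matrix ι ι R) * (b : Matrix ι ι R)) = T
    have h : bracket T ((a : Matrix ι ι R) * (b : Matrix ι ι R)) =
        bracket (bracket T (a : Matrix ι ι R)) (b : Matrix ι ι R) := by
      simp only [bracket, transpose_mul, Matrix.mul_assoc]
    rw [h, ha, hb]
  inv_mem' := by
    intro a ha
    change bracket T (a : Matrix ι ι R) = T at ha
    change bracket T ((a⁻¹ : SpecialLinearGroup ι R) : Matrix ι ι R) = T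
    have h1 : (a : Matrix ι ι R) * ((a⁻¹ : SpecialLinearGroup ι R) : Matrix ι ι R) = 1 :=
      congrArg Subtype.val (mul_inv_cancel a)
    generalize ((a⁻¹ : SpecialLinearGroup ι R) : Matrix ι ι R) = b at h1 ⊢
    have h : bracket (bracket T (a : Matrix ι ι R)) b = bracket T ((a : Matrix ι ι R) * b) := by
      simp only [bracket, transpose_mul, Matrix.mul_assoc]
    rw [ha, h1] at h
    rw [h]
    simp [bracket]

/-- `G_ℝ`, the special orthogonal group of `S₁` over `ℝ`. -/
def groupG {n : ℕ} (S : Matrix (Fin n) (Fin n) ℤ) :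
    Subgroup (SpecialLinearGroup (Idx1 n) ℝ) :=
  specialOrthogonal (S1 S ℝ)

/-- `G_ℝ⁰`, the connected component of the identity in `G_ℝ`. -/
def groupG0 {n : ℕ} (S : Matrix (Fin n) (Fin n) ℤ) :
    Subgroup (SpecialLinearGroup (Idx1 n) ℝ) :=
  (Subgroup.connectedComponentOfOne (groupG S)).map (groupG S).subtype

/-- `Γ_S`: the elements of `G_ℝ⁰` that map the lattice `ℤ^(n+4)` onto itself, that is, the
matrices in `SL_(n+4)(ℤ)` that lie in `G_ℝ⁰`. -/
def GammaS {n : ℕ} (S : Matrix (Fin n) (Fin n) ℤ) : Subgroup (SpecialLinearGroup (Idx1 n) ℤ) :=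
  (groupG0 S).comap (SpecialLinearGroup.map (Int.castRingHom ℝ))

/-- `1` on the last two indices, `0` on the others. -/
def lastTwo {n : ℕ} : Idx1 n → ℕ
  | Sum.inl _ => 0
  | Sum.inr (Sum.inl (Sum.inl _)) => 0
  | Sum.inr (Sum.inl (Sum.inr (Sum.inl _))) => 0
  | Sum.inr (Sum.inl (Sum.inr (Sum.inr _))) => 1
  | Sum.inr (Sum.inr _) => 1

/-- `Γ_{S,J}`: the elements of `Γ_S` of the form `(* *; 0 D)` with `D` of size `2 × 2`. -/
def GammaSJ {n : ℕ} (S : Matrix (Fin n) (Fin n) ℤ) : Subgroup (GammaS S) where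
  carrier := {γ | BlockTriangular
    ((γ : SpecialLinearGroup (Idx1 n) ℤ) : Matrix (Idx1 n) (Idx1 n) ℤ) lastTwo}
  one_mem' := blockTriangular_one
  mul_mem' := fun ha hb => BlockTriangular.mul ha hb
  inv_mem' := by
    intro a ha
    have h : ((a⁻¹ : SpecialLinearGroup (Idx1 n) ℤ) : Matrix (Idx1 n) (Idx1 n) ℤ) *
        ((a : SpecialLinearGroup (Idx1 n) ℤ) : Matrix (Idx1 n) (Idx1 n) ℤ) = 1 :=
      congrArg Subtype.val (inv_mul_cancel (a : SpecialLinearGroup (Idx1 n) ℤ))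
    have : Invertible ((a : SpecialLinearGroup (Idx1 n) ℤ) : Matrix (Idx1 n) (Idx1 n) ℤ) :=
      invertibleOfLeftInverse _ _ h
    have h2 : BlockTriangular
        ((a : SpecialLinearGroup (Idx1 n) ℤ) : Matrix (Idx1 n) (Idx1 n) ℤ)⁻¹ lastTwo :=
      blockTriangular_inv_of_blockTriangular ha
    rw [inv_eq_left_inv h] at h2
    exact h2

/-- The set of cosets `Γ_{S,J} \ Γ_S`. -/
abbrev Cosets {n : ℕ} (S : Matrix (Fin n) (Fin n) ℤ) : Type :=
  Quotient (QuotientGroup.rightRel (GammaSJ S))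

/-- The real matrix of an element of `Γ_S`. -/
def toReal {n : ℕ} {S : Matrix (Fin n) (Fin n) ℤ} (γ : GammaS S) :
    Matrix (Idx1 n) (Idx1 n) ℝ :=
  ((γ : SpecialLinearGroup (Idx1 n) ℤ) : Matrix (Idx1 n) (Idx1 n) ℤ).map (fun k : ℤ => (k : ℝ))

/-- `Q₀[Im (γ⟨Z⟩)]`. -/
noncomputable def heightQ {n : ℕ} (S : Matrix (Fin n) (Fin n) ℤ) (Z : Idx0 n → ℂ)
    (γ : GammaS S) : ℝ :=
  Q0 S (imPart (act S (toReal γ) Z))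

/-- `Im ((γ⟨Z⟩)₂)`, where `(ω, z, τ)₂ = τ`. -/
noncomputable def imTau {n : ℕ} (S : Matrix (Fin n) (Fin n) ℤ) (Z : Idx0 n → ℂ)
    (γ : GammaS S) : ℝ :=
  (lastCoord (act S (toReal γ) Z)).im

/-- The Klingen type Eisenstein series `E(Z, s)`: the sum over `Γ_{S,J} \ Γ_S` of
`(Q₀[Im (γ⟨Z⟩)] / Im ((γ⟨Z⟩)₂)) ^ s`, where `γ` is any representative of the coset. -/
noncomputable def eisenstein {n : ℕ} (S : Matrix (Fin n) (Fin n) ℤ) (Z : Idx0 n → ℂ) (s : ℂ) : ℂ :=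
  ∑' q : Cosets S, ((heightQ S Z q.out / imTau S Z q.out : ℝ) : ℂ) ^ s

/-- `W` is a two-dimensional totally isotropic subspace of `V₁ = ℚ^(n+4)`. -/
def IsIsotropicPlane {n : ℕ} (S : Matrix (Fin n) (Fin n) ℤ)
    (W : Submodule ℚ (Idx1 n → ℚ)) : Prop :=
  Module.finrank ℚ W = 2 ∧ ∀ v ∈ W, ∀ w ∈ W, v ⬝ᵥ (S1 S ℚ *ᵥ w) = 0

/-- The orbit `Γ_S W` of a subspace `W` of `ℚ^(n+4)`. -/
def planeOrbit {n : ℕ} (S : Matrix (Fin n) (Fin n) ℤ) (W : Submodule ℚ (Idx1 n → ℚ)) :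
    Set (Submodule ℚ (Idx1 n → ℚ)) :=
  {W' | ∃ γ ∈ GammaS S, W' = W.map (Matrix.toLin'
    ((γ : Matrix (Idx1 n) (Idx1 n) ℤ).map (fun k : ℤ => (k : ℚ))))}

/-- `𝒞¹(Γ_S)`: the set of `Γ_S`-orbits of one-dimensional cusps. -/
def oneDimCusps {n : ℕ} (S : Matrix (Fin n) (Fin n) ℤ) :
    Set (Set (Submodule ℚ (Idx1 n → ℚ))) :=
  {O | ∃ W, IsIsotropicPlane S W ∧ O = planeOrbit S W}

/-- The space of majorants of `S₁`. -/
def majorants {n : ℕ} (S : Matrix (Fin n) (Fin n) ℤ) : Set (Matrix (Idx1 n) (Idx1 n) ℝ) :=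
  {R | R = Rᵀ ∧ R * (S1 S ℝ)⁻¹ * R = S1 S ℝ ∧ R.PosDef}

/-- `R_I = diag(1, 1, S, 1, 1)`. -/
def baseMajorant {n : ℕ} (S : Matrix (Fin n) (Fin n) ℤ) : Matrix (Idx1 n) (Idx1 n) ℝ :=
  fromBlocks 1 0 0
    (fromBlocks (fromBlocks 1 0 0 (fromBlocks (S.map (fun k : ℤ => (k : ℝ))) 0 0 1)) 0 0 1)

/-- All the matrices `R_I[δ⁻¹]` with `δ ∈ G_ℝ⁰` and `δ⟨I⟩ = Z`. -/
def transportedMajorants {n : ℕ} (S : Matrix (Fin n) (Fin n) ℤ) (Z : Idx0 n → ℂ) :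
    Set (Matrix (Idx1 n) (Idx1 n) ℝ) :=
  {R | ∃ δ ∈ groupG0 S, act S (δ : Matrix (Idx1 n) (Idx1 n) ℝ) (basePoint n) = Z ∧
    R = bracket (baseMajorant S)
      ((δ⁻¹ : SpecialLinearGroup (Idx1 n) ℝ) : Matrix (Idx1 n) (Idx1 n) ℝ)}

/-- The matrix with columns `e₁, e₂`. -/
def firstTwoCols (n : ℕ) : Matrix (Idx1 n) (Fin 2) ℤ :=
  (of ![Pi.single (Sum.inl ()) 1, Pi.single (Sum.inr (Sum.inl (Sum.inl ()))) 1])ᵀ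

/-- An integral `(n+4) × 2` matrix is primitive if its elementary divisors are all `1`, that is,
if its Smith normal form is `(e₁ e₂)`. -/
def IsPrimitiveMat {n : ℕ} (l : Matrix (Idx1 n) (Fin 2) ℤ) : Prop :=
  ∃ (U : GL (Idx1 n) ℤ) (V : GL (Fin 2) ℤ),
    (U : Matrix (Idx1 n) (Idx1 n) ℤ) * l * (V : Matrix (Fin 2) (Fin 2) ℤ) = firstTwoCols n

/-- The set `X` of primitive integral `(n+4) × 2` matrices `ℓ` with `S₁[ℓ] = 0`. -/
abbrev SetX {n : ℕ} (S : Matrix (Fin n) (Fin n) ℤ) : Type :=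
  {l : Matrix (Idx1 n) (Fin 2) ℤ // IsPrimitiveMat l ∧ bracket (S1 S ℤ) l = 0}

/-- Two elements of `X` are equivalent if they differ by right multiplication by an element of
`GL₂(ℤ)`. -/
def setoidX {n : ℕ} (S : Matrix (Fin n) (Fin n) ℤ) : Setoid (SetX S) where
  r l m := ∃ U : GL (Fin 2) ℤ, m.1 = l.1 * (U : Matrix (Fin 2) (Fin 2) ℤ)
  iseqv :=
    { refl := fun l => ⟨1, by simp⟩
      symm := by
        rintro l m ⟨U, h⟩
        refine ⟨U⁻¹, ?_⟩
        rw [h, Matrix.mul_assoc, Units.mul_inv, Matrix.mul_one]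
      trans := by
        rintro l m k ⟨U, h⟩ ⟨V, h'⟩
        refine ⟨U * V, ?_⟩
        rw [h', h, Units.val_mul, Matrix.mul_assoc] }

/-- `X / GL₂(ℤ)`. -/
abbrev XModGL {n : ℕ} (S : Matrix (Fin n) (Fin n) ℤ) : Type := Quotient (setoidX S)

/-- `det (R[ℓ])` as a function of the class of `ℓ` in `X / GL₂(ℤ)`. -/
noncomputable def detBracket {n : ℕ} (S : Matrix (Fin n) (Fin n) ℤ)
    (R : Matrix (Idx1 n) (Idx1 n) ℝ) : XModGL S → ℝ :=
  Quotient.lift (fun l : SetX S => (bracket R (l.1.map (fun k : ℤ => (k : ℝ)))).det) (by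
    rintro l m ⟨U, h⟩
    have hU : ((U : Matrix (Fin 2) (Fin 2) ℤ).map (fun k : ℤ => (k : ℝ))).det ^ 2 = 1 := by
      have h1 : ((U : Matrix (Fin 2) (Fin 2) ℤ).map (fun k : ℤ => (k : ℝ))).det =
          (((U : Matrix (Fin 2) (Fin 2) ℤ).det : ℤ) : ℝ) :=
        (RingHom.map_det (Int.castRingHom ℝ) _).symm
      have h2 : IsUnit (U : Matrix (Fin 2) (Fin 2) ℤ).det :=
        (Matrix.isUnit_iff_isUnit_det _).mp U.isUnit
      rw [h1]
      rcases Int.isUnit_iff.mp h2 with h3 | h3 <;> rw [h3] <;> norm_num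
    have hm : m.1.map (fun k : ℤ => (k : ℝ)) = l.1.map (fun k : ℤ => (k : ℝ)) *
        (U : Matrix (Fin 2) (Fin 2) ℤ).map (fun k : ℤ => (k : ℝ)) := by
      rw [h]
      exact Matrix.map_mul (f := Int.castRingHom ℝ)
    have hb : ∀ (A : Matrix (Idx1 n) (Fin 2) ℝ) (B : Matrix (Fin 2) (Fin 2) ℝ),
        bracket R (A * B) = Bᵀ * bracket R A * B := by
      intro A B
      simp only [bracket, transpose_mul, Matrix.mul_assoc]
    simp only [hm, hb, det_mul, det_transpose]
    linear_combination -(bracket R (l.1.map (fun k : ℤ => (k : ℝ)))).det * hU)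

end OrthogonalEisenstein

open OrthogonalEisenstein

/-! A point `Z` is encoded by the isotropic vector `hat S Z` in `ℂ^(n+4)`. Its real and imaginary
parts form a matrix `A` with `S₁[A] = 2 Q₀[Im Z] · 1`, so they span a positive definite plane of a
form of signature `(2, n+2)`. The fractional action is the linear one up to a scalar: `g (hat S Z) =
j(g, Z) · hat S (g⟨Z⟩)`. The majorant attached to `Z` equals `S₁` on that plane and `-S₁` on its
orthogonal complement, that is `2 S₁ A S₁[A]⁻¹ Aᵗ S₁ - S₁` (`majorantOf`). It depends only on the
plane and is equivariant, which makes `R_I[δ⁻¹]` independent of `δ` (`transportedMajorants_eq`).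

Write `Δ(x) = Im (c d̄)` for the last two coordinates `c, d` of `x` (`delta`). Comparing `Δ` and the
Gram matrix of `γ (hat S Z)` with those of `hat S Z` gives `Im (γ⟨Z⟩)₂ / Q₀[Im γ⟨Z⟩] = |Δ(γ (hat S
Z))| / Q₀[Im Z]` (`height_quotient`). Also `Δ(x)` is the determinant of `(e₁ e₂)ᵗ S₁ A`. For
isotropic `ℓ` the summand `-S₁` of the majorant drops out of `R[ℓ]`, leaving `det R[ℓ] = 4 det(ℓᵗ S₁
A)² / det S₁[A]`. With `ℓ = γ⁻¹ (e₁ e₂)` this is the square of the quotient above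
(`detBracket_cosetToX`). The map `γ ↦ γ⁻¹ (e₁ e₂)` is a bijection from the cosets to `X / GL₂(ℤ)`:
`Γ_{S,J}` is the stabilizer of the plane `⟨e₁, e₂⟩`, the hypothesis on the cusps makes `Γ_S`
transitive on rational isotropic planes, and a primitive basis of a plane is unique up to `GL₂(ℤ)`.

Absolute convergence is the analytic part (`summable_abs_delta_rpow`) and is proved by unfolding.
Let `x` vary in a small compact ball `K ⊆ ℂ^(n+4)` around `hat S Z`, dropping isotropy so that
Lebesgue measure is available. For fixed `γ` the values `|Δ(γx)|`, `x ∈ K`, are comparable and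
bounded below uniformly in `γ`, since each is comparable to the root of an integral Gram
determinant. Reduction by `Γ_{S,J}` moves every `γx` into a set `F` (`fundamentalSet`) cut out by
the invariants `α`, `η` and inequalities for the remaining coordinates. As `Γ_S` preserves volume
and only finitely many elements make `K` meet its translates, `∫_K ∑_γ 1_F |Δ|^(-σ) (γx)` is at most
a constant times `∫_F |Δ|^(-σ)`. Integrating over the fibres turns the latter into an integral of
`|Δ|^(-(σ-n+1))` over reduced pairs `(c, d)`, which is finite for `σ - n + 1 > 2`; this is the bound
`σ > n + 1`. -/

namespace OrthogonalEisenstein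

open Matrix

/-! ### Block matrices with respect to a hyperbolic plane -/

section Blocks

variable {ι R : Type}

/-- The first coordinate. -/
def head (v : Ends ι → R) : R := v (Sum.inl ())

/-- The coordinates between the first and the last. -/
def mid (v : Ends ι → R) : ι → R := fun i => v (Sum.inr (Sum.inl i))

/-- The last coordinate. -/
def last (v : Ends ι → R) : R := v (Sum.inr (Sum.inr ()))

theorem ends_ext {v w : Ends ι → R} (h1 : head v = head w) (h2 : mid v = mid w)
    (h3 : last v = last w) : v = w := by
  funext i
  rcases i with ⟨⟩ | i | ⟨⟩
  · exact h1
  · exact congrFun h2 i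
  · exact h3

variable [Fintype ι] [CommRing R]

theorem dotProduct_ends (v w : Ends ι → R) :
    v ⬝ᵥ w = head v * head w + mid v ⬝ᵥ mid w + last v * last w := by
  simp [dotProduct, Fintype.sum_sum_type, head, mid, last, add_assoc]

theorem hyp_mulVec_head (T : Matrix ι ι R) (v : Ends ι → R) : head (hyp T *ᵥ v) = last v := by
  classical
  simp [head, last, hyp, mulVec, dotProduct, Fintype.sum_sum_type, fromCols_apply_inl, fromCols_apply_inr, one_apply]

theorem hyp_mulVec_last (T : Matrix ι ι R) (v : Ends ι → R) : last (hyp T *ᵥ v) = head v := by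
  classical
  simp [head, last, hyp, mulVec, dotProduct, Fintype.sum_sum_type, fromRows_apply_inl, fromRows_apply_inr, one_apply]

theorem hyp_mulVec_mid (T : Matrix ι ι R) (v : Ends ι → R) :
    mid (hyp T *ᵥ v) = T *ᵥ mid v := by
  classical
  funext i
  simp [mid, hyp, mulVec, dotProduct, Fintype.sum_sum_type, fromRows_apply_inl, fromRows_apply_inr, one_apply]

theorem hyp_form (T : Matrix ι ι R) (v w : Ends ι → R) :
    v ⬝ᵥ (hyp T *ᵥ w) =
      head v * last w + mid v ⬝ᵥ (T *ᵥ mid w) + last v * head w := by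
  rw [dotProduct_ends, hyp_mulVec_head, hyp_mulVec_last, hyp_mulVec_mid]

theorem hyp_isSymm {T : Matrix ι ι R} (h : T.IsSymm) : (hyp T).IsSymm := by
  ext i j
  have h' : ∀ i j, T i j = T j i := fun i j => congrFun (congrFun h.symm i) j
  rcases i with ⟨⟩ | i | ⟨⟩ <;> rcases j with ⟨⟩ | j | ⟨⟩ <;>
    simp [hyp, h', one_apply]

theorem bracket_eq_iff {T : Matrix ι ι R} {M : Matrix ι ι R} :
    bracket T M = T ↔ ∀ v w, (M *ᵥ v) ⬝ᵥ (T *ᵥ (M *ᵥ w)) = v ⬝ᵥ (T *ᵥ w) := by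
  classical
  have key : ∀ v w, (M *ᵥ v) ⬝ᵥ (T *ᵥ (M *ᵥ w)) = v ⬝ᵥ (bracket T M *ᵥ w) := by
    intro v w
    simp only [bracket, ← mulVec_mulVec, dotProduct_mulVec, vecMul_transpose]
  constructor
  · intro h v w
    rw [key, h]
  · intro h
    ext i j
    have := h (Pi.single i 1) (Pi.single j 1)
    rw [key] at this
    simpa using this

/-- The block matrix with rows `(1, rᵗ, q)`, `(0, 1, l)`, `(0, 0, 1)`. -/
def unip [DecidableEq ι] (r l : ι → R) (q : R) : Matrix (Ends ι) (Ends ι) R :=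
  fromBlocks 1 (fromCols (of fun _ => r) (of fun _ _ => q)) 0
    (fromBlocks 1 (of fun i _ => l i) 0 1)

/-- The block matrix with diagonal `(a, h, b)`. -/
def diagEnds (a : R) (h : Matrix ι ι R) (b : R) : Matrix (Ends ι) (Ends ι) R :=
  fromBlocks (of fun _ _ => a) 0 0 (fromBlocks h 0 0 (of fun _ _ => b))

theorem unip_mulVec_head [DecidableEq ι] (r l : ι → R) (q : R) (v : Ends ι → R) :
    head (unip r l q *ᵥ v) = head v + r ⬝ᵥ mid v + q * last v := by
  simp [head, last, mid, unip, mulVec, dotProduct, Fintype.sum_sum_type, fromCols_apply_inl, fromCols_apply_inr, add_assoc]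

theorem unip_mulVec_mid [DecidableEq ι] (r l : ι → R) (q : R) (v : Ends ι → R) :
    mid (unip r l q *ᵥ v) = mid v + last v • l := by
  funext i
  simp [last, mid, unip, mulVec, dotProduct, Fintype.sum_sum_type, one_apply, mul_comm]

theorem unip_mulVec_last [DecidableEq ι] (r l : ι → R) (q : R) (v : Ends ι → R) :
    last (unip r l q *ᵥ v) = last v := by
  simp [last, unip, mulVec, dotProduct, Fintype.sum_sum_type, one_apply]

theorem unip_transpose_mulVec_head [DecidableEq ι] (r l : ι → R) (q : R) (v : Ends ι → R) :
    head ((unip r l q)ᵀ *ᵥ v) = head v := by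
  simp [head, unip, mulVec, dotProduct, Fintype.sum_sum_type]

theorem unip_transpose_mulVec_mid [DecidableEq ι] (r l : ι → R) (q : R) (v : Ends ι → R) :
    mid ((unip r l q)ᵀ *ᵥ v) = mid v + head v • r := by
  funext i
  simp [head, mid, unip, mulVec, dotProduct, Fintype.sum_sum_type, one_apply, mul_comm,
    add_comm]

theorem unip_transpose_mulVec_last [DecidableEq ι] (r l : ι → R) (q : R) (v : Ends ι → R) :
    last ((unip r l q)ᵀ *ᵥ v) = q * head v + l ⬝ᵥ mid v + last v := by
  simp [head, last, mid, unip, mulVec, dotProduct, Fintype.sum_sum_type, fromCols_apply_inl, fromCols_apply_inr, add_assoc]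

theorem diagEnds_mulVec_head (a b : R) (h : Matrix ι ι R) (v : Ends ι → R) :
    head (diagEnds a h b *ᵥ v) = a * head v := by
  simp [head, diagEnds, mulVec, dotProduct, Fintype.sum_sum_type]

theorem diagEnds_mulVec_mid (a b : R) (h : Matrix ι ι R) (v : Ends ι → R) :
    mid (diagEnds a h b *ᵥ v) = h *ᵥ mid v := by
  funext i
  simp [mid, diagEnds, mulVec, dotProduct, Fintype.sum_sum_type]

theorem diagEnds_mulVec_last (a b : R) (h : Matrix ι ι R) (v : Ends ι → R) :
    last (diagEnds a h b *ᵥ v) = b * last v := by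
  simp [last, diagEnds, mulVec, dotProduct, Fintype.sum_sum_type]

theorem det_unip [DecidableEq ι] (r l : ι → R) (q : R) : (unip r l q).det = 1 := by
  rw [unip, det_fromBlocks_zero₂₁, det_fromBlocks_zero₂₁]
  simp

theorem det_diagEnds [DecidableEq ι] (a b : R) (h : Matrix ι ι R) : (diagEnds a h b).det = a * h.det * b := by
  rw [diagEnds, det_fromBlocks_zero₂₁, det_fromBlocks_zero₂₁]
  simp [det_unique, mul_assoc]

theorem unip_zero [DecidableEq ι] : unip (0 : ι → R) 0 0 = 1 := by
  ext i j
  rcases i with ⟨⟩ | i | ⟨⟩ <;> rcases j with ⟨⟩ | j | ⟨⟩ <;>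
    simp [unip, fromCols_apply_inl, fromCols_apply_inr, one_apply]

theorem diagEnds_one [DecidableEq ι] : diagEnds (1 : R) (1 : Matrix ι ι R) 1 = 1 := by
  ext i j
  rcases i with ⟨⟩ | i | ⟨⟩ <;> rcases j with ⟨⟩ | j | ⟨⟩ <;>
    simp [diagEnds, one_apply]

theorem unip_map [DecidableEq ι] {R' : Type} [CommRing R'] (f : R →+* R') (r l : ι → R) (q : R) :
    (unip r l q).map f = unip (f ∘ r) (f ∘ l) (f q) := by
  ext i j
  rcases i with ⟨⟩ | i | ⟨⟩ <;> rcases j with ⟨⟩ | j | ⟨⟩ <;>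
    simp [unip, fromCols_apply_inl, fromCols_apply_inr, one_apply, apply_ite f]

theorem diagEnds_map {R' : Type} [CommRing R'] (f : R →+* R') (a b : R) (h : Matrix ι ι R) :
    (diagEnds a h b).map f = diagEnds (f a) (h.map f) (f b) := by
  ext i j
  rcases i with ⟨⟩ | i | ⟨⟩ <;> rcases j with ⟨⟩ | j | ⟨⟩ <;>
    simp [diagEnds]

/-- `unip r l q` preserves `hyp T` if `r = -lᵗ T` and `2 q = -T[l]`. -/
theorem bracket_unip [DecidableEq ι] {T : Matrix ι ι R} (hT : T.IsSymm) {r l : ι → R} {q : R}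
    (hr : r = -(T *ᵥ l)) (hq : 2 * q = -(l ⬝ᵥ (T *ᵥ l))) :
    bracket (hyp T) (unip r l q) = hyp T := by
  rw [bracket_eq_iff]
  intro v w
  have hs : ∀ x y : ι → R, x ⬝ᵥ (T *ᵥ y) = y ⬝ᵥ (T *ᵥ x) := by
    intro x y
    rw [dotProduct_mulVec, ← mulVec_transpose, hT.eq, dotProduct_comm]
  simp only [hyp_form, unip_mulVec_head, unip_mulVec_mid, unip_mulVec_last, hr, mulVec_add,
    dotProduct_add, add_dotProduct, mulVec_smul, dotProduct_smul, smul_dotProduct,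
    neg_dotProduct, smul_eq_mul]
  rw [dotProduct_comm (T *ᵥ l), dotProduct_comm (T *ᵥ l), hs l (mid w)]
  linear_combination (last v * last w) * hq

theorem bracket_diagEnds {T : Matrix ι ι R} {h : Matrix ι ι R} (hh : bracket T h = T)
    {a b : R} (hab : a * b = 1) : bracket (hyp T) (diagEnds a h b) = hyp T := by
  rw [bracket_eq_iff] at hh ⊢
  intro v w
  simp only [hyp_form, diagEnds_mulVec_head, diagEnds_mulVec_mid, diagEnds_mulVec_last, hh]
  linear_combination (head v * last w + last v * head w) * hab

end Blocks

theorem continuous_unip {ι X : Type} [Fintype ι] [DecidableEq ι] [TopologicalSpace X]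
    {r l : X → ι → ℝ} {q : X → ℝ} (hr : Continuous r) (hl : Continuous l) (hq : Continuous q) :
    Continuous fun t => unip (r t) (l t) (q t) := by
  refine continuous_matrix fun i j => ?_
  have hr' := fun i => (continuous_apply i).comp hr
  have hl' := fun i => (continuous_apply i).comp hl
  rcases i with ⟨⟩ | i | ⟨⟩ <;> rcases j with ⟨⟩ | j | ⟨⟩ <;>
    simp [unip, fromCols_apply_inl, fromCols_apply_inr] <;> first | exact continuous_const | exact hq | exact hr' _ | exact hl' _

theorem continuous_diagEnds {ι X : Type} [Fintype ι] [TopologicalSpace X]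
    {a b : X → ℝ} {h : X → Matrix ι ι ℝ} (ha : Continuous a) (hh : Continuous h)
    (hb : Continuous b) :
    Continuous fun t => diagEnds (a t) (h t) (b t) := by
  refine continuous_matrix fun i j => ?_
  have hh' := fun i j => (continuous_apply_apply i j).comp hh
  rcases i with ⟨⟩ | i | ⟨⟩ <;> rcases j with ⟨⟩ | j | ⟨⟩ <;>
    simp [diagEnds] <;> first | exact continuous_const | exact ha | exact hb | exact hh' _ _

/-! ### The form `S₁` of signature `(2, n+2)` and its majorants -/

section Form

variable {n : ℕ} {S : Matrix (Fin n) (Fin n) ℤ}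

theorem S0_isSymm (hS : S.IsSymm) (R : Type) [CommRing R] : (S0 S R).IsSymm := by
  refine hyp_isSymm ?_
  ext i j
  simp [hS.apply i j]

theorem S1_isSymm (hS : S.IsSymm) (R : Type) [CommRing R] : (S1 S R).IsSymm :=
  hyp_isSymm (S0_isSymm hS R)

theorem hyp_map {ι R R' : Type} [CommRing R] [CommRing R'] (f : R →+* R') (T : Matrix ι ι R) :
    (hyp T).map f = hyp (T.map f) := by
  classical
  ext i j
  rcases i with ⟨⟩ | i | ⟨⟩ <;> rcases j with ⟨⟩ | j | ⟨⟩ <;>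
    simp [hyp, one_apply]

theorem S1_map {R R' : Type} [CommRing R] [CommRing R'] (f : R →+* R') :
    (S1 S R).map f = S1 S R' := by
  have : (-(S.map (fun k : ℤ => (k : R)))).map f = -(S.map (fun k : ℤ => (k : R'))) := by
    ext i j
    simp
  rw [S1, hyp_map, S0, hyp_map, S1, S0, this]

theorem dot_mulVec_comm {ι R : Type} [Fintype ι] [CommRing R] {T : Matrix ι ι R} (hT : T.IsSymm)
    (x y : ι → R) : x ⬝ᵥ (T *ᵥ y) = y ⬝ᵥ (T *ᵥ x) := by
  rw [dotProduct_mulVec, ← mulVec_transpose, hT.eq, dotProduct_comm]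

theorem S0_form {R : Type} [CommRing R] (v w : Idx0 n → R) :
    v ⬝ᵥ (S0 S R *ᵥ w) = head v * last w - mid v ⬝ᵥ (S.map (fun k : ℤ => (k : R)) *ᵥ mid w)
      + last v * head w := by
  rw [S0, hyp_form, neg_mulVec, dotProduct_neg, sub_eq_add_neg]

theorem S1_form {R : Type} [CommRing R] (v w : Idx1 n → R) :
    v ⬝ᵥ (S1 S R *ᵥ w) = head v * last w + (head (mid v) * last (mid w)
      - mid (mid v) ⬝ᵥ (S.map (fun k : ℤ => (k : R)) *ᵥ mid (mid w))
      + last (mid v) * head (mid w)) + last v * head w := by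
  rw [S1, hyp_form, S0_form]

theorem posDef_form {ι : Type} [Fintype ι] {T : Matrix ι ι ℝ} (hT : T.PosDef) {z : ι → ℝ}
    (hz : z ≠ 0) : 0 < z ⬝ᵥ (T *ᵥ z) := by
  simpa using hT.dotProduct_mulVec_pos hz

theorem posSemidef_form {ι : Type} [Fintype ι] {T : Matrix ι ι ℝ} (hT : T.PosSemidef) (z : ι → ℝ) :
    0 ≤ z ⬝ᵥ (T *ᵥ z) := by
  simpa using hT.dotProduct_mulVec_nonneg z

/-- On these vectors both hyperbolic planes contribute minus a sum of squares, and the remaining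
part is `-S`. This is an explicit negative definite subspace of codimension two, which is all that
is needed of the signature. -/
theorem S1_form_neg (hpos : (S.map (fun k : ℤ => (k : ℝ))).PosDef) {u : Idx1 n → ℝ}
    (h1 : head u + last u = 0) (h2 : head (mid u) + last (mid u) = 0) (hu : u ≠ 0) :
    u ⬝ᵥ (S1 S ℝ *ᵥ u) < 0 := by
  rw [S1_form]
  have e1 : last u = -head u := by linarith
  have e2 : last (mid u) = -head (mid u) := by linarith
  rw [e1, e2]
  have hz := posSemidef_form hpos.posSemidef (mid (mid u))
  rcases eq_or_ne (mid (mid u)) 0 with h3 | h3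
  · have : head u ≠ 0 ∨ head (mid u) ≠ 0 := by
      by_contra! h
      refine hu (ends_ext ?_ (ends_ext ?_ ?_ ?_) ?_)
      · exact h.1
      · exact h.2
      · exact h3
      · rw [e2, h.2]; simp [last, mid]
      · rw [e1, h.1]; simp [last]
    rcases this with h | h
    · nlinarith [mul_self_pos.mpr h, mul_self_nonneg (head (mid u))]
    · nlinarith [mul_self_pos.mpr h, mul_self_nonneg (head u)]
  · nlinarith [posDef_form hpos h3, mul_self_nonneg (head (mid u)), mul_self_nonneg (head u)]

theorem det_S1_ne_zero (hpos : (S.map (fun k : ℤ => (k : ℝ))).PosDef) : (S1 S ℝ).det ≠ 0 := by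
  intro h
  obtain ⟨v, hv, h0⟩ := exists_mulVec_eq_zero_iff.mpr h
  have a1 := hyp_mulVec_head (S0 S ℝ) v
  have a2 := hyp_mulVec_mid (S0 S ℝ) v
  have a3 := hyp_mulVec_last (S0 S ℝ) v
  have b1 := hyp_mulVec_head (-(S.map (fun k : ℤ => (k : ℝ)))) (mid v)
  have b2 := hyp_mulVec_mid (-(S.map (fun k : ℤ => (k : ℝ)))) (mid v)
  have b3 := hyp_mulVec_last (-(S.map (fun k : ℤ => (k : ℝ)))) (mid v)
  rw [S1] at h0
  rw [h0] at a1 a2 a3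
  rw [S0] at a2
  rw [← a2] at b1 b2 b3
  refine hv (ends_ext a3.symm (ends_ext b3.symm ?_ b1.symm) a1.symm)
  by_contra h
  have := posDef_form hpos h
  rw [neg_mulVec, eq_neg_iff_add_eq_zero, ] at b2
  have b2' : S.map (fun k : ℤ => (k : ℝ)) *ᵥ mid (mid v) = 0 := by
    have : mid (mid (0 : Idx1 n → ℝ)) = 0 := rfl
    rwa [this, zero_add] at b2
  rw [b2'] at this
  simp at this

/-- A vector orthogonal to a positive definite plane has negative norm. -/
theorem S1_form_neg_of_orthogonal (hS : S.IsSymm)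
    (hpos : (S.map (fun k : ℤ => (k : ℝ))).PosDef)
    {A : Matrix (Idx1 n) (Fin 2) ℝ} (hA : (bracket (S1 S ℝ) A).PosDef) {w : Idx1 n → ℝ}
    (hw : Aᵀ *ᵥ (S1 S ℝ *ᵥ w) = 0) (h0 : w ≠ 0) : w ⬝ᵥ (S1 S ℝ *ᵥ w) < 0 := by
  by_contra! hnn
  -- The span of the two columns of `A` and of `w` meets the codimension-two negative subspace of
  -- `S1_form_neg`. The two linear equations for the coefficients are padded by a zero row so that
  -- the vanishing determinant yields a nontrivial solution `t`.
  let N : Matrix (Fin 3) (Fin 3) ℝ := of ![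
    ![head (A.col 0) + last (A.col 0), head (A.col 1) + last (A.col 1), head w + last w],
    ![head (mid (A.col 0)) + last (mid (A.col 0)), head (mid (A.col 1)) + last (mid (A.col 1)),
      head (mid w) + last (mid w)], ![0, 0, 0]]
  have hN : N.det = 0 := det_eq_zero_of_row_eq_zero 2 (by intro j; fin_cases j <;> rfl)
  obtain ⟨t, ht, h⟩ := exists_mulVec_eq_zero_iff.mpr hN
  have e1 := congrFun h 0
  have e2 := congrFun h 1
  simp only [N, mulVec, dotProduct, Fin.sum_univ_three, of_apply, cons_val] at e1 e2
  set c : Fin 2 → ℝ := ![t 0, t 1] with hc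
  set u : Idx1 n → ℝ := A *ᵥ c + t 2 • w with hu
  have hAc : A *ᵥ c = t 0 • A.col 0 + t 1 • A.col 1 := by
    ext i
    simp [mulVec, dotProduct, Fin.sum_univ_two, hc, mul_comm]
  have form : u ⬝ᵥ (S1 S ℝ *ᵥ u) =
      c ⬝ᵥ (bracket (S1 S ℝ) A *ᵥ c) + t 2 ^ 2 * (w ⬝ᵥ (S1 S ℝ *ᵥ w)) := by
    have x1 : (A *ᵥ c) ⬝ᵥ (S1 S ℝ *ᵥ w) = 0 := by
      rw [← vecMul_transpose, ← dotProduct_mulVec, hw, dotProduct_zero]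
    have x2 : w ⬝ᵥ (S1 S ℝ *ᵥ (A *ᵥ c)) = 0 := by rw [dot_mulVec_comm (S1_isSymm hS ℝ), x1]
    have x3 : (A *ᵥ c) ⬝ᵥ (S1 S ℝ *ᵥ (A *ᵥ c)) = c ⬝ᵥ (bracket (S1 S ℝ) A *ᵥ c) := by
      simp only [bracket, ← mulVec_mulVec, dotProduct_mulVec, vecMul_transpose]
    simp only [hu, mulVec_add, mulVec_smul, dotProduct_add, add_dotProduct, dotProduct_smul,
      smul_dotProduct, smul_eq_mul, x1, x2, x3]
    ring
  have u1 : head u + last u = 0 := by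
    rw [hu, hAc]
    simp only [head, last, Pi.add_apply, Pi.smul_apply, smul_eq_mul, Pi.zero_apply] at e1 ⊢
    linarith
  have u2 : head (mid u) + last (mid u) = 0 := by
    rw [hu, hAc]
    simp only [head, last, mid, Pi.add_apply, Pi.smul_apply, smul_eq_mul, Pi.zero_apply] at e2 ⊢
    linarith
  have hc0 := posSemidef_form hA.posSemidef c
  rcases eq_or_ne u 0 with hu0 | hu0
  · rw [hu0] at form
    simp only [zero_dotProduct] at form
    have hcc : c = 0 := by
      by_contra hcne
      nlinarith [posDef_form hA hcne, mul_nonneg (sq_nonneg (t 2)) hnn]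
    have t0 : t 0 = 0 := congrFun hcc 0
    have t1 : t 1 = 0 := congrFun hcc 1
    have t2 : t 2 = 0 := by
      rw [hu, hcc, mulVec_zero, zero_add] at hu0
      exact (smul_eq_zero.mp hu0).resolve_right h0
    exact ht (by ext i; fin_cases i <;> assumption)
  · have := S1_form_neg hpos u1 u2 hu0
    nlinarith [mul_nonneg (sq_nonneg (t 2)) hnn]

/-- The majorant of `S₁` that belongs to the positive definite plane spanned by the columns
of `A`. -/
noncomputable def majorantOf (S : Matrix (Fin n) (Fin n) ℤ) (A : Matrix (Idx1 n) (Fin 2) ℝ) :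
    Matrix (Idx1 n) (Idx1 n) ℝ :=
  2 • (S1 S ℝ * A * (bracket (S1 S ℝ) A)⁻¹ * Aᵀ * S1 S ℝ) - S1 S ℝ

theorem bracket_transpose {ι κ R : Type} [Fintype ι] [CommRing R] {T : Matrix ι ι R}
    (hT : T.IsSymm) (B : Matrix ι κ R) : (bracket T B)ᵀ = bracket T B := by
  simp [bracket, transpose_mul, Matrix.mul_assoc, hT.eq]

theorem bracket_mul {ι κ μ R : Type} [Fintype ι] [Fintype κ] [CommRing R] (T : Matrix ι ι R)
    (B : Matrix ι κ R) (C : Matrix κ μ R) :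
    bracket T (B * C) = bracket (bracket T B) C := by
  simp only [bracket, transpose_mul, Matrix.mul_assoc]

theorem majorantOf_transpose (hS : S.IsSymm) (A : Matrix (Idx1 n) (Fin 2) ℝ) :
    (majorantOf S A)ᵀ = majorantOf S A := by
  simp only [majorantOf, transpose_sub, transpose_smul, transpose_mul, transpose_transpose,
    transpose_nonsing_inv, bracket_transpose (S1_isSymm hS ℝ), (S1_isSymm hS ℝ).eq,
    Matrix.mul_assoc]

/-- The orthogonal decomposition of `w` along the plane spanned by `A`: the majorant is the form on
the plane minus the form on the complement. Positivity follows, since the complement is negative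
definite. -/
theorem majorantOf_form (hS : S.IsSymm)
    {A : Matrix (Idx1 n) (Fin 2) ℝ} (hA : (bracket (S1 S ℝ) A).PosDef) (w : Idx1 n → ℝ) :
    ∃ m : Fin 2 → ℝ, ∃ w' : Idx1 n → ℝ, w = w' + A *ᵥ m ∧ Aᵀ *ᵥ (S1 S ℝ *ᵥ w') = 0 ∧
      w ⬝ᵥ (majorantOf S A *ᵥ w) =
        m ⬝ᵥ (bracket (S1 S ℝ) A *ᵥ m) - w' ⬝ᵥ (S1 S ℝ *ᵥ w') := by
  have hu : IsUnit (bracket (S1 S ℝ) A).det := (isUnit_iff_isUnit_det _).mp hA.isUnit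
  set G := bracket (S1 S ℝ) A with hG
  set p : Fin 2 → ℝ := Aᵀ *ᵥ (S1 S ℝ *ᵥ w) with hp
  set m : Fin 2 → ℝ := G⁻¹ *ᵥ p with hm
  have hGm : G *ᵥ m = p := by rw [hm, mulVec_mulVec, mul_nonsing_inv _ hu, one_mulVec]
  have hAm : Aᵀ *ᵥ (S1 S ℝ *ᵥ (A *ᵥ m)) = p := by
    rw [← hGm, hG, bracket]
    simp only [mulVec_mulVec, Matrix.mul_assoc]
  have hort : Aᵀ *ᵥ (S1 S ℝ *ᵥ (w - A *ᵥ m)) = 0 := by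
    rw [mulVec_sub, mulVec_sub, hAm, ← hp, sub_self]
  refine ⟨m, w - A *ᵥ m, by simp, hort, ?_⟩
  have x1 : (A *ᵥ m) ⬝ᵥ (S1 S ℝ *ᵥ (A *ᵥ m)) = m ⬝ᵥ (G *ᵥ m) := by
    rw [hGm, ← hAm, ← vecMul_transpose, ← dotProduct_mulVec]
  have x2 : (A *ᵥ m) ⬝ᵥ (S1 S ℝ *ᵥ w) = m ⬝ᵥ (G *ᵥ m) := by
    rw [hGm, hp, ← vecMul_transpose, ← dotProduct_mulVec]
  have x3 : w ⬝ᵥ (S1 S ℝ *ᵥ (A *ᵥ m)) = m ⬝ᵥ (G *ᵥ m) := by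
    rw [dot_mulVec_comm (S1_isSymm hS ℝ), x2]
  have x4 : w ⬝ᵥ (majorantOf S A *ᵥ w) = 2 * (m ⬝ᵥ (G *ᵥ m)) - w ⬝ᵥ (S1 S ℝ *ᵥ w) := by
    rw [← x3, majorantOf, sub_mulVec, dotProduct_sub, smul_mulVec, dotProduct_smul, hm, hp]
    simp only [mulVec_mulVec, Matrix.mul_assoc]
    simp [hG]
  rw [x4]
  simp only [mulVec_sub, dotProduct_sub, sub_dotProduct, x1, x2, x3]
  ring

theorem majorantOf_posDef (hS : S.IsSymm)
    (hpos : (S.map (fun k : ℤ => (k : ℝ))).PosDef)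
    {A : Matrix (Idx1 n) (Fin 2) ℝ} (hA : (bracket (S1 S ℝ) A).PosDef) :
    (majorantOf S A).PosDef := by
  refine PosDef.of_dotProduct_mulVec_pos ?_ ?_
  · rw [IsHermitian, conjTranspose_eq_transpose_of_trivial, majorantOf_transpose hS]
  · intro w hw
    rw [star_trivial]
    obtain ⟨m, w', h1, h2, h3⟩ := majorantOf_form hS hA w
    rw [h3]
    have hm := posSemidef_form hA.posSemidef m
    rcases eq_or_ne w' 0 with h | h
    · have hm0 : m ≠ 0 := by
        rintro rfl
        apply hw
        rw [h1, h]
        simp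
      rw [h]
      simpa using posDef_form hA hm0
    · linarith [S1_form_neg_of_orthogonal hS hpos hA h2 h]

theorem majorantOf_mem (hS : S.IsSymm)
    (hpos : (S.map (fun k : ℤ => (k : ℝ))).PosDef)
    {A : Matrix (Idx1 n) (Fin 2) ℝ} (hA : (bracket (S1 S ℝ) A).PosDef) :
    majorantOf S A ∈ majorants S := by
  refine ⟨(majorantOf_transpose hS A).symm, ?_, majorantOf_posDef hS hpos hA⟩
  have hu : IsUnit (bracket (S1 S ℝ) A).det := (isUnit_iff_isUnit_det _).mp hA.isUnit
  have hv : IsUnit (S1 S ℝ).det := (det_S1_ne_zero hpos).isUnit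
  have h1 : (S1 S ℝ) * (S1 S ℝ)⁻¹ = 1 := mul_nonsing_inv _ hv
  have h2 : (S1 S ℝ)⁻¹ * (S1 S ℝ) = 1 := nonsing_inv_mul _ hv
  rw [majorantOf]
  set G := bracket (S1 S ℝ) A with hG
  set X := S1 S ℝ * A * G⁻¹ * Aᵀ * S1 S ℝ with hX
  -- `S₁⁻¹ X` is the orthogonal projection onto the plane, so `S₁⁻¹ (2X - S₁)` is an involution,
  -- which is the majorant equation.
  have k1 : X * (S1 S ℝ)⁻¹ * X = X := by
    have : X * (S1 S ℝ)⁻¹ * X =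
        S1 S ℝ * A * G⁻¹ * (Aᵀ * (S1 S ℝ * (S1 S ℝ)⁻¹) * S1 S ℝ * A) * G⁻¹ * Aᵀ * S1 S ℝ := by
      rw [hX]; simp only [Matrix.mul_assoc]
    rw [this, h1, Matrix.mul_one, ← bracket, ← hG, nonsing_inv_mul_cancel_right _ _ hu, hX]
  have k2 : X * (S1 S ℝ)⁻¹ * S1 S ℝ = X := by rw [Matrix.mul_assoc, h2, Matrix.mul_one]
  have k3 : S1 S ℝ * (S1 S ℝ)⁻¹ * X = X := by rw [h1, Matrix.one_mul]
  simp only [Matrix.sub_mul, Matrix.mul_sub, Matrix.smul_mul, Matrix.mul_smul, k1, k2, k3, h1,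
    Matrix.one_mul]
  module

/-- Equivariance: for an isometry `g` one has `S₁ g = g⁻ᵗ S₁` and `gᵗ S₁ = S₁ g⁻¹`, while the Gram
matrix of the plane is unchanged. -/
theorem majorantOf_mul_left {g g' : Matrix (Idx1 n) (Idx1 n) ℝ} (hg : bracket (S1 S ℝ) g = S1 S ℝ)
    (h : g * g' = 1) (A : Matrix (Idx1 n) (Fin 2) ℝ) :
    majorantOf S (g * A) = bracket (majorantOf S A) g' := by
  have h' : g'ᵀ * gᵀ = 1 := by rw [← transpose_mul, h, transpose_one]
  have e1 : S1 S ℝ * g = g'ᵀ * S1 S ℝ := by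
    nth_rewrite 2 [← hg]
    rw [bracket, ← Matrix.mul_assoc, ← Matrix.mul_assoc, h', Matrix.one_mul]
  have e2 : gᵀ * S1 S ℝ = S1 S ℝ * g' := by
    nth_rewrite 2 [← hg]
    rw [bracket, Matrix.mul_assoc, h, Matrix.mul_one]
  have e3 : bracket (S1 S ℝ) g' = S1 S ℝ := by
    rw [bracket, ← e1, Matrix.mul_assoc, h, Matrix.mul_one]
  have e4 : ∀ X, bracket (2 • X - S1 S ℝ) g' = 2 • (g'ᵀ * X * g') - S1 S ℝ := by
    intro X
    nth_rewrite 2 [← e3]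
    simp only [bracket, Matrix.mul_sub, Matrix.sub_mul, Matrix.mul_smul, Matrix.smul_mul]
  rw [majorantOf, bracket_mul, hg, majorantOf, e4, transpose_mul]
  congr 2
  calc _ = (S1 S ℝ * g) * A * (bracket (S1 S ℝ) A)⁻¹ * Aᵀ * (gᵀ * S1 S ℝ) := by
        simp only [Matrix.mul_assoc]
    _ = _ := by rw [e1, e2]; simp only [Matrix.mul_assoc]

/-- A change of basis `U` cancels against the inverse Gram matrix, so the majorant depends on the
plane only. -/
theorem majorantOf_mul_right {A : Matrix (Idx1 n) (Fin 2) ℝ} {U : Matrix (Fin 2) (Fin 2) ℝ}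
    (hU : IsUnit U.det) : majorantOf S (A * U) = majorantOf S A := by
  have hU' : IsUnit Uᵀ.det := by rwa [det_transpose]
  rw [majorantOf, majorantOf, bracket_mul, bracket, Matrix.mul_inv_rev, Matrix.mul_inv_rev,
    transpose_mul]
  congr 2
  calc _ = S1 S ℝ * A * (U * U⁻¹) * (bracket (S1 S ℝ) A)⁻¹ * (Uᵀ⁻¹ * Uᵀ) * Aᵀ * S1 S ℝ := by
        simp only [Matrix.mul_assoc]
    _ = _ := by rw [mul_nonsing_inv _ hU, nonsing_inv_mul _ hU', Matrix.mul_one, Matrix.mul_one]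

/-- Isotropy of `l` removes the summand `-S₁`. What remains is `2 B G⁻¹ Bᵗ` with `B = lᵗ S₁ A` and
`G = S₁[A]`, and the factor 2 becomes `2² = 4` in a determinant of size two. -/
theorem det_bracket_majorantOf (hS : S.IsSymm) {A l : Matrix (Idx1 n) (Fin 2) ℝ}
    (hl : bracket (S1 S ℝ) l = 0) :
    (bracket (majorantOf S A) l).det =
      4 * (lᵀ * S1 S ℝ * A).det ^ 2 / (bracket (S1 S ℝ) A).det := by
  have e : bracket (majorantOf S A) l = (2 : ℝ) •
      ((lᵀ * S1 S ℝ * A) * (bracket (S1 S ℝ) A)⁻¹ * (lᵀ * S1 S ℝ * A)ᵀ) := by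
    have : bracket (majorantOf S A) l = 2 • (lᵀ * (S1 S ℝ * A * (bracket (S1 S ℝ) A)⁻¹ * Aᵀ
        * S1 S ℝ) * l) - bracket (S1 S ℝ) l := by
      rw [majorantOf, bracket, bracket, Matrix.mul_sub, Matrix.sub_mul, Matrix.mul_smul,
        Matrix.smul_mul]
      rfl
    rw [this, hl, sub_zero]
    simp only [transpose_mul, transpose_transpose, (S1_isSymm hS ℝ).eq, Matrix.mul_assoc]
    rw [two_smul, two_smul]
  rw [e, det_smul, det_mul, det_mul, det_transpose, det_nonsing_inv, Ring.inverse_eq_inv',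
    Fintype.card_fin]
  ring

end Form

/-! ### The action on the tube domain through isotropic vectors -/

section Action

variable {n : ℕ} {S : Matrix (Fin n) (Fin n) ℤ}

/-- The action of a real matrix on `ℂ^(n+4)`. -/
noncomputable def cmul (g : Matrix (Idx1 n) (Idx1 n) ℝ) (x : Idx1 n → ℂ) : Idx1 n → ℂ :=
  g.map (fun t : ℝ => (t : ℂ)) *ᵥ x

/-- The matrix with columns `Re x` and `Im x`. -/
def reIm (x : Idx1 n → ℂ) : Matrix (Idx1 n) (Fin 2) ℝ := of fun i => ![(x i).re, (x i).im]

/-- `Im (c d̄)` for the last two coordinates `c, d` of `x`. -/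
noncomputable def delta (x : Idx1 n → ℂ) : ℝ :=
  (last (mid x)).im * (last x).re - (last (mid x)).re * (last x).im

theorem cmul_mul (g h : Matrix (Idx1 n) (Idx1 n) ℝ) (x : Idx1 n → ℂ) :
    cmul (g * h) x = cmul g (cmul h x) := by
  rw [cmul, cmul, cmul, mulVec_mulVec]
  congr 1
  exact Matrix.map_mul (f := Complex.ofRealHom)

theorem cmul_one (x : Idx1 n → ℂ) : cmul 1 x = x := by
  have : (1 : Matrix (Idx1 n) (Idx1 n) ℝ).map (fun t : ℝ => (t : ℂ)) = 1 :=
    Matrix.map_one _ Complex.ofReal_zero Complex.ofReal_one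
  rw [cmul, this, one_mulVec]

theorem reIm_cmul (g : Matrix (Idx1 n) (Idx1 n) ℝ) (x : Idx1 n → ℂ) :
    reIm (cmul g x) = g * reIm x := by
  ext i j
  fin_cases j <;> simp [reIm, cmul, mul_apply, mulVec, dotProduct]

/-- Multiplication by `k` on `ℂ`, as a matrix acting on rows. -/
def mulMatrix (k : ℂ) : Matrix (Fin 2) (Fin 2) ℝ := !![k.re, k.im; -k.im, k.re]

theorem det_mulMatrix (k : ℂ) : (mulMatrix k).det = Complex.normSq k := by
  rw [mulMatrix, det_fin_two_of, Complex.normSq_apply]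
  ring

theorem mulMatrix_conformal (k : ℂ) :
    (mulMatrix k)ᵀ * mulMatrix k = (Complex.normSq k) • (1 : Matrix (Fin 2) (Fin 2) ℝ) := by
  ext i j
  fin_cases i <;> fin_cases j <;>
    simp [mulMatrix, mul_apply, Fin.sum_univ_two, Complex.normSq_apply] <;> ring

theorem reIm_smul (k : ℂ) (x : Idx1 n → ℂ) : reIm (k • x) = reIm x * mulMatrix k := by
  ext i j
  fin_cases j <;> simp [reIm, mulMatrix, mul_apply, Fin.sum_univ_two] <;> ring

theorem delta_smul (k : ℂ) (x : Idx1 n → ℂ) : delta (k • x) = Complex.normSq k * delta x := by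
  simp only [delta, last, mid, Pi.smul_apply, smul_eq_mul, Complex.mul_im, Complex.mul_re,
    Complex.normSq_apply]
  ring

/-- Pairing with `e₁, e₂` under `S₁` extracts the last two coordinates. This is the link between the
heights of the Eisenstein series and isotropic pairs of columns. -/
theorem delta_eq_det (x : Idx1 n → ℂ) :
    delta x = (((firstTwoCols n).map (fun k : ℤ => (k : ℝ)))ᵀ * S1 S ℝ * reIm x).det := by
  have h : ((firstTwoCols n).map (fun k : ℤ => (k : ℝ)))ᵀ * S1 S ℝ * reIm x =
      of ![![(last x).re, (last x).im], ![(last (mid x)).re, (last (mid x)).im]] := by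
    ext i j
    fin_cases i <;> fin_cases j <;>
    simp [firstTwoCols, mul_apply, S1, S0, hyp, reIm, Fintype.sum_sum_type, Pi.single_apply,
      last, mid]
  rw [h, det_fin_two_of, delta]
  ring

theorem quad_complex {ι : Type} [Fintype ι] {T : Matrix ι ι ℝ} (hT : T.IsSymm) (z : ι → ℂ) :
    z ⬝ᵥ (T.map Complex.ofRealHom *ᵥ z) =
      (((fun i => (z i).re) ⬝ᵥ (T *ᵥ fun i => (z i).re)
        - (fun i => (z i).im) ⬝ᵥ (T *ᵥ fun i => (z i).im) : ℝ) : ℂ)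
      + ((2 * ((fun i => (z i).re) ⬝ᵥ (T *ᵥ fun i => (z i).im)) : ℝ) : ℂ) * Complex.I := by
  set p : ι → ℝ := fun i => (z i).re
  set q : ι → ℝ := fun i => (z i).im
  have hz : z = Complex.ofRealHom ∘ p + Complex.I • (Complex.ofRealHom ∘ q) := by
    funext i
    simp [p, q, mul_comm Complex.I, Complex.re_add_im]
  have hm : ∀ u v : ι → ℝ, (Complex.ofRealHom ∘ u) ⬝ᵥ
      (T.map Complex.ofRealHom *ᵥ (Complex.ofRealHom ∘ v)) = ((u ⬝ᵥ (T *ᵥ v) : ℝ) : ℂ) := by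
    intro u v
    have h1 : T.map Complex.ofRealHom *ᵥ (Complex.ofRealHom ∘ v) = Complex.ofRealHom ∘ (T *ᵥ v) := by
      funext i
      exact (RingHom.map_mulVec Complex.ofRealHom T v i).symm
    rw [h1]
    exact (RingHom.map_dotProduct Complex.ofRealHom u (T *ᵥ v)).symm
  rw [hz]
  simp only [mulVec_add, mulVec_smul, dotProduct_add, add_dotProduct, dotProduct_smul,
    smul_dotProduct, smul_eq_mul, hm, dot_mulVec_comm hT q p]
  push_cast
  linear_combination (↑(q ⬝ᵥ T *ᵥ q) : ℂ) * Complex.I_mul_I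

theorem S0_map {R R' : Type} [CommRing R] [CommRing R'] (f : R →+* R') :
    (S0 S R).map f = S0 S R' := by
  have : (-(S.map (fun k : ℤ => (k : R)))).map f = -(S.map (fun k : ℤ => (k : R'))) := by
    ext i j
    simp
  rw [S0, hyp_map, S0, this]

theorem bracket_reIm (hS : S.IsSymm) (x : Idx1 n → ℂ) :
    bracket (S1 S ℝ) (reIm x) =
      !![(fun i => (x i).re) ⬝ᵥ (S1 S ℝ *ᵥ fun i => (x i).re),
        (fun i => (x i).re) ⬝ᵥ (S1 S ℝ *ᵥ fun i => (x i).im);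
        (fun i => (x i).re) ⬝ᵥ (S1 S ℝ *ᵥ fun i => (x i).im),
        (fun i => (x i).im) ⬝ᵥ (S1 S ℝ *ᵥ fun i => (x i).im)] := by
  have key : ∀ i j, bracket (S1 S ℝ) (reIm x) i j =
      (reIm x).col i ⬝ᵥ (S1 S ℝ *ᵥ (reIm x).col j) := by
    intro i j
    rw [bracket, Matrix.mul_assoc, mul_apply]
    simp only [dotProduct, mulVec, mul_apply, transpose_apply, col_apply]
  ext i j
  rw [key]
  fin_cases i <;> fin_cases j
  · rfl
  · rfl
  · exact dot_mulVec_comm (S1_isSymm hS ℝ) _ _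
  · rfl

/-- Isotropy of `hat S Z` for the complex bilinear form says that its real and imaginary parts are
orthogonal and of equal norm; the common norm is read off from the imaginary part, whose last
coordinate is zero. -/
theorem bracket_hat (hS : S.IsSymm) (Z : Idx0 n → ℂ) :
    bracket (S1 S ℝ) (reIm (hat S Z)) =
      (2 * Q0 S (imPart Z)) • (1 : Matrix (Fin 2) (Fin 2) ℝ) := by
  rw [bracket_reIm hS]
  have hq := quad_complex (S0_isSymm hS ℝ) Z
  rw [S0_map] at hq
  have h1 := congrArg Complex.re hq
  have h2 := congrArg Complex.im hq
  simp only [Complex.add_re, Complex.add_im, Complex.ofReal_re, Complex.ofReal_im, Complex.mul_re,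
    Complex.mul_im, Complex.I_re, Complex.I_im] at h1 h2
  have e1 : head (fun i => (hat S Z i).re) = -(1 / 2) * (Z ⬝ᵥ (S0 S ℂ *ᵥ Z)).re := by
    simp [head, hat]
  have e2 : head (fun i => (hat S Z i).im) = -(1 / 2) * (Z ⬝ᵥ (S0 S ℂ *ᵥ Z)).im := by
    simp [head, hat]
  have e3 : last (fun i => (hat S Z i).re) = 1 := by simp [last, hat]
  have e4 : last (fun i => (hat S Z i).im) = 0 := by simp [last, hat]
  have e5 : mid (fun i => (hat S Z i).re) = fun i => (Z i).re := rfl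
  have e6 : mid (fun i => (hat S Z i).im) = fun i => (Z i).im := rfl
  have e7 : 2 * Q0 S (imPart Z) = (fun i => (Z i).im) ⬝ᵥ (S0 S ℝ *ᵥ fun i => (Z i).im) := by
    rw [Q0]
    change 2 * (1 / 2 * ((fun i => (Z i).im) ⬝ᵥ (S0 S ℝ *ᵥ fun i => (Z i).im))) = _
    ring
  rw [e7]
  simp only [S1, hyp_form, e1, e2, e3, e4, e5, e6, h1, h2]
  ext i j
  fin_cases i <;> fin_cases j <;> simp <;> ring

theorem S1_form_hat (Z : Idx0 n → ℂ) : hat S Z ⬝ᵥ (S1 S ℂ *ᵥ hat S Z) = 0 := by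
  have e1 : head (hat S Z) = -(1 / 2) * (Z ⬝ᵥ (S0 S ℂ *ᵥ Z)) := rfl
  have e2 : mid (hat S Z) = Z := rfl
  have e3 : last (hat S Z) = 1 := rfl
  rw [S1, hyp_form, e1, e2, e3]
  ring

theorem bracket_map {ι κ R R' : Type} [Fintype ι] [CommRing R] [CommRing R'] (f : R →+* R')
    (T : Matrix ι ι R) (B : Matrix ι κ R) :
    (bracket T B).map f = bracket (T.map f) (B.map f) := by
  rw [bracket, Matrix.map_mul, Matrix.map_mul, bracket, transpose_map]

theorem bracket_complex {g : Matrix (Idx1 n) (Idx1 n) ℝ} (hg : bracket (S1 S ℝ) g = S1 S ℝ) :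
    bracket (S1 S ℂ) (g.map (fun t : ℝ => (t : ℂ))) = S1 S ℂ := by
  have h := bracket_map Complex.ofRealHom (S1 S ℝ) g
  rw [hg, S1_map] at h
  exact h.symm

theorem posDef_bracket_hat (hS : S.IsSymm) {Z : Idx0 n → ℂ} (hZ : 0 < Q0 S (imPart Z)) :
    (bracket (S1 S ℝ) (reIm (hat S Z))).PosDef := by
  rw [bracket_hat hS]
  exact PosDef.one.smul (by positivity)

/-- If the last coordinate of `g (hat S Z)` vanished, `e₁` would be orthogonal to the positive
definite plane it spans, hence of negative norm; but `e₁` is isotropic. -/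
theorem autFactor_ne_zero (hS : S.IsSymm)
    (hpos : (S.map (fun k : ℤ => (k : ℝ))).PosDef)
    {g : Matrix (Idx1 n) (Idx1 n) ℝ} (hg : bracket (S1 S ℝ) g = S1 S ℝ) {Z : Idx0 n → ℂ}
    (hZ : 0 < Q0 S (imPart Z)) : autFactor S g Z ≠ 0 := by
  intro h
  have hA : (bracket (S1 S ℝ) (reIm (cmul g (hat S Z)))).PosDef := by
    rw [reIm_cmul, bracket_mul, hg]
    exact posDef_bracket_hat hS hZ
  have hl : cmul g (hat S Z) (Sum.inr (Sum.inr ())) = 0 := h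
  set w : Idx1 n → ℝ := Pi.single (Sum.inl ()) 1 with hw
  have w1 : head w = 1 := by simp [head, hw]
  have w2 : mid w = 0 := by funext i; simp [mid, hw]
  have w3 : last w = 0 := by simp [last, hw]
  have hSw : S1 S ℝ *ᵥ w = Pi.single (Sum.inr (Sum.inr ())) 1 := by
    refine ends_ext ?_ ?_ ?_
    · rw [S1, hyp_mulVec_head, w3]; simp [head]
    · rw [S1, hyp_mulVec_mid, w2]; funext i; simp [mid]
    · rw [S1, hyp_mulVec_last, w1]; simp [last]
  have := S1_form_neg_of_orthogonal hS hpos hA (w := w) (by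
    rw [hSw]
    ext j
    fin_cases j <;> simp [reIm, hl]) (by
    intro h0
    rw [h0] at w1
    simp [head] at w1)
  rw [hSw] at this
  simp [hw] at this

/-- The middle and last coordinates agree by the definition of the action. The first one is then
forced, because both sides are isotropic and the last coordinate is nonzero. -/
theorem cmul_hat (hS : S.IsSymm)
    (hpos : (S.map (fun k : ℤ => (k : ℝ))).PosDef)
    {g : Matrix (Idx1 n) (Idx1 n) ℝ} (hg : bracket (S1 S ℝ) g = S1 S ℝ) {Z : Idx0 n → ℂ}
    (hZ : 0 < Q0 S (imPart Z)) : cmul g (hat S Z) = autFactor S g Z • hat S (act S g Z) := by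
  have hj := autFactor_ne_zero hS hpos hg hZ
  set j := autFactor S g Z with hjdef
  have hmid : mid (cmul g (hat S Z)) = j • act S g Z := by
    funext i
    change _ = j * ((g.map (fun x : ℝ => (x : ℂ)) *ᵥ hat S Z) (Sum.inr (Sum.inl i)) / j)
    rw [mul_div_cancel₀ _ hj]
    rfl
  have hlast : last (cmul g (hat S Z)) = j := rfl
  refine ends_ext ?_ ?_ ?_
  · have hq := bracket_eq_iff.mp (bracket_complex hg) (hat S Z) (hat S Z)
    rw [S1_form_hat] at hq
    change cmul g (hat S Z) ⬝ᵥ (S1 S ℂ *ᵥ cmul g (hat S Z)) = 0 at hq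
    rw [S1, hyp_form, hmid, hlast, mulVec_smul, dotProduct_smul, smul_dotProduct] at hq
    have : j * (head (cmul g (hat S Z))
        - j * (-(1 / 2) * (act S g Z ⬝ᵥ (S0 S ℂ *ᵥ act S g Z)))) = 0 := by
      simp only [smul_eq_mul] at hq
      linear_combination (1 / 2) * hq
    have := (mul_eq_zero.mp this).resolve_left hj
    rw [sub_eq_zero.mp this]
    rfl
  · rw [hmid]; rfl
  · rw [hlast]; simp [last, hat]

/-- Compare the Gram matrices of `hat S Z` and of `g (hat S Z)`: multiplication by `j` is a
similarity with factor `|j|²`. -/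
theorem Q0_act (hS : S.IsSymm)
    (hpos : (S.map (fun k : ℤ => (k : ℝ))).PosDef)
    {g : Matrix (Idx1 n) (Idx1 n) ℝ} (hg : bracket (S1 S ℝ) g = S1 S ℝ) {Z : Idx0 n → ℂ}
    (hZ : 0 < Q0 S (imPart Z)) :
    Complex.normSq (autFactor S g Z) * Q0 S (imPart (act S g Z)) = Q0 S (imPart Z) := by
  have h1 : bracket (S1 S ℝ) (reIm (cmul g (hat S Z))) =
      bracket (S1 S ℝ) (reIm (hat S Z)) := by
    rw [reIm_cmul, bracket_mul, hg]
  rw [cmul_hat hS hpos hg hZ, reIm_smul, bracket_mul, bracket_hat hS, bracket_hat hS, bracket,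
    Matrix.mul_smul, Matrix.mul_one, Matrix.smul_mul, mulMatrix_conformal] at h1
  have := congrFun (congrFun h1 0) 0
  simp at this
  linarith

theorem delta_hat (Z : Idx0 n → ℂ) : delta (hat S Z) = (lastCoord Z).im := by
  simp [delta, hat, last, mid, lastCoord]

theorem delta_cmul_hat (hS : S.IsSymm)
    (hpos : (S.map (fun k : ℤ => (k : ℝ))).PosDef)
    {g : Matrix (Idx1 n) (Idx1 n) ℝ} (hg : bracket (S1 S ℝ) g = S1 S ℝ) {Z : Idx0 n → ℂ}
    (hZ : 0 < Q0 S (imPart Z)) :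
    delta (cmul g (hat S Z)) =
      Complex.normSq (autFactor S g Z) * (lastCoord (act S g Z)).im := by
  rw [cmul_hat hS hpos hg hZ, delta_smul, delta_hat]

theorem im_head_mul_im_last (hpos : (S.map (fun k : ℤ => (k : ℝ))).PosDef) {y : Idx0 n → ℝ}
    (hy : 0 < Q0 S y) : 0 < head y * last y := by
  rw [Q0, S0_form] at hy
  have := posSemidef_form hpos.posSemidef (mid y)
  linarith

theorem groupG0_bracket {g : SpecialLinearGroup (Idx1 n) ℝ} (hg : g ∈ groupG0 S) :
    bracket (S1 S ℝ) (g : Matrix (Idx1 n) (Idx1 n) ℝ) = S1 S ℝ := by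
  obtain ⟨h, -, rfl⟩ := hg
  exact h.2

theorem act_one (Z : Idx0 n → ℂ) : act S 1 Z = Z := by
  funext i
  have h := cmul_one (hat S Z)
  have h1 : (((1 : Matrix (Idx1 n) (Idx1 n) ℝ).map (fun x : ℝ => (x : ℂ))) *ᵥ hat S Z) = hat S Z :=
    h
  rw [act, autFactor, h1]
  simp [hat]

/-- `Q₀` stays positive under all of `G_ℝ`, and positive `Q₀` forbids the first coordinate of the
imaginary part to vanish. Hence its sign is constant on the connected component of the identity. -/
theorem act_mem_tubeDomain (hS : S.IsSymm)
    (hpos : (S.map (fun k : ℤ => (k : ℝ))).PosDef)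
    {g : SpecialLinearGroup (Idx1 n) ℝ} (hg : g ∈ groupG0 S) {Z : Idx0 n → ℂ}
    (hZ : Z ∈ tubeDomain S) :
    act S (g : Matrix (Idx1 n) (Idx1 n) ℝ) Z ∈ tubeDomain S := by
  have hQ : ∀ g : groupG S, 0 < Q0 S (imPart (act S (g.1 : Matrix (Idx1 n) (Idx1 n) ℝ) Z)) := by
    intro g
    have h1 := Q0_act hS hpos (g := (g.1 : Matrix (Idx1 n) (Idx1 n) ℝ)) g.2 hZ.2
    have h2 := Complex.normSq_pos.mpr
      (autFactor_ne_zero hS hpos (g := (g.1 : Matrix (Idx1 n) (Idx1 n) ℝ)) g.2 hZ.2)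
    have h3 := hZ.2
    rw [← h1] at h3
    exact (mul_pos_iff_of_pos_left h2).mp h3
  have hval : Continuous fun g : groupG S => (g.1 : Matrix (Idx1 n) (Idx1 n) ℝ) :=
    continuous_subtype_val.comp continuous_subtype_val
  have hvec : Continuous fun g : groupG S =>
      (g.1 : Matrix (Idx1 n) (Idx1 n) ℝ).map (fun x : ℝ => (x : ℂ)) *ᵥ hat S Z :=
    (hval.matrix_map Complex.continuous_ofReal).matrix_mulVec continuous_const
  have hcont : Continuous fun g : groupG S =>
      imPart (act S (g.1 : Matrix (Idx1 n) (Idx1 n) ℝ) Z) (Sum.inl ()) := by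
    refine Complex.continuous_im.comp (Continuous.div ?_ ?_ ?_)
    · exact continuous_pi_iff.mp hvec _
    · exact continuous_pi_iff.mp hvec _
    · intro g
      exact autFactor_ne_zero hS hpos g.2 hZ.2
  obtain ⟨h, hh, rfl⟩ := hg
  refine ⟨?_, hQ h⟩
  by_contra! hneg
  have hpre := (isPreconnected_connectedComponent (x := (1 : groupG S))).image _ hcont.continuousOn
  have h1 : imPart Z (Sum.inl ()) ∈ (fun g : groupG S =>
      imPart (act S (g.1 : Matrix (Idx1 n) (Idx1 n) ℝ) Z) (Sum.inl ())) ''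
      connectedComponent (1 : groupG S) :=
    ⟨1, mem_connectedComponent, by
      change imPart (act S (1 : Matrix (Idx1 n) (Idx1 n) ℝ) Z) _ = _
      rw [act_one]⟩
  have h2 := hpre.ordConnected.out ⟨h, hh, rfl⟩ h1 ⟨hneg, hZ.1.le⟩
  obtain ⟨k, -, hk⟩ := h2
  have := im_head_mul_im_last hpos (hQ k)
  change imPart (act S (k.1 : Matrix (Idx1 n) (Idx1 n) ℝ) Z) (Sum.inl ()) = 0 at hk
  rw [head, hk, zero_mul] at this
  exact lt_irrefl _ this

end Action

/-! ### Explicit elements of `G_ℝ⁰` and of `Γ_{S,J}` -/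

section Elements

variable {n : ℕ} {S : Matrix (Fin n) (Fin n) ℤ}

/-- The matrix `M` belongs to `G_ℝ⁰`. -/
def InG0 (S : Matrix (Fin n) (Fin n) ℤ) (M : Matrix (Idx1 n) (Idx1 n) ℝ) : Prop :=
  ∃ g ∈ groupG0 S, (g : Matrix (Idx1 n) (Idx1 n) ℝ) = M

theorem InG0.mul {M N : Matrix (Idx1 n) (Idx1 n) ℝ} (hM : InG0 S M) (hN : InG0 S N) :
    InG0 S (M * N) := by
  obtain ⟨g, hg, rfl⟩ := hM
  obtain ⟨h, hh, rfl⟩ := hN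
  exact ⟨g * h, mul_mem hg hh, rfl⟩

/-- Membership in the identity component is always obtained from a path in `G_ℝ` through `1`: the
image of `ℝ` is connected. -/
theorem InG0.of_path {f : ℝ → Matrix (Idx1 n) (Idx1 n) ℝ} (hf : Continuous f)
    (hdet : ∀ t, (f t).det = 1) (hS : ∀ t, bracket (S1 S ℝ) (f t) = S1 S ℝ) (h0 : f 0 = 1)
    (t : ℝ) : InG0 S (f t) := by
  let F : ℝ → groupG S := fun t => ⟨⟨f t, hdet t⟩, hS t⟩
  have hF : Continuous F := (hf.subtype_mk _).subtype_mk _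
  have h1 : F 0 = 1 := Subtype.ext (Subtype.ext h0)
  refine ⟨⟨f t, hdet t⟩, ⟨F t, ?_, rfl⟩, rfl⟩
  have hpre := (isPreconnected_univ (α := ℝ)).image F hF.continuousOn
  exact hpre.subset_connectedComponent ⟨0, trivial, h1⟩ ⟨t, trivial, rfl⟩

theorem bracket_one {ι R : Type} [Fintype ι] [DecidableEq ι] [CommRing R] (T : Matrix ι ι R) :
    bracket T (1 : Matrix ι ι R) = T := by
  simp [bracket]

theorem inG0_translation (hS : S.IsSymm) (x : Idx0 n → ℝ) :
    InG0 S (unip (-(S0 S ℝ *ᵥ x)) x (-(1 / 2) * (x ⬝ᵥ (S0 S ℝ *ᵥ x)))) := by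
  have := InG0.of_path (S := S)
    (f := fun t : ℝ => unip (t • -(S0 S ℝ *ᵥ x)) (t • x) (t ^ 2 * (-(1 / 2) * (x ⬝ᵥ (S0 S ℝ *ᵥ x)))))
    (continuous_unip (by fun_prop) (by fun_prop) (by fun_prop)) (fun t => det_unip _ _ _)
    (fun t => bracket_unip (S0_isSymm hS ℝ) (by rw [mulVec_smul, smul_neg])
      (by rw [mulVec_smul, dotProduct_smul, smul_dotProduct, smul_eq_mul, smul_eq_mul]; ring))
    (by simp [unip_zero]) 1
  simpa using this

theorem negS_isSymm (hS : S.IsSymm) (R : Type) [CommRing R] :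
    (-(S.map (fun k : ℤ => (k : R)))).IsSymm := by
  ext i j
  simp [hS.apply i j]

theorem inG0_middle_translation (hS : S.IsSymm) (x : Fin n → ℝ) :
    InG0 S (diagEnds 1 (unip (S.map (fun k : ℤ => (k : ℝ)) *ᵥ x) x
      ((1 / 2) * (x ⬝ᵥ (S.map (fun k : ℤ => (k : ℝ)) *ᵥ x)))) 1) := by
  have := InG0.of_path (S := S)
    (f := fun t : ℝ => diagEnds 1 (unip (t • (S.map (fun k : ℤ => (k : ℝ)) *ᵥ x)) (t • x)
      (t ^ 2 * ((1 / 2) * (x ⬝ᵥ (S.map (fun k : ℤ => (k : ℝ)) *ᵥ x))))) 1)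
    (continuous_diagEnds continuous_const
      (continuous_unip (by fun_prop) (by fun_prop) (by fun_prop)) continuous_const)
    (fun t => by rw [det_diagEnds, det_unip]; norm_num)
    (fun t => bracket_diagEnds (bracket_unip (negS_isSymm hS ℝ)
      (by rw [mulVec_smul, neg_mulVec, smul_neg, neg_neg])
      (by
        rw [mulVec_smul, neg_mulVec, dotProduct_smul, dotProduct_neg, smul_dotProduct, smul_eq_mul,
          smul_eq_mul]
        ring)) (by norm_num))
    (by simp [unip_zero, diagEnds_one]) 1
  simpa using this

theorem inG0_diagonal {a : ℝ} (ha : 0 < a) : InG0 S (diagEnds a 1 a⁻¹) := by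
  have := InG0.of_path (S := S)
    (f := fun t : ℝ => diagEnds (Real.exp (t * Real.log a)) 1 (Real.exp (-(t * Real.log a))))
    (continuous_diagEnds (by fun_prop) continuous_const (by fun_prop))
    (fun t => by rw [det_diagEnds, det_one, mul_one, ← Real.exp_add]; simp)
    (fun t => bracket_diagEnds (bracket_one _) (by rw [← Real.exp_add]; simp))
    (by simp [diagEnds_one]) 1
  simpa [Real.exp_neg, Real.exp_log ha] using this

theorem inG0_middle_diagonal {a : ℝ} (ha : 0 < a) :
    InG0 S (diagEnds 1 (diagEnds a 1 a⁻¹) 1) := by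
  have := InG0.of_path (S := S)
    (f := fun t : ℝ => diagEnds 1
      (diagEnds (Real.exp (t * Real.log a)) 1 (Real.exp (-(t * Real.log a)))) 1)
    (continuous_diagEnds continuous_const
      (continuous_diagEnds (by fun_prop) continuous_const (by fun_prop)) continuous_const)
    (fun t => by
      rw [det_diagEnds, det_diagEnds, det_one, one_mul, mul_one, mul_one, ← Real.exp_add]; simp)
    (fun t => bracket_diagEnds (bracket_diagEnds (bracket_one _) (by rw [← Real.exp_add]; simp))
      (one_mul 1))
    (by simp [diagEnds_one]) 1
  simpa [Real.exp_neg, Real.exp_log ha] using this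

/-- The lower unipotent matrix that adds the last but one coordinate to the last one. -/
def lowerUnip (n : ℕ) {R : Type} [CommRing R] (t : R) : Matrix (Idx1 n) (Idx1 n) R :=
  (unip (ι := Idx0 n) (Pi.single (Sum.inl ()) (-t)) (Pi.single (Sum.inr (Sum.inr ())) t) 0)ᵀ

theorem bracket_lowerUnip (R : Type) [CommRing R] (t : R) :
    bracket (S1 S R) (lowerUnip n t) = S1 S R := by
  rw [bracket_eq_iff]
  intro v w
  have k1 : ∀ u : Idx1 n → R, head (mid (lowerUnip n t *ᵥ u)) = head (mid u) - t * head u := by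
    intro u
    rw [lowerUnip, unip_transpose_mulVec_mid]
    simp [head]; ring
  have k2 : ∀ u : Idx1 n → R, mid (mid (lowerUnip n t *ᵥ u)) = mid (mid u) := by
    intro u
    rw [lowerUnip, unip_transpose_mulVec_mid]
    funext i
    simp [mid]
  have k3 : ∀ u : Idx1 n → R, last (mid (lowerUnip n t *ᵥ u)) = last (mid u) := by
    intro u
    rw [lowerUnip, unip_transpose_mulVec_mid]
    simp [last]
  have k4 : ∀ u : Idx1 n → R, last (lowerUnip n t *ᵥ u) = last u + t * last (mid u) := by
    intro u
    rw [lowerUnip, unip_transpose_mulVec_last]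
    simp [last]; ring
  have k5 : ∀ u : Idx1 n → R, head (lowerUnip n t *ᵥ u) = head u := by
    intro u
    rw [lowerUnip, unip_transpose_mulVec_head]
  rw [S1_form, S1_form]
  simp only [k1, k2, k3, k4, k5]
  ring

theorem inG0_lowerUnip (t : ℝ) : InG0 S (lowerUnip n t) := by
  refine InG0.of_path (S := S) (f := fun t : ℝ => lowerUnip n t) ?_
    (fun t => by rw [lowerUnip, det_transpose, det_unip]) (fun t => bracket_lowerUnip ℝ t) ?_ t
  · refine Continuous.matrix_transpose (continuous_unip ?_ ?_ continuous_const)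
    · exact (continuous_single (A := fun _ : Idx0 n => ℝ) (Sum.inl ())).comp continuous_neg
    · exact continuous_single (A := fun _ : Idx0 n => ℝ) (Sum.inr (Sum.inr ()))
  · simp [lowerUnip, unip_zero]

/-- An integral matrix in `G_ℝ⁰` with the zero pattern of `Γ_{S,J}` comes from `Γ_{S,J}`. -/
theorem exists_mem_GammaSJ {M : Matrix (Idx1 n) (Idx1 n) ℤ} (hdet : M.det = 1)
    (hM : InG0 S (M.map (Int.castRingHom ℝ))) (hb : BlockTriangular M lastTwo) :
    ∃ p ∈ GammaSJ S, toReal p = M.map (Int.castRingHom ℝ) := by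
  obtain ⟨g, hg, hgM⟩ := hM
  have hmem : (⟨M, hdet⟩ : SpecialLinearGroup (Idx1 n) ℤ) ∈ GammaS S := by
    change SpecialLinearGroup.map (Int.castRingHom ℝ) ⟨M, hdet⟩ ∈ groupG0 S
    convert hg
    exact Subtype.ext hgM.symm
  exact ⟨⟨⟨M, hdet⟩, hmem⟩, hb, rfl⟩

theorem toReal_mem (γ : GammaS S) :
    ∃ g ∈ groupG0 S, (g : Matrix (Idx1 n) (Idx1 n) ℝ) = toReal γ :=
  ⟨SpecialLinearGroup.map (Int.castRingHom ℝ) γ.1, γ.2, rfl⟩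

theorem bracket_toReal (γ : GammaS S) : bracket (S1 S ℝ) (toReal γ) = S1 S ℝ := by
  obtain ⟨g, hg, h⟩ := toReal_mem γ
  rw [← h]
  exact groupG0_bracket hg

theorem toReal_mul (γ δ : GammaS S) : toReal (γ * δ) = toReal γ * toReal δ :=
  Matrix.map_mul (f := Int.castRingHom ℝ)

theorem toReal_one : toReal (1 : GammaS S) = 1 :=
  Matrix.map_one (Int.castRingHom ℝ) (map_zero _) (map_one _)

theorem toReal_inv_mul (γ : GammaS S) : toReal γ⁻¹ * toReal γ = 1 := by
  rw [← toReal_mul, inv_mul_cancel, toReal_one]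

theorem toReal_mul_inv (γ : GammaS S) : toReal γ * toReal γ⁻¹ = 1 := by
  rw [← toReal_mul, mul_inv_cancel, toReal_one]

/-- Evenness of `S` makes the corner entry `-(1/2) S₀[l]` of a translation by an integral vector
integral. -/
theorem even_S0 (heven : ∀ x : Fin n → ℤ, Even (x ⬝ᵥ Matrix.mulVec S x)) (x : Idx0 n → ℤ) :
    2 ∣ x ⬝ᵥ (S0 S ℤ *ᵥ x) := by
  rw [S0_form]
  have h : S.map (fun k : ℤ => (Int.cast k : ℤ)) = S := by ext; simp
  have h2 := (heven (mid x)).two_dvd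
  rw [h]
  obtain ⟨k, hk⟩ := h2
  exact ⟨head x * last x - k, by rw [hk]; ring⟩

theorem cmul_intCast (M : Matrix (Idx1 n) (Idx1 n) ℤ) (x : Idx1 n → ℂ) :
    cmul (M.map (Int.castRingHom ℝ)) x = M.map (Int.castRingHom ℂ) *ᵥ x := by
  rfl

/-- These are the elements used to reduce vectors modulo `Γ_{S,J}`: they add multiples of the last
coordinate `d` to the middle block. The formula for the first coordinate is needed for the central
direction. -/
theorem exists_translation (hS : S.IsSymm)
    (heven : ∀ x : Fin n → ℤ, Even (x ⬝ᵥ Matrix.mulVec S x)) (l : Idx0 n → ℤ) :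
    ∃ p ∈ GammaSJ S, ∀ x : Idx1 n → ℂ,
      last (cmul (toReal p) x) = last x ∧
      mid (cmul (toReal p) x) = mid x + last x • (fun i => (l i : ℂ)) ∧
      head (cmul (toReal p) x) = head x - (S0 S ℂ *ᵥ fun i => (l i : ℂ)) ⬝ᵥ mid x
        - (1 / 2) * ((fun i => (l i : ℂ)) ⬝ᵥ (S0 S ℂ *ᵥ fun i => (l i : ℂ))) * last x := by
  obtain ⟨k, hk⟩ := even_S0 heven l
  have hmv : ∀ (R : Type) [CommRing R], Int.castRingHom R ∘ (-(S0 S ℤ *ᵥ l)) =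
      -(S0 S R *ᵥ (fun i => (l i : R))) := by
    intro R _
    funext i
    have := RingHom.map_mulVec (Int.castRingHom R) (S0 S ℤ) l i
    rw [S0_map] at this
    rw [Function.comp_apply, Pi.neg_apply, map_neg, this]
    rfl
  have hq : ∀ (R : Type) [CommRing R], 2 * (Int.castRingHom R (-k)) =
      -((fun i => (l i : R)) ⬝ᵥ (S0 S R *ᵥ fun i => (l i : R))) := by
    intro R _
    have h1 := RingHom.map_dotProduct (Int.castRingHom R) l (S0 S ℤ *ᵥ l)
    have h2 : (Int.castRingHom R) ∘ (S0 S ℤ *ᵥ l) = S0 S R *ᵥ (fun i => (l i : R)) := by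
      funext i
      have := RingHom.map_mulVec (Int.castRingHom R) (S0 S ℤ) l i
      rwa [S0_map] at this
    rw [h2, hk] at h1
    change _ = -((Int.castRingHom R ∘ l) ⬝ᵥ _)
    rw [← h1]
    simp
  obtain ⟨p, hp, h⟩ := exists_mem_GammaSJ (S := S)
    (M := unip (-(S0 S ℤ *ᵥ l)) l (-k)) (det_unip _ _ _)
    (by
      rw [unip_map, hmv]
      have := inG0_translation hS (fun i => (l i : ℝ))
      have hq' : Int.castRingHom ℝ (-k) = -(1 / 2) *
          ((fun i => (l i : ℝ)) ⬝ᵥ (S0 S ℝ *ᵥ fun i => (l i : ℝ))) := by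
        linear_combination (1 / 2) * hq ℝ
      rw [hq']
      exact this)
    (by
      intro i j hij
      rcases i with ⟨⟩ | (⟨⟩ | i | ⟨⟩) | ⟨⟩ <;> rcases j with ⟨⟩ | (⟨⟩ | j | ⟨⟩) | ⟨⟩ <;>
        simp [lastTwo] at hij <;> simp [unip, one_apply])
  refine ⟨p, hp, fun x => ?_⟩
  rw [h, cmul_intCast, unip_map, hmv]
  refine ⟨unip_mulVec_last _ _ _ _, unip_mulVec_mid _ _ _ _, ?_⟩
  rw [unip_mulVec_head, neg_dotProduct]
  linear_combination (1 / 2) * last x * hq ℂ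

/-- The counterpart of `exists_translation` inside the middle block: it adds integral multiples of
`c`, the last but one coordinate, to `z`. Together the two give reduction of `z` modulo `ℤⁿ c + ℤⁿ
d`. -/
theorem exists_middle_translation (hS : S.IsSymm)
    (heven : ∀ x : Fin n → ℤ, Even (x ⬝ᵥ Matrix.mulVec S x)) (l : Fin n → ℤ) :
    ∃ p ∈ GammaSJ S, ∀ x : Idx1 n → ℂ,
      last (cmul (toReal p) x) = last x ∧
      last (mid (cmul (toReal p) x)) = last (mid x) ∧
      mid (mid (cmul (toReal p) x)) = mid (mid x) + last (mid x) • (fun i => (l i : ℂ)) := by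
  obtain ⟨k, hk⟩ := (heven l).two_dvd
  have hmv : ∀ (R : Type) [CommRing R], Int.castRingHom R ∘ (S *ᵥ l) =
      S.map (fun k : ℤ => (k : R)) *ᵥ (fun i => (l i : R)) := by
    intro R _
    funext i
    exact RingHom.map_mulVec (Int.castRingHom R) S l i
  have hq : (1 / 2 : ℝ) * ((fun i => (l i : ℝ)) ⬝ᵥ
      (S.map (fun k : ℤ => (k : ℝ)) *ᵥ fun i => (l i : ℝ))) = Int.castRingHom ℝ k := by
    have h1 := RingHom.map_dotProduct (Int.castRingHom ℝ) l (S *ᵥ l)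
    rw [hmv, hk] at h1
    change (1 / 2 : ℝ) * ((Int.castRingHom ℝ ∘ l) ⬝ᵥ _) = _
    rw [← h1]
    simp
  obtain ⟨p, hp, h⟩ := exists_mem_GammaSJ (S := S)
    (M := diagEnds 1 (unip (S *ᵥ l) l k) 1) (by rw [det_diagEnds, det_unip]; norm_num)
    (by
      rw [diagEnds_map, unip_map, hmv, ← hq, map_one]
      exact inG0_middle_translation hS (fun i => (l i : ℝ)))
    (by
      intro i j hij
      rcases i with ⟨⟩ | (⟨⟩ | i | ⟨⟩) | ⟨⟩ <;> rcases j with ⟨⟩ | (⟨⟩ | j | ⟨⟩) | ⟨⟩ <;>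
        simp [lastTwo] at hij <;> simp [diagEnds, unip])
  refine ⟨p, hp, fun x => ?_⟩
  rw [h, cmul_intCast, diagEnds_map, unip_map]
  refine ⟨?_, ?_, ?_⟩
  · rw [diagEnds_mulVec_last, map_one, one_mul]
  · rw [diagEnds_mulVec_mid, unip_mulVec_last]
  · rw [diagEnds_mulVec_mid, unip_mulVec_mid]
    rfl

theorem exists_lowerUnip (t : ℤ) :
    ∃ p ∈ GammaSJ S, ∀ x : Idx1 n → ℂ,
      last (cmul (toReal p) x) = last x + t * last (mid x) ∧
      last (mid (cmul (toReal p) x)) = last (mid x) := by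
  have hmap : ∀ (R : Type) [CommRing R], (lowerUnip n t).map (Int.castRingHom R) =
      lowerUnip n (t : R) := by
    intro R _
    rw [lowerUnip, transpose_map, unip_map, lowerUnip, map_zero]
    congr 2 <;>
    · funext i
      rcases i with ⟨⟩ | i | ⟨⟩ <;> simp
  obtain ⟨p, hp, h⟩ := exists_mem_GammaSJ (S := S)
    (M := lowerUnip n t) (by rw [lowerUnip, det_transpose, det_unip])
    (by rw [hmap]; exact inG0_lowerUnip _)
    (by
      intro i j hij
      rcases i with ⟨⟩ | (⟨⟩ | i | ⟨⟩) | ⟨⟩ <;> rcases j with ⟨⟩ | (⟨⟩ | j | ⟨⟩) | ⟨⟩ <;>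
        simp [lastTwo] at hij <;> simp [lowerUnip, unip, fromCols, one_apply])
  refine ⟨p, hp, fun x => ?_⟩
  rw [h, cmul_intCast, hmap, lowerUnip]
  constructor
  · rw [unip_transpose_mulVec_last]
    simp [last]; ring
  · rw [unip_transpose_mulVec_mid]
    simp [last]

/-- The last two coordinates are transformed among themselves by the integral block `D`, and `Δ` is
their alternating form, so `m = det D`. -/
theorem exists_delta_cmul (p : GammaS S) (hp : p ∈ GammaSJ S) :
    ∃ m : ℤ, ∀ x : Idx1 n → ℂ, delta (cmul (toReal p) x) = m * delta x := by
  have hb : ∀ i j, lastTwo j < lastTwo i →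
      ((p : SpecialLinearGroup (Idx1 n) ℤ) : Matrix (Idx1 n) (Idx1 n) ℤ) i j = 0 := hp
  set M := ((p : SpecialLinearGroup (Idx1 n) ℤ) : Matrix (Idx1 n) (Idx1 n) ℤ) with hM
  let e : Idx1 n := Sum.inr (Sum.inr ())
  let f : Idx1 n := Sum.inr (Sum.inl (Sum.inr (Sum.inr ())))
  have row : ∀ (i : Idx1 n) (x : Idx1 n → ℂ), lastTwo i = 1 →
      cmul (toReal p) x i = M i f * x f + M i e * x e := by
    intro i x hi
    have h0 : ∀ j : Idx1 n, lastTwo j = 0 → M i j = 0 := fun j hj => hb i j (by rw [hj, hi]; norm_num)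
    have h1 : cmul (toReal p) x = M.map (Int.castRingHom ℂ) *ᵥ x := cmul_intCast M x
    have z1 : M i (Sum.inl ()) = 0 := h0 _ rfl
    have z2 : M i (Sum.inr (Sum.inl (Sum.inl ()))) = 0 := h0 _ rfl
    have z3 : ∀ k, M i (Sum.inr (Sum.inl (Sum.inr (Sum.inl k)))) = 0 := fun k => h0 _ rfl
    rw [h1]
    simp [mulVec, dotProduct, Fintype.sum_sum_type, z1, z2, z3, e, f]
  refine ⟨M f f * M e e - M f e * M e f, fun x => ?_⟩
  have r1 : last (cmul (toReal p) x) = M e f * x f + M e e * x e := row e x rfl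
  have r2 : last (mid (cmul (toReal p) x)) = M f f * x f + M f e * x e := row f x rfl
  rw [delta, r1, r2, delta]
  change _ = _ * ((x f).im * (x e).re - (x f).re * (x e).im)
  simp
  ring

theorem abs_delta_cmul (p : GammaS S) (hp : p ∈ GammaSJ S) (x : Idx1 n → ℂ) :
    |delta (cmul (toReal p) x)| = |delta x| := by
  obtain ⟨m, hm⟩ := exists_delta_cmul p hp
  obtain ⟨m', hm'⟩ := exists_delta_cmul p⁻¹ (inv_mem hp)
  -- Evaluating at a vector with `Δ = 1` shows that the multipliers of `p` and `p⁻¹` are inverse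
  -- integers, hence `±1`.
  have h1 : delta (hat S (basePoint n)) = 1 := by
    rw [delta_hat]; simp [lastCoord, basePoint]
  have h2 : (m' * m : ℝ) = 1 := by
    have := hm' (cmul (toReal p) (hat S (basePoint n)))
    rw [← cmul_mul, toReal_inv_mul, cmul_one, hm, h1, mul_one] at this
    exact this.symm
  have h3 : m' * m = 1 := by exact_mod_cast h2
  have h4 : |m| = 1 := Int.isUnit_iff_abs_eq.mp (isUnit_iff_exists_inv'.mpr ⟨m', h3⟩)
  rw [hm, abs_mul]
  have : |(m : ℝ)| = 1 := by exact_mod_cast h4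
  rw [this, one_mul]

end Elements

/-! ### Transitivity on `ℋ_S`, the majorant of a point, the height quotient -/

section Transitive

variable {n : ℕ} {S : Matrix (Fin n) (Fin n) ℤ}

theorem act_eq_of_cmul {g : Matrix (Idx1 n) (Idx1 n) ℝ} {Z W : Idx0 n → ℂ} {k : ℂ} (hk : k ≠ 0)
    (h1 : mid (cmul g (hat S Z)) = k • W) (h2 : last (cmul g (hat S Z)) = k) :
    act S g Z = W := by
  funext i
  have e1 : (g.map (fun x : ℝ => (x : ℂ)) *ᵥ hat S Z) (Sum.inr (Sum.inl i)) = k * W i :=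
    congrFun h1 i
  have e2 : (g.map (fun x : ℝ => (x : ℂ)) *ᵥ hat S Z) (Sum.inr (Sum.inr ())) = k := h2
  rw [act, autFactor, e1, e2, mul_div_cancel_left₀ _ hk]

theorem head_add {ι : Type} (v w : Ends ι → ℂ) : head (v + w) = head v + head w := rfl

theorem mid_add {ι : Type} (v w : Ends ι → ℂ) : mid (v + w) = mid v + mid w := rfl

theorem last_add {ι : Type} (v w : Ends ι → ℂ) : last (v + w) = last v + last w := rfl

theorem cmul_unip (r l : Idx0 n → ℝ) (q : ℝ) (x : Idx1 n → ℂ) :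
    cmul (unip r l q) x =
      unip (fun i => (r i : ℂ)) (fun i => (l i : ℂ)) (q : ℂ) *ᵥ x := by
  have := unip_map Complex.ofRealHom r l q
  exact congrArg (· *ᵥ x) this

theorem cmul_diagEnds (a b : ℝ) (h : Matrix (Idx0 n) (Idx0 n) ℝ) (x : Idx1 n → ℂ) :
    cmul (diagEnds a h b) x =
      diagEnds (a : ℂ) (h.map Complex.ofRealHom) (b : ℂ) *ᵥ x := by
  have := diagEnds_map Complex.ofRealHom a b h
  exact congrArg (· *ᵥ x) this

/-- An Iwasawa decomposition. The outer diagonal element sends `I` to `t I`, and the inner one to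
`(i f, 0, i v)` if `t² = f v`. The middle translation produces the imaginary part of `z`, and the
outer translation adds `Re Z`. -/
theorem exists_act_basePoint (hS : S.IsSymm)
    (hpos : (S.map (fun k : ℤ => (k : ℝ))).PosDef) {Z : Idx0 n → ℂ} (hZ : Z ∈ tubeDomain S) :
    ∃ M, InG0 S M ∧ act S M (basePoint n) = Z := by
  set y := imPart Z with hy
  set v : ℝ := last y with hv
  have hprod := im_head_mul_im_last hpos hZ.2
  have hv0 : 0 < v := (mul_pos_iff_of_pos_left hZ.1).mp hprod
  set T : Matrix (Fin n) (Fin n) ℝ := S.map (fun k : ℤ => (k : ℝ)) with hT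
  set m : Fin n → ℝ := v⁻¹ • mid y with hm
  set f : ℝ := head y - (1 / 2) * (m ⬝ᵥ (T *ᵥ m)) * v with hf
  have hmm : (mid y) ⬝ᵥ (T *ᵥ mid y) = v ^ 2 * (m ⬝ᵥ (T *ᵥ m)) := by
    rw [hm, mulVec_smul, dotProduct_smul, smul_dotProduct, smul_eq_mul, smul_eq_mul]
    field_simp
  have hQ : Q0 S y = f * v := by
    rw [Q0, S0_form, hmm, hf]
    ring
  have hf0 : 0 < f := (mul_pos_iff_of_pos_right hv0).mp (hQ ▸ hZ.2)
  set t : ℝ := Real.sqrt (f * v) with ht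
  have ht0 : 0 < t := Real.sqrt_pos.mpr (mul_pos hf0 hv0)
  have ht2 : t * t = f * v := Real.mul_self_sqrt (mul_pos hf0 hv0).le
  have ha0 : 0 < t / v := div_pos ht0 hv0
  set x : Idx0 n → ℝ := fun i => (Z i).re with hx
  refine ⟨_, (inG0_translation hS x).mul ((inG0_middle_translation hS m).mul
    ((inG0_middle_diagonal ha0).mul (inG0_diagonal ht0))), ?_⟩
  have htC : (t : ℂ) ≠ 0 := by exact_mod_cast ht0.ne'
  have hvC : (v : ℂ) ≠ 0 := by exact_mod_cast hv0.ne'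
  have htC2 : (t : ℂ) * t = f * v := by exact_mod_cast ht2
  rw [← hT]
  refine act_eq_of_cmul (k := (t : ℂ)⁻¹) (inv_ne_zero htC) ?_ ?_
  · rw [cmul_mul, cmul_mul, cmul_mul, cmul_unip, unip_mulVec_mid]
    simp only [cmul_diagEnds, diagEnds_mulVec_mid, diagEnds_mulVec_last]
    rw [diagEnds_map, unip_map, Matrix.map_one _ (map_zero _) (map_one _),
      Matrix.map_one _ (map_zero _) (map_one _), one_mulVec]
    have b1 : mid (hat S (basePoint n)) = basePoint n := rfl
    have b2 : last (hat S (basePoint n)) = 1 := rfl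
    have b3 : head (basePoint n) = Complex.I := rfl
    have b4 : mid (basePoint n) = 0 := rfl
    have b5 : last (basePoint n) = Complex.I := rfl
    rw [b1, b2]
    refine ends_ext ?_ ?_ ?_
    · have : head ((unip (Complex.ofRealHom ∘ (T *ᵥ m)) (Complex.ofRealHom ∘ m)
          (Complex.ofRealHom (1 / 2 * m ⬝ᵥ T *ᵥ m))) *ᵥ
          diagEnds (Complex.ofRealHom (t / v)) 1 (Complex.ofRealHom (t / v)⁻¹) *ᵥ basePoint n) =
          (t / v) * Complex.I + (1 / 2) * ((m ⬝ᵥ T *ᵥ m : ℝ) : ℂ) * (v / t) * Complex.I := by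
        rw [unip_mulVec_head, diagEnds_mulVec_head, diagEnds_mulVec_mid, diagEnds_mulVec_last,
          b3, b4, b5, one_mulVec, dotProduct_zero]
        simp
        ring
      rw [head_add, this]
      change _ + _ * ((x (Sum.inl ()) : ℝ) : ℂ) = (t : ℂ)⁻¹ * Z (Sum.inl ())
      have hz : Z (Sum.inl ()) = ((x (Sum.inl ()) : ℝ) : ℂ) + ((head y : ℝ) : ℂ) * Complex.I :=
        (Complex.re_add_im _).symm
      have hfC : ((head y : ℝ) : ℂ) = f + (1 / 2) * ((m ⬝ᵥ T *ᵥ m : ℝ) : ℂ) * v := by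
        rw [hf]; push_cast; ring
      rw [hz, hfC]
      push_cast
      field_simp
      linear_combination (2 * Complex.I) * htC2
    · funext i
      have : mid ((unip (Complex.ofRealHom ∘ (T *ᵥ m)) (Complex.ofRealHom ∘ m)
          (Complex.ofRealHom (1 / 2 * m ⬝ᵥ T *ᵥ m))) *ᵥ
          diagEnds (Complex.ofRealHom (t / v)) 1 (Complex.ofRealHom (t / v)⁻¹) *ᵥ basePoint n) i =
          (v / t) * Complex.I * m i := by
        rw [unip_mulVec_mid, diagEnds_mulVec_mid, diagEnds_mulVec_last, b4, b5, one_mulVec]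
        simp
      rw [mid_add, Pi.add_apply, this]
      change _ + _ * ((x (Sum.inr (Sum.inl i)) : ℝ) : ℂ) = (t : ℂ)⁻¹ * Z (Sum.inr (Sum.inl i))
      have hz : Z (Sum.inr (Sum.inl i)) =
          ((x (Sum.inr (Sum.inl i)) : ℝ) : ℂ) + ((mid y i : ℝ) : ℂ) * Complex.I :=
        (Complex.re_add_im _).symm
      have hmi : (m i : ℂ) = (v : ℂ)⁻¹ * (mid y i : ℝ) := by rw [hm]; simp
      rw [hz, hmi]
      push_cast
      field_simp
      ring
    · have : last ((unip (Complex.ofRealHom ∘ (T *ᵥ m)) (Complex.ofRealHom ∘ m)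
          (Complex.ofRealHom (1 / 2 * m ⬝ᵥ T *ᵥ m))) *ᵥ
          diagEnds (Complex.ofRealHom (t / v)) 1 (Complex.ofRealHom (t / v)⁻¹) *ᵥ basePoint n) =
          (v / t) * Complex.I := by
        rw [unip_mulVec_last, diagEnds_mulVec_last, b5]
        simp
      rw [last_add, this]
      change _ + _ * ((x (Sum.inr (Sum.inr ())) : ℝ) : ℂ) = (t : ℂ)⁻¹ * Z (Sum.inr (Sum.inr ()))
      have hz : Z (Sum.inr (Sum.inr ())) =
          ((x (Sum.inr (Sum.inr ())) : ℝ) : ℂ) + (v : ℂ) * Complex.I :=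
        (Complex.re_add_im _).symm
      rw [hz]
      push_cast
      field_simp
      ring
  · rw [cmul_mul, cmul_mul, cmul_mul, cmul_unip, unip_mulVec_last]
    simp only [cmul_diagEnds, diagEnds_mulVec_last]
    simp [hat, last]

theorem Q0_basePoint : Q0 S (imPart (basePoint n)) = 1 := by
  have b3 : head (imPart (basePoint n)) = 1 := by simp [head, imPart, basePoint]
  have b4 : mid (imPart (basePoint n)) = 0 := by funext i; simp [mid, imPart, basePoint]
  have b5 : last (imPart (basePoint n)) = 1 := by simp [last, imPart, basePoint]
  rw [Q0, S0_form, b3, b4, b5]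
  simp
  norm_num

/-- The plane of `I` is fixed pointwise by `S₁` and has Gram matrix `2 · 1`, so the majorant is `A
Aᵗ - S₁`. -/
theorem majorantOf_basePoint (hS : S.IsSymm) :
    majorantOf S (reIm (hat S (basePoint n))) = baseMajorant S := by
  have hh : head (hat S (basePoint n)) = 1 := by
    have b3 : head (basePoint n) = Complex.I := rfl
    have b4 : mid (basePoint n) = 0 := rfl
    have b5 : last (basePoint n) = Complex.I := rfl
    change -(1 / 2) * (basePoint n ⬝ᵥ (S0 S ℂ *ᵥ basePoint n)) = 1
    rw [S0_form, b3, b4, b5]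
    simp
    norm_num
  have hhI : hat S (basePoint n) = Sum.elim (fun _ => 1) (Sum.elim (basePoint n) fun _ => 1) := by
    refine ends_ext hh rfl rfl
  have hA : S1 S ℝ * reIm (hat S (basePoint n)) = reIm (hat S (basePoint n)) := by
    rw [hhI]
    ext i j
    rcases i with ⟨⟩ | (⟨⟩ | i | ⟨⟩) | ⟨⟩ <;> fin_cases j <;>
      simp [mul_apply, Fintype.sum_sum_type, S1, S0, hyp, reIm, basePoint]
  have hA' : (reIm (hat S (basePoint n)))ᵀ * S1 S ℝ = (reIm (hat S (basePoint n)))ᵀ := by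
    rw [← (S1_isSymm hS ℝ).eq, ← transpose_mul, hA]
  rw [majorantOf, bracket_hat hS, Q0_basePoint, hA, Matrix.mul_assoc _ _ (S1 S ℝ), hA']
  have hinv : ((2 * 1 : ℝ) • (1 : Matrix (Fin 2) (Fin 2) ℝ))⁻¹ = (1 / 2 : ℝ) • 1 := by
    refine inv_eq_left_inv ?_
    rw [smul_mul_smul_comm, Matrix.one_mul]
    norm_num
  have htwo : ∀ M : Matrix (Idx1 n) (Idx1 n) ℝ, 2 • ((1 / 2 : ℝ) • M) = M := by
    intro M
    module
  rw [hinv, Matrix.mul_smul, Matrix.mul_one, Matrix.smul_mul, htwo, hhI]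
  ext i j
  rcases i with ⟨⟩ | (⟨⟩ | i | ⟨⟩) | ⟨⟩ <;> rcases j with ⟨⟩ | (⟨⟩ | j | ⟨⟩) | ⟨⟩ <;>
    simp [mul_apply, S1, S0, hyp, reIm, basePoint, baseMajorant, Fin.sum_univ_two]

/-- If `δ⟨I⟩ = Z`, then `δ` carries the plane of `I` to that of `Z`, the two vectors differing by
the scalar `j(δ, I)`. Equivariance and independence of the basis give the same majorant for every
such `δ`; transitivity shows that the set is not empty. -/
theorem transportedMajorants_eq (hS : S.IsSymm)
    (hpos : (S.map (fun k : ℤ => (k : ℝ))).PosDef) {Z : Idx0 n → ℂ} (hZ : Z ∈ tubeDomain S) :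
    transportedMajorants S Z = {majorantOf S (reIm (hat S Z))} := by
  have hI : 0 < Q0 S (imPart (basePoint n)) := by rw [Q0_basePoint]; norm_num
  have key : ∀ g ∈ groupG0 S, act S (g : Matrix (Idx1 n) (Idx1 n) ℝ) (basePoint n) = Z →
      bracket (baseMajorant S)
        ((g⁻¹ : SpecialLinearGroup (Idx1 n) ℝ) : Matrix (Idx1 n) (Idx1 n) ℝ) =
      majorantOf S (reIm (hat S Z)) := by
    intro g hg h
    have hgb := groupG0_bracket hg
    have h1 := cmul_hat hS hpos hgb hI
    have h2 := autFactor_ne_zero hS hpos hgb hI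
    rw [h] at h1
    have h3 := congrArg (fun x => majorantOf S (reIm x)) h1
    simp only [reIm_cmul, reIm_smul] at h3
    have h4 : (g : Matrix (Idx1 n) (Idx1 n) ℝ) *
        ((g⁻¹ : SpecialLinearGroup (Idx1 n) ℝ) : Matrix (Idx1 n) (Idx1 n) ℝ) = 1 :=
      congrArg Subtype.val (mul_inv_cancel g)
    rw [majorantOf_mul_left hgb h4, majorantOf_mul_right, majorantOf_basePoint hS] at h3
    · exact h3
    · rw [det_mulMatrix]
      exact (Complex.normSq_pos.mpr h2).ne'.isUnit
  ext R
  constructor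
  · rintro ⟨g, hg, h, rfl⟩
    exact key g hg h
  · rintro rfl
    obtain ⟨M, ⟨g, hg, rfl⟩, h⟩ := exists_act_basePoint hS hpos hZ
    exact ⟨g, hg, h, (key g hg h).symm⟩

/-- The quotient of the heights in terms of the linear action. -/
theorem height_quotient (hS : S.IsSymm)
    (hpos : (S.map (fun k : ℤ => (k : ℝ))).PosDef) {Z : Idx0 n → ℂ} (hZ : Z ∈ tubeDomain S)
    (γ : GammaS S) : 0 < heightQ S Z γ ∧ 0 < imTau S Z γ ∧
      imTau S Z γ / heightQ S Z γ = |delta (cmul (toReal γ) (hat S Z))| / Q0 S (imPart Z) := by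
  obtain ⟨g, hg, h⟩ := toReal_mem γ
  have hb := bracket_toReal γ
  have hmem := act_mem_tubeDomain hS hpos hg hZ
  rw [h] at hmem
  have hN := Complex.normSq_pos.mpr (autFactor_ne_zero hS hpos hb hZ.2)
  have h1 : 0 < heightQ S Z γ := hmem.2
  have h2 : 0 < imTau S Z γ :=
    (mul_pos_iff_of_pos_left hmem.1).mp (im_head_mul_im_last hpos hmem.2)
  refine ⟨h1, h2, ?_⟩
  rw [delta_cmul_hat hS hpos hb hZ.2, ← Q0_act hS hpos hb hZ.2]
  change _ = |_ * imTau S Z γ| / (_ * heightQ S Z γ)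
  rw [abs_of_pos (mul_pos hN h2), mul_div_mul_left _ _ hN.ne']

theorem height_quotient_coset (hS : S.IsSymm)
    (hpos : (S.map (fun k : ℤ => (k : ℝ))).PosDef) {Z : Idx0 n → ℂ} (hZ : Z ∈ tubeDomain S)
    (p : GammaS S) (hp : p ∈ GammaSJ S) (γ : GammaS S) :
    heightQ S Z (p * γ) / imTau S Z (p * γ) = heightQ S Z γ / imTau S Z γ := by
  have h1 := (height_quotient hS hpos hZ γ).2.2
  have h2 := (height_quotient hS hpos hZ (p * γ)).2.2
  rw [toReal_mul, cmul_mul, abs_delta_cmul p hp, ← h1] at h2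
  rw [← inv_div, h2, inv_div]

end Transitive

/-! ### Cosets of `Γ_{S,J}` and primitive isotropic pairs -/

section Bijection

variable {n : ℕ} {S : Matrix (Fin n) (Fin n) ℤ}

/-- The matrix `(e₁ e₂)` over a ring `R`. -/
def baseCols (n : ℕ) (R : Type) [CommRing R] : Matrix (Idx1 n) (Fin 2) R :=
  (firstTwoCols n).map (fun k : ℤ => (k : R))

/-- The matrix whose rows are the last and the last but one unit vectors. -/
def lastRows (n : ℕ) (R : Type) [CommRing R] : Matrix (Fin 2) (Idx1 n) R :=
  of ![Pi.single (Sum.inr (Sum.inr ())) 1, Pi.single (Sum.inr (Sum.inl (Sum.inr (Sum.inr ())))) 1]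

theorem baseCols_int : baseCols n ℤ = firstTwoCols n := by
  ext i j
  simp [baseCols]

theorem baseCols_transpose_mul_S1 (R : Type) [CommRing R] :
    (baseCols n R)ᵀ * S1 S R = lastRows n R := by
  ext i j
  fin_cases i <;> rcases j with ⟨⟩ | (⟨⟩ | j | ⟨⟩) | ⟨⟩ <;>
    simp [baseCols, firstTwoCols, mul_apply, S1, S0, hyp, Pi.single_apply,
      lastRows]

theorem baseCols_transpose_mul (R : Type) [CommRing R] :
    (baseCols n R)ᵀ * baseCols n R = 1 := by
  ext i j
  fin_cases i <;> fin_cases j <;>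
    simp [baseCols, firstTwoCols, mul_apply, Pi.single_apply]

theorem bracket_baseCols (R : Type) [CommRing R] : bracket (S1 S R) (baseCols n R) = 0 := by
  rw [bracket, baseCols_transpose_mul_S1]
  ext i j
  fin_cases i <;> fin_cases j <;>
    simp [baseCols, firstTwoCols, mul_apply, Pi.single_apply, lastRows]

/-- The columns of `γ⁻¹ (e₁ e₂)`. -/
def planeCols (γ : GammaS S) : Matrix (Idx1 n) (Fin 2) ℤ :=
  ((γ⁻¹ : GammaS S) : SpecialLinearGroup (Idx1 n) ℤ).1 * firstTwoCols n

theorem bracket_intMatrix (γ : GammaS S) :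
    bracket (S1 S ℤ) (γ : SpecialLinearGroup (Idx1 n) ℤ).1 = S1 S ℤ := by
  have h := bracket_map (Int.castRingHom ℝ) (S1 S ℤ) (γ : SpecialLinearGroup (Idx1 n) ℤ).1
  rw [S1_map] at h
  have h2 := bracket_toReal γ
  change bracket (S1 S ℝ) ((γ : SpecialLinearGroup (Idx1 n) ℤ).1.map (Int.castRingHom ℝ)) = _ at h2
  rw [h2, ← S1_map (Int.castRingHom ℝ)] at h
  exact Matrix.map_injective (RingHom.injective_int _) h

theorem intMatrix_mul_inv (γ : GammaS S) : (γ : SpecialLinearGroup (Idx1 n) ℤ).1 *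
    ((γ⁻¹ : GammaS S) : SpecialLinearGroup (Idx1 n) ℤ).1 = 1 :=
  congrArg (fun g : GammaS S => g.1.1) (mul_inv_cancel γ)

theorem intMatrix_inv_mul (γ : GammaS S) : ((γ⁻¹ : GammaS S) : SpecialLinearGroup (Idx1 n) ℤ).1 *
    (γ : SpecialLinearGroup (Idx1 n) ℤ).1 = 1 :=
  congrArg (fun g : GammaS S => g.1.1) (inv_mul_cancel γ)

theorem planeCols_mem (γ : GammaS S) :
    IsPrimitiveMat (planeCols γ) ∧ bracket (S1 S ℤ) (planeCols γ) = 0 := by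
  constructor
  · refine ⟨⟨_, _, intMatrix_mul_inv γ, intMatrix_inv_mul γ⟩, 1, ?_⟩
    rw [Units.val_one, Matrix.mul_one, planeCols, ← Matrix.mul_assoc, intMatrix_mul_inv,
      Matrix.one_mul]
  · rw [planeCols, bracket_mul, bracket_intMatrix, ← baseCols_int, bracket_baseCols]

theorem planeCols_map (γ : GammaS S) :
    (planeCols γ).map (fun k : ℤ => (k : ℝ)) = toReal γ⁻¹ * baseCols n ℝ :=
  Matrix.map_mul (f := Int.castRingHom ℝ)

/-- For `ℓ = γ⁻¹ (e₁ e₂)` the isometry moves across the form: `ℓᵗ S₁ A = (e₁ e₂)ᵗ S₁ γ A`, whose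
determinant is `Δ(γx)`. -/
theorem det_bracket_planeCols (hS : S.IsSymm) (x : Idx1 n → ℂ) (γ : GammaS S) :
    (bracket (majorantOf S (reIm x)) ((planeCols γ).map (fun k : ℤ => (k : ℝ)))).det =
      4 * delta (cmul (toReal γ) x) ^ 2 / (bracket (S1 S ℝ) (reIm x)).det := by
  have h1 : bracket (S1 S ℝ) ((planeCols γ).map (fun k : ℤ => (k : ℝ))) = 0 := by
    rw [planeCols_map, bracket_mul, bracket_toReal, bracket_baseCols]
  rw [det_bracket_majorantOf hS h1, delta_eq_det (S := S)]
  have h2 : (toReal γ⁻¹)ᵀ * S1 S ℝ = S1 S ℝ * toReal γ := by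
    nth_rewrite 2 [← bracket_toReal γ⁻¹]
    rw [bracket, Matrix.mul_assoc, toReal_inv_mul, Matrix.mul_one]
  rw [planeCols_map, transpose_mul, Matrix.mul_assoc (baseCols n ℝ)ᵀ, h2, reIm_cmul]
  simp only [baseCols, Matrix.mul_assoc]

theorem IsPrimitiveMat.exists_mul_eq_one {l : Matrix (Idx1 n) (Fin 2) ℤ} (hl : IsPrimitiveMat l) :
    ∃ L : Matrix (Fin 2) (Idx1 n) ℤ, L * l = 1 := by
  obtain ⟨U, V, h⟩ := hl
  have hV : (V : Matrix (Fin 2) (Fin 2) ℤ) * ((V⁻¹ : GL (Fin 2) ℤ) : Matrix (Fin 2) (Fin 2) ℤ) = 1 :=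
    Units.mul_inv V
  generalize ((V⁻¹ : GL (Fin 2) ℤ) : Matrix (Fin 2) (Fin 2) ℤ) = v' at hV
  generalize (V : Matrix (Fin 2) (Fin 2) ℤ) = v at hV h
  generalize (U : Matrix (Idx1 n) (Idx1 n) ℤ) = u at h
  rw [← baseCols_int] at h
  refine ⟨v * (baseCols n ℤ)ᵀ * u, ?_⟩
  have h2 : u * l = baseCols n ℤ * v' := by
    rw [← h, Matrix.mul_assoc, hV, Matrix.mul_one]
  rw [Matrix.mul_assoc, h2, Matrix.mul_assoc, ← Matrix.mul_assoc (baseCols n ℤ)ᵀ,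
    baseCols_transpose_mul, Matrix.one_mul, hV]

/-- Two primitive matrices that span the same plane over a field differ by a unimodular factor. -/
theorem primitive_eq_mul {K : Type} [Field K] [CharZero K] {l m : Matrix (Idx1 n) (Fin 2) ℤ}
    (hl : IsPrimitiveMat l) (hm : IsPrimitiveMat m) {C : Matrix (Fin 2) (Fin 2) K}
    (h : m.map (Int.castRingHom K) = l.map (Int.castRingHom K) * C) :
    ∃ U : GL (Fin 2) ℤ, m = l * (U : Matrix (Fin 2) (Fin 2) ℤ) := by
  obtain ⟨L, hL⟩ := hl.exists_mul_eq_one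
  obtain ⟨M, hM⟩ := hm.exists_mul_eq_one
  -- If `m = l C` over the field, an integral left inverse `L` of `l` shows that `C = L m` is
  -- integral; exchanging the roles of the two matrices gives the inverse `M l`.
  have hmN : m = l * (L * m) := by
    refine Matrix.map_injective (RingHom.injective_int (Int.castRingHom K)) ?_
    change m.map _ = (l * (L * m)).map (Int.castRingHom K)
    have k : L.map (Int.castRingHom K) * l.map (Int.castRingHom K) = 1 := by
      rw [← Matrix.map_mul, hL, Matrix.map_one _ (map_zero _) (map_one _)]
    rw [Matrix.map_mul, Matrix.map_mul, h, ← Matrix.mul_assoc (L.map _), k, Matrix.one_mul]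
  have hunit : (M * l) * (L * m) = 1 := by
    rw [Matrix.mul_assoc, ← hmN, hM]
  exact ⟨⟨L * m, M * l, mul_eq_one_comm.mp hunit, hunit⟩, hmN⟩

theorem lastRows_mul_of_blockTriangular {R : Type} [CommRing R] {M : Matrix (Idx1 n) (Idx1 n) R}
    (hM : BlockTriangular M lastTwo) :
    ∃ D : Matrix (Fin 2) (Fin 2) R, lastRows n R * M = D * lastRows n R := by
  have h0 : ∀ i j, lastTwo i = 1 → lastTwo j = 0 → M i j = 0 :=
    fun i j hi hj => hM (by rw [hi, hj]; norm_num)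
  let e : Idx1 n := Sum.inr (Sum.inr ())
  let f : Idx1 n := Sum.inr (Sum.inl (Sum.inr (Sum.inr ())))
  refine ⟨!![M e e, M e f; M f e, M f f], ?_⟩
  ext i j
  fin_cases i <;> rcases j with ⟨⟩ | (⟨⟩ | j | ⟨⟩) | ⟨⟩ <;>
    simp [lastRows, mul_apply, Fin.sum_univ_two, Pi.single_apply, e, f] <;> exact h0 _ _ rfl rfl

theorem toReal_blockTriangular {p : GammaS S} (hp : p ∈ GammaSJ S) :
    BlockTriangular (toReal p) lastTwo := by
  intro i j hij
  have h : ((p : SpecialLinearGroup (Idx1 n) ℤ) : Matrix (Idx1 n) (Idx1 n) ℤ) i j = 0 := hp hij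
  simp [toReal, h]

/-- The zero pattern of `p` says that the last two coordinate functionals span a stable space. These
functionals are `(e₁ e₂)ᵗ S₁`, so dually `p⁻¹` preserves the real plane `⟨e₁, e₂⟩`; primitivity
makes the base change unimodular. -/
theorem exists_planeCols_mul (hS : S.IsSymm) (hpos : (S.map (fun k : ℤ => (k : ℝ))).PosDef)
    {p : GammaS S} (hp : p ∈ GammaSJ S) (γ : GammaS S) :
    ∃ U : GL (Fin 2) ℤ, planeCols (p * γ) = planeCols γ * (U : Matrix (Fin 2) (Fin 2) ℤ) := by
  obtain ⟨D, hD⟩ := lastRows_mul_of_blockTriangular (toReal_blockTriangular hp)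
  have hu : IsUnit (S1 S ℝ).det := (det_S1_ne_zero hpos).isUnit
  have key : toReal p⁻¹ * baseCols n ℝ = baseCols n ℝ * Dᵀ := by
    have h1 := congrArg transpose hD
    rw [transpose_mul, transpose_mul, ← baseCols_transpose_mul_S1 (S := S),
      transpose_mul, transpose_transpose, (S1_isSymm hS ℝ).eq] at h1
    have h2 : (toReal p)ᵀ * S1 S ℝ = S1 S ℝ * toReal p⁻¹ := by
      nth_rewrite 2 [← bracket_toReal p]
      rw [bracket, Matrix.mul_assoc _ (toReal p), toReal_mul_inv, Matrix.mul_one]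
    rw [← Matrix.mul_assoc, h2] at h1
    have h3 := congrArg (fun M => (S1 S ℝ)⁻¹ * M) h1
    simp only [Matrix.mul_assoc] at h3
    simpa only [nonsing_inv_mul_cancel_left _ _ hu] using h3
  refine primitive_eq_mul (K := ℝ) (planeCols_mem γ).1 (planeCols_mem (p * γ)).1 (C := Dᵀ) ?_
  change (planeCols (p * γ)).map (fun k : ℤ => (k : ℝ)) =
    (planeCols γ).map (fun k : ℤ => (k : ℝ)) * Dᵀ
  rw [planeCols_map, planeCols_map, _root_.mul_inv_rev, toReal_mul, Matrix.mul_assoc, key,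
    Matrix.mul_assoc]

/-- The map from the cosets to the classes of primitive isotropic matrices. -/
noncomputable def cosetToX (S : Matrix (Fin n) (Fin n) ℤ) (q : Cosets S) : XModGL S :=
  Quotient.mk (setoidX S) ⟨planeCols q.out, planeCols_mem q.out⟩

/-- If the two matrices differ by `U`, then `(γ₂ γ₁⁻¹)⁻¹` maps `(e₁ e₂)` to `(e₁ e₂) U`. Dualizing
with `S₁`, the last two rows of `γ₂ γ₁⁻¹` vanish outside the last two columns. -/
theorem cosetToX_injective : Function.Injective (cosetToX S) := by
  intro q₁ q₂ h
  obtain ⟨U, hU⟩ : ∃ U : GL (Fin 2) ℤ, planeCols q₂.out =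
      planeCols q₁.out * (U : Matrix (Fin 2) (Fin 2) ℤ) := Quotient.exact h
  set γ₁ := q₁.out
  set γ₂ := q₂.out
  have key : γ₂ * γ₁⁻¹ ∈ GammaSJ S := by
    set M := ((γ₂ * γ₁⁻¹ : GammaS S) : SpecialLinearGroup (Idx1 n) ℤ).1 with hM
    set M' := (((γ₂ * γ₁⁻¹)⁻¹ : GammaS S) : SpecialLinearGroup (Idx1 n) ℤ).1 with hM'
    have e1 : M' * baseCols n ℤ = baseCols n ℤ * (U : Matrix (Fin 2) (Fin 2) ℤ) := by
      have : M' = γ₁.1.1 * ((γ₂⁻¹ : GammaS S) : SpecialLinearGroup (Idx1 n) ℤ).1 := by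
        rw [hM', _root_.mul_inv_rev, inv_inv]
        rfl
      rw [this, baseCols_int, Matrix.mul_assoc]
      change γ₁.1.1 * planeCols γ₂ = _
      rw [hU, planeCols, ← Matrix.mul_assoc, ← Matrix.mul_assoc, intMatrix_mul_inv, Matrix.one_mul]
    have e2 : S1 S ℤ * M = M'ᵀ * S1 S ℤ := by
      nth_rewrite 2 [← bracket_intMatrix (γ₂ * γ₁⁻¹)]
      rw [bracket, ← Matrix.mul_assoc, ← Matrix.mul_assoc, ← transpose_mul, ← hM, hM,
        intMatrix_mul_inv, transpose_one, Matrix.one_mul]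
    have e3 : lastRows n ℤ * M = (U : Matrix (Fin 2) (Fin 2) ℤ)ᵀ * lastRows n ℤ := by
      rw [← baseCols_transpose_mul_S1 (S := S), Matrix.mul_assoc, e2, ← Matrix.mul_assoc,
        ← transpose_mul, e1, transpose_mul, Matrix.mul_assoc]
    have r0 : ∀ j, M (Sum.inr (Sum.inr ())) j = (lastRows n ℤ * M) 0 j := by
      intro j
      simp [lastRows, mul_apply, Pi.single_apply]
    have r1 : ∀ j, M (Sum.inr (Sum.inl (Sum.inr (Sum.inr ())))) j = (lastRows n ℤ * M) 1 j := by
      intro j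
      simp [lastRows, mul_apply, Pi.single_apply]
    intro i j hij
    change M i j = 0
    rcases i with ⟨⟩ | (⟨⟩ | i | ⟨⟩) | ⟨⟩ <;> rcases j with ⟨⟩ | (⟨⟩ | j | ⟨⟩) | ⟨⟩ <;>
      simp [lastTwo] at hij <;> (first | rw [r0, e3] | rw [r1, e3]) <;>
      simp [lastRows, mul_apply]
  have : QuotientGroup.rightRel (GammaSJ S) γ₁ γ₂ := QuotientGroup.rightRel_apply.mpr key
  have h2 : Quotient.mk (QuotientGroup.rightRel (GammaSJ S)) γ₁ = Quotient.mk _ γ₂ :=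
    Quotient.sound this
  rwa [Quotient.out_eq, Quotient.out_eq] at h2

/-- The rational plane spanned by the columns of a matrix. -/
noncomputable def planeOf (l : Matrix (Idx1 n) (Fin 2) ℤ) : Submodule ℚ (Idx1 n → ℚ) :=
  LinearMap.range (Matrix.toLin' (l.map (Int.castRingHom ℚ)))

theorem isIsotropicPlane_planeOf {l : Matrix (Idx1 n) (Fin 2) ℤ} (hl : IsPrimitiveMat l)
    (h : bracket (S1 S ℤ) l = 0) : IsIsotropicPlane S (planeOf l) := by
  constructor
  · have hinj : Function.Injective (Matrix.toLin' (l.map (Int.castRingHom ℚ))) := by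
      obtain ⟨L, hL⟩ := hl.exists_mul_eq_one
      have k : L.map (Int.castRingHom ℚ) * l.map (Int.castRingHom ℚ) = 1 := by
        rw [← Matrix.map_mul, hL, Matrix.map_one _ (map_zero _) (map_one _)]
      intro a b hab
      have := congrArg (fun v => L.map (Int.castRingHom ℚ) *ᵥ v) hab
      simpa only [toLin'_apply, mulVec_mulVec, k, one_mulVec] using this
    rw [planeOf, LinearMap.finrank_range_of_inj hinj]
    simp
  · rintro _ ⟨a, rfl⟩ _ ⟨b, rfl⟩
    have hq := congrArg (fun M : Matrix (Fin 2) (Fin 2) ℤ => M.map (Int.castRingHom ℚ)) h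
    simp only [bracket_map, S1_map] at hq
    have : (Matrix.toLin' (l.map (Int.castRingHom ℚ)) a) ⬝ᵥ
        (S1 S ℚ *ᵥ Matrix.toLin' (l.map (Int.castRingHom ℚ)) b) =
        a ⬝ᵥ (bracket (S1 S ℚ) (l.map (Int.castRingHom ℚ)) *ᵥ b) := by
      simp only [toLin'_apply, bracket, ← mulVec_mulVec, dotProduct_mulVec, vecMul_transpose]
    rw [this, hq]
    simp [Matrix.map_zero]

/-- The plane of `l` and the plane `⟨e₁, e₂⟩` lie in the only orbit, so `l` and some `γ⁻¹ (e₁ e₂)`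
span the same rational plane; both are primitive, hence equivalent under `GL₂(ℤ)`. Passing to the
chosen representative of the coset costs another unimodular factor. -/
theorem cosetToX_surjective (hS : S.IsSymm) (hpos : (S.map (fun k : ℤ => (k : ℝ))).PosDef)
    (hcusp : (oneDimCusps S).ncard = 1) : Function.Surjective (cosetToX S) := by
  intro c
  induction c using Quotient.inductionOn with
  | h l =>
  obtain ⟨O, hO⟩ := Set.ncard_eq_one.mp hcusp
  have h1 : IsPrimitiveMat (firstTwoCols n) := ⟨1, 1, by simp⟩
  have h1' : bracket (S1 S ℤ) (firstTwoCols n) = 0 := by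
    rw [← baseCols_int, bracket_baseCols]
  have m1 : planeOrbit S (planeOf (firstTwoCols n)) ∈ oneDimCusps S :=
    ⟨_, isIsotropicPlane_planeOf h1 h1', rfl⟩
  have m2 : planeOrbit S (planeOf l.1) ∈ oneDimCusps S :=
    ⟨_, isIsotropicPlane_planeOf l.2.1 l.2.2, rfl⟩
  rw [hO] at m1 m2
  have m3 : planeOf l.1 ∈ planeOrbit S (planeOf l.1) := by
    refine ⟨1, one_mem _, ?_⟩
    have : ((1 : SpecialLinearGroup (Idx1 n) ℤ) : Matrix (Idx1 n) (Idx1 n) ℤ).map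
        (fun k : ℤ => (k : ℚ)) = 1 :=
      Matrix.map_one (Int.castRingHom ℚ) (map_zero _) (map_one _)
    rw [this, toLin'_one, Submodule.map_id]
  rw [m2.trans m1.symm] at m3
  obtain ⟨g, hg, hW⟩ := m3
  set γ : GammaS S := (⟨g, hg⟩ : GammaS S)⁻¹ with hγ
  have hcols : planeCols γ = (g : Matrix (Idx1 n) (Idx1 n) ℤ) * firstTwoCols n := by
    rw [planeCols, hγ, inv_inv]
  have hplane : planeOf l.1 = planeOf (planeCols γ) := by
    rw [hW, hcols, planeOf, planeOf, ← LinearMap.range_comp, ← toLin'_mul, Matrix.map_mul]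
    rfl
  have hC : ∃ C : Matrix (Fin 2) (Fin 2) ℚ, l.1.map (Int.castRingHom ℚ) =
      (planeCols γ).map (Int.castRingHom ℚ) * C := by
    have : ∀ k, ∃ c : Fin 2 → ℚ, (planeCols γ).map (Int.castRingHom ℚ) *ᵥ c =
        l.1.map (Int.castRingHom ℚ) *ᵥ Pi.single k 1 := by
      intro k
      have hk : l.1.map (Int.castRingHom ℚ) *ᵥ Pi.single k 1 ∈ planeOf l.1 :=
        ⟨Pi.single k 1, toLin'_apply _ _⟩
      rw [hplane] at hk
      obtain ⟨c, hc⟩ := hk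
      exact ⟨c, hc⟩
    choose c hc using this
    refine ⟨(of c)ᵀ, ?_⟩
    ext i k
    have := congrFun (hc k) i
    rw [mulVec_single_one] at this
    exact this.symm
  obtain ⟨C, hC⟩ := hC
  obtain ⟨U, hU⟩ := primitive_eq_mul (planeCols_mem γ).1 l.2.1 hC
  set q : Cosets S := Quotient.mk _ γ with hq
  have hrel : QuotientGroup.rightRel (GammaSJ S) q.out γ := Quotient.exact (Quotient.out_eq q)
  have hp : γ * q.out⁻¹ ∈ GammaSJ S := QuotientGroup.rightRel_apply.mp hrel
  obtain ⟨V, hV⟩ := exists_planeCols_mul hS hpos hp q.out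
  rw [inv_mul_cancel_right] at hV
  refine ⟨q, Quotient.sound ⟨V * U, ?_⟩⟩
  change l.1 = planeCols q.out * _
  rw [hU, hV, Units.val_mul, Matrix.mul_assoc]

end Bijection

/-! ### Uniform estimates on compact families of positive definite planes -/

section Compact

variable {n : ℕ} {S : Matrix (Fin n) (Fin n) ℤ}

theorem bracket_form {ι κ R : Type} [Fintype ι] [Fintype κ] [CommRing R] (T : Matrix ι ι R)
    (B : Matrix ι κ R) (v w : κ → R) :
    v ⬝ᵥ (bracket T B *ᵥ w) = (B *ᵥ v) ⬝ᵥ (T *ᵥ (B *ᵥ w)) := by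
  simp only [bracket, ← mulVec_mulVec, dotProduct_mulVec, vecMul_transpose]

theorem continuous_reIm : Continuous (reIm : (Idx1 n → ℂ) → Matrix (Idx1 n) (Fin 2) ℝ) := by
  refine continuous_matrix fun i j => ?_
  fin_cases j
  · exact Complex.continuous_re.comp (continuous_apply i)
  · exact Complex.continuous_im.comp (continuous_apply i)

theorem continuous_gram : Continuous fun x : Idx1 n → ℂ => bracket (S1 S ℝ) (reIm x) :=
  (continuous_reIm.matrix_transpose.matrix_mul continuous_const).matrix_mul continuous_reIm

theorem continuousOn_majorantOf {K : Set (Idx1 n → ℂ)}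
    (hK : ∀ x ∈ K, (bracket (S1 S ℝ) (reIm x)).PosDef) :
    ContinuousOn (fun x => majorantOf S (reIm x)) K := by
  have hinv : ContinuousOn (fun x => (bracket (S1 S ℝ) (reIm x))⁻¹) K := by
    intro x hx
    have hu : (bracket (S1 S ℝ) (reIm x)).det ≠ 0 := (hK x hx).det_pos.ne'
    refine ContinuousAt.continuousWithinAt ?_
    refine ContinuousAt.comp (f := fun x : Idx1 n → ℂ => bracket (S1 S ℝ) (reIm x)) ?_
      continuous_gram.continuousAt
    refine continuousAt_matrix_inv _ ?_
    rw [Ring.inverse_eq_inv']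
    exact continuousAt_inv₀ hu
  have hA := (continuous_reIm (n := n)).continuousOn (s := K)
  unfold majorantOf
  simp_rw [continuousOn_iff_continuous_domRestrict] at *
  exact ((((continuous_const.matrix_mul hA).matrix_mul hinv).matrix_mul
    hA.matrix_transpose).matrix_mul continuous_const).const_smul 2 |>.sub continuous_const

/-- The constants are the minimum and maximum of a continuous positive function on the compact
product of `K` with the unit sphere, extended to all `w` by homogeneity. -/
theorem majorantOf_bounds (hS : S.IsSymm) (hpos : (S.map (fun k : ℤ => (k : ℝ))).PosDef)
    {K : Set (Idx1 n → ℂ)} (hKc : IsCompact K)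
    (hK : ∀ x ∈ K, (bracket (S1 S ℝ) (reIm x)).PosDef) :
    ∃ c > 0, ∃ C > 0, ∀ x ∈ K, ∀ w : Idx1 n → ℝ,
      c * (w ⬝ᵥ w) ≤ w ⬝ᵥ (majorantOf S (reIm x) *ᵥ w) ∧
      w ⬝ᵥ (majorantOf S (reIm x) *ᵥ w) ≤ C * (w ⬝ᵥ w) := by
  rcases K.eq_empty_or_nonempty with rfl | hne
  · exact ⟨1, one_pos, 1, one_pos, by simp⟩
  set sph : Set (Idx1 n → ℝ) := {w | w ⬝ᵥ w = 1} with hsph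
  have hsphc : IsCompact sph := by
    refine Metric.isCompact_of_isClosed_isBounded
      (isClosed_eq (Continuous.dotProduct continuous_id continuous_id) continuous_const) ?_
    refine (Metric.isBounded_closedBall (x := (0 : Idx1 n → ℝ)) (r := 1)).subset ?_
    intro w hw
    rw [mem_closedBall_zero_iff, pi_norm_le_iff_of_nonneg zero_le_one]
    intro i
    have h1 : w i * w i ≤ w ⬝ᵥ w :=
      Finset.single_le_sum (f := fun i => w i * w i) (fun i _ => mul_self_nonneg _)
        (Finset.mem_univ i)
    have h2 : w ⬝ᵥ w = 1 := hw
    rw [Real.norm_eq_abs]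
    nlinarith [abs_nonneg (w i), abs_mul_abs_self (w i)]
  have hsphne : sph.Nonempty := ⟨Pi.single (Sum.inl ()) 1, by simp [hsph]⟩
  have hcont : ContinuousOn (fun p : (Idx1 n → ℂ) × (Idx1 n → ℝ) =>
      p.2 ⬝ᵥ (majorantOf S (reIm p.1) *ᵥ p.2)) (K ×ˢ sph) := by
    have h1 : ContinuousOn (fun p : (Idx1 n → ℂ) × (Idx1 n → ℝ) => majorantOf S (reIm p.1))
        (K ×ˢ sph) :=
      (continuousOn_majorantOf hK).comp continuousOn_fst (fun p hp => hp.1)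
    have h2 : ContinuousOn (fun p : (Idx1 n → ℂ) × (Idx1 n → ℝ) => p.2) (K ×ˢ sph) :=
      continuousOn_snd
    simp_rw [continuousOn_iff_continuous_domRestrict] at *
    exact Continuous.dotProduct h2 (h1.matrix_mulVec h2)
  obtain ⟨p, hp, hmin⟩ := (hKc.prod hsphc).exists_isMinOn (hne.prod hsphne) hcont
  obtain ⟨p', hp', hmax⟩ := (hKc.prod hsphc).exists_isMaxOn (hne.prod hsphne) hcont
  set c := p.2 ⬝ᵥ (majorantOf S (reIm p.1) *ᵥ p.2)
  set C := p'.2 ⬝ᵥ (majorantOf S (reIm p'.1) *ᵥ p'.2)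
  have hposs : ∀ q ∈ K ×ˢ sph, 0 < q.2 ⬝ᵥ (majorantOf S (reIm q.1) *ᵥ q.2) := by
    intro q hq
    refine posDef_form (majorantOf_posDef hS hpos (hK _ hq.1)) ?_
    intro h0
    have : q.2 ⬝ᵥ q.2 = 1 := hq.2
    rw [h0] at this
    simp at this
  refine ⟨c, hposs p hp, C, hposs p' hp', fun x hx w => ?_⟩
  rcases eq_or_ne w 0 with rfl | hw
  · simp
  have hww : 0 < w ⬝ᵥ w := by
    rw [← one_mulVec w]
    simpa using posDef_form (PosDef.one (n := Idx1 n) (R := ℝ)) hw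
  set r := Real.sqrt (w ⬝ᵥ w) with hr
  have hr0 : 0 < r := Real.sqrt_pos.mpr hww
  have hrr : r * r = w ⬝ᵥ w := Real.mul_self_sqrt hww.le
  have hmem : (x, r⁻¹ • w) ∈ K ×ˢ sph := by
    refine ⟨hx, ?_⟩
    change (r⁻¹ • w) ⬝ᵥ (r⁻¹ • w) = 1
    rw [dotProduct_smul, smul_dotProduct, ← hrr, smul_eq_mul, smul_eq_mul]
    field_simp
  have hval : (r⁻¹ • w) ⬝ᵥ (majorantOf S (reIm x) *ᵥ (r⁻¹ • w)) * (w ⬝ᵥ w) =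
      w ⬝ᵥ (majorantOf S (reIm x) *ᵥ w) := by
    rw [mulVec_smul, dotProduct_smul, smul_dotProduct, ← hrr, smul_eq_mul, smul_eq_mul]
    field_simp
  have hm := hmin hmem
  have hM := hmax hmem
  rw [← hval]
  exact ⟨mul_le_mul_of_nonneg_right hm hww.le, mul_le_mul_of_nonneg_right hM hww.le⟩

theorem det_le_det_of_form_le {P Q : Matrix (Fin 2) (Fin 2) ℝ} (hP : P.IsSymm) (hQ : Q.IsSymm)
    (h0 : ∀ v, 0 ≤ v ⬝ᵥ (Q *ᵥ v)) (h : ∀ v, v ⬝ᵥ (Q *ᵥ v) ≤ v ⬝ᵥ (P *ᵥ v)) : Q.det ≤ P.det := by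
  have hform : ∀ (M : Matrix (Fin 2) (Fin 2) ℝ), M.IsSymm → ∀ s t : ℝ,
      ![s, t] ⬝ᵥ (M *ᵥ ![s, t]) = M 0 0 * s ^ 2 + 2 * M 0 1 * s * t + M 1 1 * t ^ 2 := by
    intro M hM s t
    have := hM.apply 0 1
    simp [dotProduct, mulVec, Fin.sum_univ_two, this]
    ring
  have q := fun s t => hform Q hQ s t ▸ h0 ![s, t]
  have pq := fun s t => hform P hP s t ▸ hform Q hQ s t ▸ h ![s, t]
  rw [det_fin_two, det_fin_two, hP.apply 0 1, hQ.apply 0 1]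
  set a := Q 0 0
  set b := Q 0 1
  set d := Q 1 1
  set a' := P 0 0
  set b' := P 0 1
  set d' := P 1 1
  have ha : 0 ≤ a := by simpa using q 1 0
  have haa : a ≤ a' := by simpa using pq 1 0
  have hdet : ∀ a b d : ℝ, (∀ s t, 0 ≤ a * s ^ 2 + 2 * b * s * t + d * t ^ 2) → 0 ≤ a * d - b * b := by
    intro a b d hq
    by_contra! hneg
    rcases eq_or_ne a 0 with h0 | h0
    · have hb : b ≠ 0 := by
        rintro rfl
        rw [h0] at hneg
        simp at hneg
      have h1 := hq (-(d + 1) / (2 * b)) 1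
      have h2 : 2 * b * (-(d + 1) / (2 * b)) = -(d + 1) := by field_simp
      rw [h0, h2] at h1
      linarith
    · have h1 := hq (-b) a
      have h2 : 0 < a := lt_of_le_of_ne (by simpa using hq 1 0) h0.symm
      nlinarith
  have hQ0 := hdet a b d q
  rcases ha.eq_or_lt with h1 | h1
  · have hP0 := hdet a' b' d' (fun s t => (q s t).trans (pq s t))
    rw [← h1]
    nlinarith [mul_self_nonneg b]
  -- The vector `(-b', a')` is orthogonal to the first basis vector for `P`, so `P` takes the value
  -- `a' det P` there. Multiplying the inequality by `a` and completing the square bounds `a'² det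
  -- Q` by `a a' det P`.
  · have h2 := pq (-b') a'
    have ha' : 0 < a' := h1.trans_le haa
    have h3 : a' * (a' * (a * d - b * b)) ≤ a' * (a * (a' * d' - b' * b')) := by
      nlinarith [mul_self_nonneg (a * b' - b * a')]
    have h4 := le_of_mul_le_mul_left h3 ha'
    have h5 : a * (a * d - b * b) ≤ a * (a' * d' - b' * b') := by nlinarith
    exact le_of_mul_le_mul_left h5 h1

/-- The Gram determinant of two independent integral columns is a positive integer. -/
theorem one_le_det_planeCols (γ : GammaS S) :
    1 ≤ (((planeCols γ).map (fun k : ℤ => (k : ℝ)))ᵀ *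
      ((planeCols γ).map (fun k : ℤ => (k : ℝ)))).det := by
  set l := planeCols γ with hl
  obtain ⟨L, hL⟩ := (planeCols_mem γ).1.exists_mul_eq_one
  rw [← hl] at hL
  have hinj : Function.Injective (l.map (Int.castRingHom ℝ)).mulVec := by
    have k : L.map (Int.castRingHom ℝ) * l.map (Int.castRingHom ℝ) = 1 := by
      rw [← Matrix.map_mul, hL, Matrix.map_one _ (map_zero _) (map_one _)]
    intro a b hab
    have := congrArg (fun v => L.map (Int.castRingHom ℝ) *ᵥ v) hab
    simpa only [mulVec_mulVec, k, one_mulVec] using this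
  have hpd := (PosDef.conjTranspose_mul_self _ hinj).det_pos
  rw [conjTranspose_eq_transpose_of_trivial, ← transpose_map, ← Matrix.map_mul] at hpd
  have hdet : ((lᵀ * l).map (Int.castRingHom ℝ)).det = (((lᵀ * l).det : ℤ) : ℝ) :=
    (RingHom.map_det (Int.castRingHom ℝ) _).symm
  have : (l.map (fun k : ℤ => (k : ℝ)))ᵀ * (l.map (fun k : ℤ => (k : ℝ))) =
      (lᵀ * l).map (Int.castRingHom ℝ) := by
    rw [Matrix.map_mul, transpose_map]
    rfl
  rw [this, hdet]
  rw [hdet] at hpd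
  have : (0 : ℤ) < (lᵀ * l).det := by exact_mod_cast hpd
  exact_mod_cast this

/-- On a compact set of positive definite planes the values `|Δ(γ x)|` are bounded below and
comparable to each other, uniformly in `γ`. -/
theorem delta_bounds (hS : S.IsSymm) (hpos : (S.map (fun k : ℤ => (k : ℝ))).PosDef)
    {K : Set (Idx1 n → ℂ)} (hKc : IsCompact K)
    (hK : ∀ x ∈ K, (bracket (S1 S ℝ) (reIm x)).PosDef) :
    ∃ c > 0, ∃ C > 0, (∀ x ∈ K, ∀ γ : GammaS S, c ≤ |delta (cmul (toReal γ) x)|) ∧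
      ∀ x ∈ K, ∀ y ∈ K, ∀ γ : GammaS S,
        |delta (cmul (toReal γ) x)| ≤ C * |delta (cmul (toReal γ) y)| := by
  rcases K.eq_empty_or_nonempty with rfl | hne
  · exact ⟨1, one_pos, 1, one_pos, by simp⟩
  obtain ⟨c, hc, C, hC, hb⟩ := majorantOf_bounds hS hpos hKc hK
  have hdc : ContinuousOn (fun x : Idx1 n → ℂ => (bracket (S1 S ℝ) (reIm x)).det) K :=
    (continuous_gram.matrix_det).continuousOn
  obtain ⟨p, hp, hmin⟩ := hKc.exists_isMinOn hne hdc
  obtain ⟨p', hp', hmax⟩ := hKc.exists_isMaxOn hne hdc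
  set d := (bracket (S1 S ℝ) (reIm p)).det with hd
  set D := (bracket (S1 S ℝ) (reIm p')).det with hD
  have hd0 : 0 < d := (hK p hp).det_pos
  have hD0 : 0 < D := (hK p' hp').det_pos
  have hdle : ∀ x ∈ K, d ≤ (bracket (S1 S ℝ) (reIm x)).det := fun x hx => hmin hx
  have hleD : ∀ x ∈ K, (bracket (S1 S ℝ) (reIm x)).det ≤ D := fun x hx => hmax hx
  clear_value d D
  -- The integral determinant `L` depends on `γ` alone and equals `4 Δ(γx)² / det S₁[A]` up to
  -- constants, for all `x ∈ K` simultaneously. The lower bound follows from `L ≥ 1`, the comparison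
  -- by eliminating `L`.
  have main : ∀ x ∈ K, ∀ γ : GammaS S, ∃ L : ℝ, L = (((planeCols γ).map (fun k : ℤ => (k : ℝ)))ᵀ *
      ((planeCols γ).map (fun k : ℤ => (k : ℝ)))).det ∧
      c ^ 2 * L * d ≤ 4 * delta (cmul (toReal γ) x) ^ 2 ∧
      4 * delta (cmul (toReal γ) x) ^ 2 ≤ C ^ 2 * L * D := by
    intro x hx γ
    refine ⟨_, rfl, ?_⟩
    set l := (planeCols γ).map (fun k : ℤ => (k : ℝ)) with hl
    have hL1 : 1 ≤ (lᵀ * l).det := one_le_det_planeCols γ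
    have hx0 : 0 < (bracket (S1 S ℝ) (reIm x)).det := (hK x hx).det_pos
    have e := det_bracket_planeCols hS x γ
    rw [← hl, eq_div_iff hx0.ne'] at e
    have hsymm : (bracket (majorantOf S (reIm x)) l).IsSymm :=
      bracket_transpose (majorantOf_transpose hS _) l
    have hll : ∀ t : ℝ, (t • (lᵀ * l)).IsSymm := by
      intro t
      rw [Matrix.IsSymm, transpose_smul, transpose_mul, transpose_transpose]
    have hform : ∀ (t : ℝ) v, v ⬝ᵥ ((t • (lᵀ * l)) *ᵥ v) = t * ((l *ᵥ v) ⬝ᵥ (l *ᵥ v)) := by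
      intro t v
      rw [smul_mulVec, dotProduct_smul, smul_eq_mul, ← mulVec_mulVec, dotProduct_mulVec,
        vecMul_transpose]
    have hnn : ∀ v : Idx1 n → ℝ, 0 ≤ v ⬝ᵥ v := fun v =>
      Finset.sum_nonneg fun i _ => mul_self_nonneg _
    have h1 := det_le_det_of_form_le hsymm (hll c)
      (fun v => by rw [hform]; exact mul_nonneg hc.le (hnn _))
      (fun v => by rw [hform, bracket_form]; exact (hb x hx _).1)
    have h2 := det_le_det_of_form_le (hll C) hsymm
      (fun v => by
        rw [bracket_form]
        exact posSemidef_form (majorantOf_posDef hS hpos (hK x hx)).posSemidef _)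
      (fun v => by rw [hform, bracket_form]; exact (hb x hx _).2)
    rw [det_smul, Fintype.card_fin] at h1 h2
    have hdx : d ≤ (bracket (S1 S ℝ) (reIm x)).det := hdle x hx
    have hDx : (bracket (S1 S ℝ) (reIm x)).det ≤ D := hleD x hx
    rw [← e]
    constructor
    · exact mul_le_mul h1 hdx hd0.le (le_trans (by positivity) h1)
    · exact mul_le_mul h2 hDx hx0.le (by positivity)
  have hroot : ∀ a b : ℝ, 0 ≤ a → a ^ 2 ≤ b ^ 2 → a ≤ |b| := by
    intro a b ha hab
    have := sq_le_sq.mp hab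
    rwa [abs_of_nonneg ha] at this
  refine ⟨Real.sqrt (c ^ 2 * d / 4), Real.sqrt_pos.mpr (by positivity),
    Real.sqrt (C ^ 2 * D / (c ^ 2 * d)), Real.sqrt_pos.mpr (by positivity), ?_, ?_⟩
  · intro x hx γ
    refine hroot _ _ (Real.sqrt_nonneg _) ?_
    rw [Real.sq_sqrt (by positivity)]
    obtain ⟨L, hL, h1, -⟩ := main x hx γ
    have hL1 : 1 ≤ L := by
      rw [hL]
      exact one_le_det_planeCols γ
    have : c ^ 2 * d * 1 ≤ c ^ 2 * d * L := mul_le_mul_of_nonneg_left hL1 (by positivity)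
    linarith
  · intro x hx y hy γ
    obtain ⟨L, hL, -, h1⟩ := main x hx γ
    obtain ⟨L', hL', h2, -⟩ := main y hy γ
    rw [← hL] at hL'
    subst hL'
    have hkey : delta (cmul (toReal γ) x) ^ 2 ≤
        (Real.sqrt (C ^ 2 * D / (c ^ 2 * d)) * delta (cmul (toReal γ) y)) ^ 2 := by
      rw [mul_pow, Real.sq_sqrt (by positivity), div_mul_eq_mul_div, le_div_iff₀ (by positivity)]
      have h3 := mul_le_mul_of_nonneg_left h2 (show 0 ≤ C ^ 2 * D by positivity)
      have h4 := mul_le_mul_of_nonneg_left h1 (show 0 ≤ c ^ 2 * d by positivity)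
      nlinarith
    have := sq_le_sq.mp hkey
    rwa [abs_mul, abs_of_nonneg (Real.sqrt_nonneg _)] at this

/-- Only finitely many elements of `Γ_S` move a compact set of positive definite planes to a set
that meets it. -/
theorem finite_overlap (hS : S.IsSymm) (hpos : (S.map (fun k : ℤ => (k : ℝ))).PosDef)
    {K : Set (Idx1 n → ℂ)} (hKc : IsCompact K)
    (hK : ∀ x ∈ K, (bracket (S1 S ℝ) (reIm x)).PosDef) :
    {γ : GammaS S | ∃ x ∈ K, cmul (toReal γ) x ∈ K}.Finite := by
  obtain ⟨c, hc, C, hC, hb⟩ := majorantOf_bounds hS hpos hKc hK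
  -- If `x` and `γx` lie in `K`, the majorant of `γx` at `γ e_j` equals that of `x` at `e_j`. So `c
  -- |γ e_j|² ≤ C`, and the integral entries of `γ` are bounded.
  obtain ⟨B, hB⟩ := exists_nat_ge (C / c)
  have hfin : {f : Idx1 n → Idx1 n → ℤ | ∀ i, f i ∈ {g : Idx1 n → ℤ |
      ∀ j, g j ∈ Set.Icc (-(B : ℤ)) B}}.Finite :=
    Set.Finite.pi' fun _ => Set.Finite.pi' fun _ => Set.finite_Icc _ _
  have hinj : Function.Injective (fun (γ : GammaS S) (i j : Idx1 n) => γ.1.1 i j) := by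
    intro γ γ' h
    exact Subtype.ext (Subtype.ext h)
  refine (hfin.preimage hinj.injOn).subset ?_
  rintro γ ⟨x, hx, hy⟩
  have key : ∀ i j, |γ.1.1 i j| ≤ B := by
    intro i j
    set w : Idx1 n → ℝ := Pi.single j 1 with hw
    have h1 := (hb _ hy (toReal γ *ᵥ w)).1
    rw [reIm_cmul, majorantOf_mul_left (bracket_toReal γ) (toReal_mul_inv γ), ← bracket_form,
      ← bracket_mul, toReal_inv_mul] at h1
    have h2 : bracket (majorantOf S (reIm x)) (1 : Matrix (Idx1 n) (Idx1 n) ℝ) =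
      majorantOf S (reIm x) := bracket_one _
    rw [h2] at h1
    have h3 := (hb x hx w).2
    have h4 : w ⬝ᵥ w = 1 := by simp [hw]
    rw [h4, mul_one] at h3
    have h5 : toReal γ *ᵥ w = fun i => (γ.1.1 i j : ℝ) := by
      rw [hw, mulVec_single_one]
      rfl
    have h6 : ((γ.1.1 i j : ℤ) : ℝ) * (γ.1.1 i j : ℝ) ≤ (toReal γ *ᵥ w) ⬝ᵥ (toReal γ *ᵥ w) := by
      rw [h5]
      exact Finset.single_le_sum (f := fun i => (γ.1.1 i j : ℝ) * (γ.1.1 i j : ℝ))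
        (fun i _ => mul_self_nonneg _) (Finset.mem_univ i)
    have h7 : ((γ.1.1 i j : ℤ) : ℝ) * (γ.1.1 i j : ℝ) ≤ C / c := by
      rw [le_div_iff₀ hc]
      nlinarith
    have h8 : γ.1.1 i j * γ.1.1 i j ≤ (B : ℤ) := by exact_mod_cast h7.trans hB
    have h9 : |γ.1.1 i j| ≤ γ.1.1 i j * γ.1.1 i j := by
      rw [← abs_mul_abs_self]
      rcases (abs_nonneg (γ.1.1 i j)).eq_or_lt with h | h
      · rw [← h]; simp
      · nlinarith
    exact h9.trans h8
  exact fun i j => abs_le.mp (key i j)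

end Compact

/-! ### Reduction theory for `Γ_{S,J}` on `ℂ^(n+4)` -/

section Reduction

variable {n : ℕ} {S : Matrix (Fin n) (Fin n) ℤ}

/-- Move `c / d` into the standard fundamental domain of `SL₂(ℤ)` and clear denominators in `|τ| ≥
1`, `|Re τ| ≤ 1/2`. -/
theorem exists_reduced_pair_of_pos {c d : ℂ} (h : 0 < c.im * d.re - c.re * d.im) :
    ∃ g : SpecialLinearGroup (Fin 2) ℤ,
      Complex.normSq (g 1 0 * c + g 1 1 * d) ≤ Complex.normSq (g 0 0 * c + g 0 1 * d) ∧
      2 * |((g 0 0 * c + g 0 1 * d) * (starRingEnd ℂ) (g 1 0 * c + g 1 1 * d)).re| ≤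
        Complex.normSq (g 1 0 * c + g 1 1 * d) := by
  have hd : d ≠ 0 := by
    rintro rfl
    simp at h
  have hdd : 0 < Complex.normSq d := Complex.normSq_pos.mpr hd
  have him : 0 < (c / d).im := by
    rw [Complex.div_im]
    have : c.im * d.re / Complex.normSq d - c.re * d.im / Complex.normSq d =
      (c.im * d.re - c.re * d.im) / Complex.normSq d := by ring
    rw [this]
    positivity
  obtain ⟨g, hg⟩ := ModularGroup.exists_smul_mem_fd ⟨c / d, him⟩
  refine ⟨g, ?_⟩
  set c' := g 0 0 * c + g 0 1 * d with hc'
  set d' := g 1 0 * c + g 1 1 * d with hd'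
  obtain ⟨h1, h2⟩ := hg
  have hval : (((g • (⟨c / d, him⟩ : UpperHalfPlane)) : UpperHalfPlane) : ℂ) = c' / d' := by
    rw [UpperHalfPlane.coe_specialLinearGroup_apply]
    simp only [hc', hd']
    change ((g 0 0 : ℝ) * (c / d) + (g 0 1 : ℝ)) / ((g 1 0 : ℝ) * (c / d) + (g 1 1 : ℝ)) = _
    rw [← mul_div_mul_right _ _ hd]
    congr 1 <;> field_simp <;> push_cast <;> ring
  have hd'0 : d' ≠ 0 := by
    intro h0
    have := (g • (⟨c / d, him⟩ : UpperHalfPlane)).im_pos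
    rw [← UpperHalfPlane.coe_im, hval, h0] at this
    simp at this
  have hdd' : 0 < Complex.normSq d' := Complex.normSq_pos.mpr hd'0
  rw [hval, Complex.normSq_div, le_div_iff₀ hdd', one_mul] at h1
  refine ⟨h1, ?_⟩
  rw [← UpperHalfPlane.coe_re, hval] at h2
  have h3 : c' / d' = (c' * (starRingEnd ℂ) d') / (Complex.normSq d' : ℝ) := by
    rw [Complex.normSq_eq_conj_mul_self]
    have : (starRingEnd ℂ) d' ≠ 0 := (map_ne_zero _).mpr hd'0
    field_simp
  rw [h3, Complex.div_ofReal_re, abs_div, abs_of_pos hdd', div_le_iff₀ hdd'] at h2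
  linarith

theorem exists_reduced_pair {c d : ℂ} (h : c.im * d.re - c.re * d.im ≠ 0) :
    ∃ g : SpecialLinearGroup (Fin 2) ℤ,
      Complex.normSq (g 1 0 * c + g 1 1 * d) ≤ Complex.normSq (g 0 0 * c + g 0 1 * d) ∧
      2 * |((g 0 0 * c + g 0 1 * d) * (starRingEnd ℂ) (g 1 0 * c + g 1 1 * d)).re| ≤
        Complex.normSq (g 1 0 * c + g 1 1 * d) := by
  rcases h.lt_or_gt with h | h
  -- If `c / d` lies in the lower half-plane, pass to complex conjugates: the entries of `g` are
  -- real and both inequalities are invariant.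
  · obtain ⟨g, h1, h2⟩ := exists_reduced_pair_of_pos
      (c := (starRingEnd ℂ) c) (d := (starRingEnd ℂ) d) (by simp; linarith)
    refine ⟨g, ?_⟩
    have e1 : ∀ i, (g i 0 : ℂ) * (starRingEnd ℂ) c + g i 1 * (starRingEnd ℂ) d =
        (starRingEnd ℂ) (g i 0 * c + g i 1 * d) := by
      intro i
      simp
    rw [e1, e1, Complex.normSq_conj, Complex.normSq_conj] at h1
    rw [e1, e1, Complex.normSq_conj, ← map_mul, Complex.conj_re] at h2
    exact ⟨h1, h2⟩
  · exact exists_reduced_pair_of_pos h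

/-- It suffices to realize generators of `SL₂(ℤ)` on the pair `(c, d)`. A translation gives the
upper unipotent matrices, `lowerUnip` the lower ones. -/
theorem exists_GammaSJ_of_SL2 (hS : S.IsSymm)
    (heven : ∀ x : Fin n → ℤ, Even (x ⬝ᵥ Matrix.mulVec S x))
    (g : SpecialLinearGroup (Fin 2) ℤ) :
    ∃ p ∈ GammaSJ S, ∀ x : Idx1 n → ℂ,
      last (mid (cmul (toReal p) x)) = g 0 0 * last (mid x) + g 0 1 * last x ∧
      last (cmul (toReal p) x) = g 1 0 * last (mid x) + g 1 1 * last x := by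
  have upper : ∀ t : ℤ, ∃ p ∈ GammaSJ S, ∀ x : Idx1 n → ℂ,
      last (mid (cmul (toReal p) x)) = last (mid x) + t * last x ∧
      last (cmul (toReal p) x) = last x := by
    intro t
    obtain ⟨p, hp, h⟩ := exists_translation hS heven (Pi.single (Sum.inr (Sum.inr ())) t)
    refine ⟨p, hp, fun x => ⟨?_, (h x).1⟩⟩
    rw [(h x).2.1, last_add]
    simp [last, mul_comm]
  have hmem : g ∈ Subgroup.closure ({ModularGroup.S, ModularGroup.T} :
      Set (SpecialLinearGroup (Fin 2) ℤ)) := by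
    rw [SpecialLinearGroup.SL2Z_generators]
    trivial
  induction hmem using Subgroup.closure_induction with
  | mem g hg =>
    rcases hg with rfl | rfl
    -- The inversion is `T⁻¹ L T⁻¹`, where `L` is the lower unipotent matrix with entry 1.
    · obtain ⟨p, hp, h⟩ := upper (-1)
      obtain ⟨q, hq, h'⟩ := exists_lowerUnip (S := S) 1
      refine ⟨p * (q * p), mul_mem hp (mul_mem hq hp), fun x => ?_⟩
      rw [toReal_mul, toReal_mul, cmul_mul, cmul_mul, (h _).1, (h _).2, (h' _).1, (h' _).2,
        (h _).1, (h _).2]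
      simp [ModularGroup.S]
    · obtain ⟨p, hp, h⟩ := upper 1
      refine ⟨p, hp, fun x => ?_⟩
      rw [(h _).1, (h _).2]
      simp [ModularGroup.T]
  | one => exact ⟨1, one_mem _, fun x => by simp [toReal_one, cmul_one]⟩
  | mul g g' _ _ hg hg' =>
    obtain ⟨p, hp, h⟩ := hg
    obtain ⟨q, hq, h'⟩ := hg'
    refine ⟨p * q, mul_mem hp hq, fun x => ?_⟩
    rw [toReal_mul, cmul_mul, (h _).1, (h _).2, (h' _).1, (h' _).2]
    have e : ∀ i j, (g * g') i j = g i 0 * g' 0 j + g i 1 * g' 1 j := by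
      intro i j
      change (g.1 * g'.1) i j = _
      rw [mul_apply, Fin.sum_univ_two]
    simp only [e]
    push_cast
    constructor <;> ring
  | inv g _ hg =>
    obtain ⟨p, hp, h⟩ := hg
    refine ⟨p⁻¹, inv_mem hp, fun x => ?_⟩
    have h1 := h (cmul (toReal p⁻¹) x)
    rw [← cmul_mul, toReal_mul_inv, cmul_one] at h1
    have hdet : (g 0 0 : ℂ) * g 1 1 - g 0 1 * g 1 0 = 1 := by
      have := g.det_coe
      rw [det_fin_two] at this
      exact_mod_cast this
    have e : (g⁻¹).1 = !![g 1 1, -g 0 1; -g 1 0, g 0 0] := adjugate_fin_two g.1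
    have e00 : g⁻¹ 0 0 = g 1 1 := congrFun (congrFun e 0) 0
    have e01 : g⁻¹ 0 1 = -g 0 1 := congrFun (congrFun e 0) 1
    have e10 : g⁻¹ 1 0 = -g 1 0 := congrFun (congrFun e 1) 0
    have e11 : g⁻¹ 1 1 = g 0 0 := congrFun (congrFun e 1) 1
    rw [h1.1, h1.2, e00, e01, e10, e11]
    push_cast
    constructor
    · linear_combination (-(last (mid (cmul (toReal p⁻¹) x)))) * hdet
    · linear_combination (-(last (cmul (toReal p⁻¹) x))) * hdet

/-- Half the value of the complex bilinear form `S₁` at `(x, x)`. -/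
noncomputable def alpha (S : Matrix (Fin n) (Fin n) ℤ) (x : Idx1 n → ℂ) : ℂ :=
  head x * last x + head (mid x) * last (mid x)
    - (1 / 2) * (mid (mid x) ⬝ᵥ (S.map (fun k : ℤ => (k : ℂ)) *ᵥ mid (mid x)))

/-- Half the value of the hermitian form `S₁` at `(x, x)`. -/
noncomputable def eta (S : Matrix (Fin n) (Fin n) ℤ) (x : Idx1 n → ℂ) : ℝ :=
  (head x * (starRingEnd ℂ) (last x) + head (mid x) * (starRingEnd ℂ) (last (mid x))).re
    - (1 / 2) * ((fun i => (mid (mid x) i).re) ⬝ᵥ (S.map (fun k : ℤ => (k : ℝ)) *ᵥ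
      fun i => (mid (mid x) i).re) + (fun i => (mid (mid x) i).im) ⬝ᵥ
      (S.map (fun k : ℤ => (k : ℝ)) *ᵥ fun i => (mid (mid x) i).im))

theorem alpha_eq (x : Idx1 n → ℂ) : alpha S x = (1 / 2) * (x ⬝ᵥ (S1 S ℂ *ᵥ x)) := by
  rw [S1_form, alpha]
  ring

theorem eta_eq (hS : S.IsSymm) (x : Idx1 n → ℂ) : eta S x = (1 / 2) *
    (bracket (S1 S ℝ) (reIm x)).trace := by
  rw [bracket_reIm hS, trace_fin_two]
  simp only [of_apply, cons_val', cons_val_zero, cons_val_one, cons_val_fin_one]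
  rw [S1_form, S1_form, eta]
  simp only [Complex.add_re, Complex.mul_re, Complex.conj_re, Complex.conj_im]
  change _ = 1 / 2 * ((head x).re * (last x).re + ((head (mid x)).re * (last (mid x)).re
    - (fun i => (mid (mid x) i).re) ⬝ᵥ (S.map (fun k : ℤ => (k : ℝ)) *ᵥ
      fun i => (mid (mid x) i).re) + (last (mid x)).re * (head (mid x)).re)
    + (last x).re * (head x).re + ((head x).im * (last x).im
    + ((head (mid x)).im * (last (mid x)).im
    - (fun i => (mid (mid x) i).im) ⬝ᵥ (S.map (fun k : ℤ => (k : ℝ)) *ᵥ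
      fun i => (mid (mid x) i).im) + (last (mid x)).im * (head (mid x)).im)
    + (last x).im * (head x).im))
  ring

theorem alpha_cmul {g : Matrix (Idx1 n) (Idx1 n) ℝ} (hg : bracket (S1 S ℝ) g = S1 S ℝ)
    (x : Idx1 n → ℂ) : alpha S (cmul g x) = alpha S x := by
  rw [alpha_eq, alpha_eq]
  congr 1
  exact bracket_eq_iff.mp (bracket_complex hg) x x

theorem eta_cmul (hS : S.IsSymm) {g : Matrix (Idx1 n) (Idx1 n) ℝ}
    (hg : bracket (S1 S ℝ) g = S1 S ℝ)
    (x : Idx1 n → ℂ) : eta S (cmul g x) = eta S x := by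
  rw [eta_eq hS, eta_eq hS, reIm_cmul, bracket_mul, hg]

/-- The pairs `(c, d)` whose quotient lies in the standard fundamental domain of `SL₂(ℤ)`, with
`|Im (c d̄)|` bounded below. -/
def reducedPairs (c₀ : ℝ) : Set (ℂ × ℂ) :=
  {p | Complex.normSq p.2 ≤ Complex.normSq p.1 ∧
    2 * |(p.1 * (starRingEnd ℂ) p.2).re| ≤ Complex.normSq p.2 ∧
    c₀ ≤ |(p.1 * (starRingEnd ℂ) p.2).im|}

/-- The vectors `z` that are reduced modulo the lattice `ℤ c + ℤ d`. -/
def reducedVectors (n : ℕ) (c d : ℂ) : Set (Fin n → ℂ) :=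
  {z | ∀ i, (z i * (starRingEnd ℂ) d).im / (c * (starRingEnd ℂ) d).im ∈ Set.Ico (0 : ℝ) 1 ∧
    (z i * (starRingEnd ℂ) d).re / Complex.normSq d ∈ Set.Ico (0 : ℝ) 1}

/-- The pairs `(a, b)` that are reduced modulo the centre of the Heisenberg group. -/
def reducedHeads (k : ℝ) (c d f : ℂ) (g : ℝ) : Set (ℂ × ℂ) :=
  {p | (p.1 * (starRingEnd ℂ) d + p.2 * (starRingEnd ℂ) c).im / (2 * (c * (starRingEnd ℂ) d).im) ∈
      Set.Ico (0 : ℝ) 1 ∧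
    ‖p.1 * d + p.2 * c - f‖ ≤ k ∧
    |(p.1 * (starRingEnd ℂ) d + p.2 * (starRingEnd ℂ) c).re - g| ≤ k}

/-- A set that meets every orbit of `Γ_{S,J}` on the vectors with `|α|, |η| ≤ k`, `|Δ| ≥ c₀`. -/
def fundamentalSet (S : Matrix (Fin n) (Fin n) ℤ) (k c₀ : ℝ) : Set (Idx1 n → ℂ) :=
  {x | (last (mid x), last x) ∈ reducedPairs c₀ ∧
    mid (mid x) ∈ reducedVectors n (last (mid x)) (last x) ∧
    (head x, head (mid x)) ∈ reducedHeads k (last (mid x)) (last x)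
      ((1 / 2) * (mid (mid x) ⬝ᵥ (S.map (fun k : ℤ => (k : ℂ)) *ᵥ mid (mid x))))
      ((1 / 2) * ((fun i => (mid (mid x) i).re) ⬝ᵥ (S.map (fun k : ℤ => (k : ℝ)) *ᵥ
        fun i => (mid (mid x) i).re) + (fun i => (mid (mid x) i).im) ⬝ᵥ
        (S.map (fun k : ℤ => (k : ℝ)) *ᵥ fun i => (mid (mid x) i).im)))}

theorem delta_eq_im (x : Idx1 n → ℂ) :
    delta x = (last (mid x) * (starRingEnd ℂ) (last x)).im := by
  rw [delta, Complex.mul_im, Complex.conj_re, Complex.conj_im]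
  ring

/-- The coordinates are reduced in an order in which later steps do not disturb earlier ones: the
pair `(c, d)`, then `z` modulo multiples of `c` and of `d`, then `(a, b)` modulo the centre. The
bounds on `a d + b c` and `Re (a d̄ + b c̄)` need no reduction, since `α` and `η` are invariant. -/
theorem exists_mem_fundamentalSet (hS : S.IsSymm)
    (heven : ∀ x : Fin n → ℤ, Even (x ⬝ᵥ Matrix.mulVec S x)) {k c₀ : ℝ} (hc₀ : 0 < c₀)
    {x : Idx1 n → ℂ} (h1 : ‖alpha S x‖ ≤ k) (h2 : |eta S x| ≤ k) (h3 : c₀ ≤ |delta x|) :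
    ∃ p ∈ GammaSJ S, cmul (toReal p) x ∈ fundamentalSet S k c₀ := by
  have hx0 : delta x ≠ 0 := by
    intro h
    rw [h] at h3
    simp at h3
    linarith
  obtain ⟨g, r1, r2⟩ := exists_reduced_pair (c := last (mid x)) (d := last x) hx0
  obtain ⟨p₁, hp₁, e₁⟩ := exists_GammaSJ_of_SL2 (S := S) hS heven g
  rw [← (e₁ x).1, ← (e₁ x).2] at r1
  rw [← (e₁ x).1, ← (e₁ x).2] at r2
  set x₁ := cmul (toReal p₁) x with hx₁
  set c := last (mid x₁) with hc
  set d := last x₁ with hd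
  have hΔ₁ : |(c * (starRingEnd ℂ) d).im| = |delta x| := by
    rw [← abs_delta_cmul p₁ hp₁ x, delta_eq_im]
  set Δ := (c * (starRingEnd ℂ) d).im with hΔdef
  have hΔ : Δ ≠ 0 := by
    intro h
    rw [h, abs_zero] at hΔ₁
    exact hx0 (abs_eq_zero.mp hΔ₁.symm)
  have hΔ' : (d * (starRingEnd ℂ) c).im = -Δ := by
    rw [hΔdef]
    simp only [Complex.mul_im, Complex.conj_re, Complex.conj_im]
    ring
  have hd0 : d ≠ 0 := by
    intro h
    apply hΔ
    rw [hΔdef, h]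
    simp
  have hdd : Complex.normSq d ≠ 0 := (Complex.normSq_pos.mpr hd0).ne'
  have hdd_re : (d * (starRingEnd ℂ) d).re = Complex.normSq d := by
    rw [Complex.mul_conj, Complex.ofReal_re]
  have hdd_im : (d * (starRingEnd ℂ) d).im = 0 := by
    rw [Complex.mul_conj, Complex.ofReal_im]
  -- `Im (z d̄)/Δ` is the coefficient of `c` in the real basis `c, d`. The next step adds multiples
  -- of `d`, which does not change `Im (z d̄)` and shifts `Re (z d̄)/|d|²` by integers.
  obtain ⟨p₂, hp₂, e₂⟩ := exists_middle_translation (S := S) hS heven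
    (fun i => -⌊(mid (mid x₁) i * (starRingEnd ℂ) d).im / Δ⌋)
  set x₂ := cmul (toReal p₂) x₁ with hx₂
  obtain ⟨f1, f2, f3⟩ := e₂ x₁
  obtain ⟨p₃, hp₃, e₃⟩ := exists_translation (S := S) hS heven
    (Sum.elim (fun _ => 0) (Sum.elim
      (fun i => -⌊(mid (mid x₂) i * (starRingEnd ℂ) d).re / Complex.normSq d⌋) (fun _ => 0)))
  set x₃ := cmul (toReal p₃) x₂ with hx₃
  obtain ⟨g1, g2, -⟩ := e₃ x₂
  -- A central translation by `t` replaces `(a, b)` by `(a - t c, b + t d)`. This preserves `a d + b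
  -- c` and shifts `Im (a d̄ + b c̄)` by `-2 Δ t`, whence the denominator `2 Δ`.
  set θ := (head x₃ * (starRingEnd ℂ) d + head (mid x₃) * (starRingEnd ℂ) c).im / (2 * Δ) with hθ
  obtain ⟨p₄, hp₄, e₄⟩ := exists_translation (S := S) hS heven
    (Sum.elim (fun _ => ⌊θ⌋) (Sum.elim (fun _ => 0) (fun _ => 0)))
  set x₄ := cmul (toReal p₄) x₃ with hx₄
  obtain ⟨k1, k2, k3⟩ := e₄ x₃
  have hprod : cmul (toReal (p₄ * (p₃ * (p₂ * p₁)))) x = x₄ := by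
    rw [toReal_mul, toReal_mul, toReal_mul, cmul_mul, cmul_mul, cmul_mul]
  have l3 : last x₃ = d := by rw [g1, f1]
  have m3 : last (mid x₃) = c := by
    rw [g2, last_add, f2]
    simp [last]
    rfl
  have l4 : last x₄ = d := by rw [k1, l3]
  have m4 : last (mid x₄) = c := by
    rw [k2, last_add, m3]
    simp [last]
  have z4 : mid (mid x₄) = mid (mid x₃) := by
    rw [k2]
    funext i
    simp [mid]
  have z3 : ∀ i, mid (mid x₃) i = mid (mid x₂) i
      - d * (⌊(mid (mid x₂) i * (starRingEnd ℂ) d).re / Complex.normSq d⌋ : ℤ) := by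
    intro i
    rw [g2, mid_add, Pi.add_apply, f1]
    simp [mid]
    ring
  have z2 : ∀ i, mid (mid x₂) i = mid (mid x₁) i
      - c * (⌊(mid (mid x₁) i * (starRingEnd ℂ) d).im / Δ⌋ : ℤ) := by
    intro i
    rw [f3, Pi.add_apply]
    simp
    ring
  have hmid4 : head (mid x₄) = head (mid x₃) + d * (⌊θ⌋ : ℤ) := by
    rw [k2, head_add, l3]
    simp [head]
  have hhead4 : head x₄ = head x₃ - c * (⌊θ⌋ : ℤ) := by
    rw [k3]
    have s0 : (S0 S ℂ *ᵥ fun i => ((Sum.elim (fun _ => ⌊θ⌋) (Sum.elim (fun _ => 0) (fun _ => 0)) :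
        Idx0 n → ℤ) i : ℂ)) = Pi.single (Sum.inr (Sum.inr ())) ((⌊θ⌋ : ℤ) : ℂ) := by
      refine ends_ext ?_ ?_ ?_
      · rw [S0, hyp_mulVec_head]
        simp [last, head]
      · rw [S0, hyp_mulVec_mid]
        have : mid (fun i => ((Sum.elim (fun _ => ⌊θ⌋) (Sum.elim (fun _ => 0) (fun _ => 0)) :
            Idx0 n → ℤ) i : ℂ)) = 0 := by
          funext i
          simp [mid]
        rw [this, mulVec_zero]
        funext i
        simp [mid]
      · rw [S0, hyp_mulVec_last]
        simp [last, head]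
    rw [s0]
    have : mid x₃ (Sum.inr (Sum.inr ())) = c := m3
    simp [this]
    ring
  refine ⟨p₄ * (p₃ * (p₂ * p₁)), mul_mem hp₄ (mul_mem hp₃ (mul_mem hp₂ hp₁)), ?_⟩
  have hα : alpha S x₄ = alpha S x := by
    rw [← hprod, alpha_cmul (bracket_toReal _)]
  have hη : eta S x₄ = eta S x := by
    rw [← hprod, eta_cmul hS (bracket_toReal _)]
  rw [hprod]
  have hre : ∀ (w : ℂ) (t : ℤ), (w * (t : ℂ)).re = w.re * t := by
    intro w t
    simp
  have him : ∀ (w : ℂ) (t : ℤ), (w * (t : ℂ)).im = w.im * t := by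
    intro w t
    simp
  have hfract : ∀ t : ℝ, t - ⌊t⌋ ∈ Set.Ico (0 : ℝ) 1 := fun t =>
    ⟨Int.fract_nonneg t, Int.fract_lt_one t⟩
  refine ⟨?_, ?_, ?_⟩
  · rw [l4, m4]
    exact ⟨r1, r2, h3.trans hΔ₁.ge⟩
  · rw [l4, m4, z4]
    intro i
    change _ / Δ ∈ _ ∧ _
    constructor
    · have : (mid (mid x₃) i * (starRingEnd ℂ) d).im / Δ =
          (mid (mid x₁) i * (starRingEnd ℂ) d).im / Δ
            - ⌊(mid (mid x₁) i * (starRingEnd ℂ) d).im / Δ⌋ := by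
        have e : mid (mid x₃) i * (starRingEnd ℂ) d = mid (mid x₁) i * (starRingEnd ℂ) d
            - (c * (starRingEnd ℂ) d) * (⌊(mid (mid x₁) i * (starRingEnd ℂ) d).im / Δ⌋ : ℤ)
            - (d * (starRingEnd ℂ) d) *
              (⌊(mid (mid x₂) i * (starRingEnd ℂ) d).re / Complex.normSq d⌋ : ℤ) := by
          rw [z3, z2]
          ring
        rw [e, Complex.sub_im, Complex.sub_im, him, him, hdd_im, zero_mul, sub_zero, sub_div,
          ← hΔdef, mul_div_cancel_left₀ _ hΔ]
      rw [this]
      exact hfract _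
    · have : (mid (mid x₃) i * (starRingEnd ℂ) d).re / Complex.normSq d =
          (mid (mid x₂) i * (starRingEnd ℂ) d).re / Complex.normSq d
            - ⌊(mid (mid x₂) i * (starRingEnd ℂ) d).re / Complex.normSq d⌋ := by
        have e : mid (mid x₃) i * (starRingEnd ℂ) d = mid (mid x₂) i * (starRingEnd ℂ) d
            - (d * (starRingEnd ℂ) d) *
              (⌊(mid (mid x₂) i * (starRingEnd ℂ) d).re / Complex.normSq d⌋ : ℤ) := by
          rw [z3]
          ring
        rw [e, Complex.sub_re, hre, hdd_re, sub_div, mul_div_cancel_left₀ _ hdd]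
      rw [this]
      exact hfract _
  · refine ⟨?_, ?_, ?_⟩
    · rw [l4, m4]
      change (head x₄ * (starRingEnd ℂ) d + head (mid x₄) * (starRingEnd ℂ) c).im / (2 * Δ) ∈ _
      have e : head x₄ * (starRingEnd ℂ) d + head (mid x₄) * (starRingEnd ℂ) c =
          (head x₃ * (starRingEnd ℂ) d + head (mid x₃) * (starRingEnd ℂ) c)
          - (c * (starRingEnd ℂ) d) * (⌊θ⌋ : ℤ) + (d * (starRingEnd ℂ) c) * (⌊θ⌋ : ℤ) := by
        rw [hhead4, hmid4]
        ring
      have e2 : (head x₄ * (starRingEnd ℂ) d + head (mid x₄) * (starRingEnd ℂ) c).im / (2 * Δ) =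
          θ - ⌊θ⌋ := by
        rw [e, Complex.add_im, Complex.sub_im, him, him, hΔ', ← hΔdef, hθ]
        field_simp
        ring
      rw [e2]
      exact hfract _
    · rw [← hα] at h1
      exact h1
    · rw [← hη] at h2
      exact h2

end Reduction

/-! ### Volumes of the reduced sets -/

section ComplexMeasure

open MeasureTheory

theorem volume_preimage_mul_add {w : ℂ} (hw : w ≠ 0) (e : ℂ) (A : Set ℂ) :
    volume {z : ℂ | w * z + e ∈ A} = ENNReal.ofReal (1 / Complex.normSq w) * volume A := by
  have hdet : LinearMap.det (LinearMap.mulLeft ℝ w) = Complex.normSq w := by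
    have := Algebra.norm_complex_eq
    have h := congrArg (fun f => f w) this
    simp only [Algebra.norm_apply] at h
    exact h
  have hpos : 0 < Complex.normSq w := Complex.normSq_pos.mpr hw
  have h := Measure.addHaar_preimage_linearMap (volume : Measure ℂ)
    (f := LinearMap.mulLeft ℝ w) (by rw [hdet]; exact hpos.ne') ((fun z => z + e) ⁻¹' A)
  rw [measure_preimage_add_right, hdet, abs_of_pos (inv_pos.mpr hpos)] at h
  rw [one_div]
  exact h

theorem lintegral_comp_mul_left {w : ℂ} (hw : w ≠ 0) (f : ℂ → ENNReal) :
    ∫⁻ z, f z = ENNReal.ofReal (Complex.normSq w) * ∫⁻ z, f (w * z) := by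
  have hpos : 0 < Complex.normSq w := Complex.normSq_pos.mpr hw
  let e : ℂ ≃ᵐ ℂ := (Homeomorph.mulLeft₀ w hw).toMeasurableEquiv
  have h : Measure.map e volume = ENNReal.ofReal (1 / Complex.normSq w) • volume := by
    ext A _
    rw [e.map_apply, Measure.smul_apply, smul_eq_mul, ← volume_preimage_mul_add hw 0 A]
    simp [e, Set.preimage]
  have h2 : ∫⁻ z, f (w * z) = ∫⁻ z, f z ∂(Measure.map e volume) := by
    rw [lintegral_map_equiv]
    rfl
  rw [h2, h, lintegral_smul_measure, smul_eq_mul, ← mul_assoc, ← ENNReal.ofReal_mul hpos.le,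
    mul_one_div_cancel hpos.ne', ENNReal.ofReal_one, one_mul]

theorem volume_re_mem_im_mem (I J : Set ℝ) :
    volume {z : ℂ | z.re ∈ I ∧ z.im ∈ J} = volume I * volume J := by
  rw [← Measure.prod_prod, ← Measure.volume_eq_prod,
    ← Complex.volume_preserving_equiv_real_prod.measure_preimage_equiv]
  rfl

theorem volume_div_mem_Ico {r : ℝ} (hr : r ≠ 0) :
    volume {t : ℝ | t / r ∈ Set.Ico (0 : ℝ) 1} = ENNReal.ofReal |r| := by
  have := Real.volume_preimage_mul_right (inv_ne_zero hr) (Set.Ico (0 : ℝ) 1)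
  rw [inv_inv, Real.volume_Ico, sub_zero, ENNReal.ofReal_one, mul_one] at this
  exact this

/-- In each coordinate `d̄ z` runs through a rectangle of area `|d|² |Δ|`, and multiplication by
`d̄` scales area by `|d|²`. So each factor has area `|Δ|`. -/
theorem volume_reducedVectors (n : ℕ) {c d : ℂ} (h : (c * (starRingEnd ℂ) d).im ≠ 0) :
    volume (reducedVectors n c d) = ENNReal.ofReal |(c * (starRingEnd ℂ) d).im| ^ n := by
  have hd : d ≠ 0 := by
    rintro rfl
    simp at h
  have hdd : Complex.normSq d ≠ 0 := (Complex.normSq_pos.mpr hd).ne'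
  have hcd : (starRingEnd ℂ) d ≠ 0 := (map_ne_zero _).mpr hd
  have e : reducedVectors n c d = Set.univ.pi fun _ =>
      {z : ℂ | (starRingEnd ℂ) d * z + 0 ∈ {w : ℂ |
        w.re ∈ {t : ℝ | t / Complex.normSq d ∈ Set.Ico (0 : ℝ) 1} ∧
        w.im ∈ {t : ℝ | t / (c * (starRingEnd ℂ) d).im ∈ Set.Ico (0 : ℝ) 1}}} := by
    ext z
    simp only [reducedVectors, Set.mem_pi, Set.mem_univ, true_imp_iff, Set.mem_ofPred_eq, add_zero,
      mul_comm ((starRingEnd ℂ) d)]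
    exact forall_congr' fun i => and_comm
  rw [e, volume_pi_pi]
  simp only [volume_preimage_mul_add hcd, volume_re_mem_im_mem, volume_div_mem_Ico h,
    volume_div_mem_Ico hdd, Finset.prod_const, Finset.card_univ, Fintype.card_fin]
  congr 1
  have p1 : 0 ≤ 1 / Complex.normSq d := one_div_nonneg.mpr (Complex.normSq_nonneg d)
  rw [Complex.normSq_conj, ← mul_assoc, ← ENNReal.ofReal_mul p1,
    abs_of_nonneg (Complex.normSq_nonneg d), one_div_mul_cancel hdd, ENNReal.ofReal_one, one_mul]

theorem volume_abs_sub_le (g k : ℝ) : volume {t : ℝ | |t - g| ≤ k} = ENNReal.ofReal (2 * k) :=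
  Real.volume_closedBall g k

/-- Use `u = a d + b c` and `a d̄ + b c̄` as linear coordinates: the first runs through a disc of
radius `k`, the second through a rectangle of area `2k · 2|Δ|`. The Jacobian is `|d|² · 4 Δ²/|d|² =
4 Δ²`, which leaves the factor `k / |Δ|`. -/
theorem volume_reducedHeads_le {k : ℝ} (hk : 0 ≤ k) {c d : ℂ}
    (h : (c * (starRingEnd ℂ) d).im ≠ 0) (f : ℂ) (g : ℝ) :
    volume (reducedHeads k c d f g) ≤
      ENNReal.ofReal (k / |(c * (starRingEnd ℂ) d).im|) * volume (Metric.closedBall f k) := by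
  have hd : d ≠ 0 := by
    rintro rfl
    simp at h
  have hdd : 0 < Complex.normSq d := Complex.normSq_pos.mpr hd
  set Δ := (c * (starRingEnd ℂ) d).im with hΔ
  -- For fixed `u`, the quantity `a d̄ + b c̄` is affine in `b` with slope `c̄ - c d̄/d = -2iΔ/d`.
  set m : ℂ := -2 * Complex.I * Δ / d with hm
  have hΔ0 : (Δ : ℂ) ≠ 0 := Complex.ofReal_ne_zero.mpr h
  have hm0 : m ≠ 0 := by
    rw [hm]
    simp [hΔ0, hd]
  have hmn : Complex.normSq m = 4 * Δ ^ 2 / Complex.normSq d := by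
    rw [hm]
    simp [Complex.normSq_mul, Complex.normSq_ofReal]
    norm_num
    ring
  have key : ∀ a b : ℂ, a * (starRingEnd ℂ) d + b * (starRingEnd ℂ) c =
      m * b + (d * a + b * c) * ((starRingEnd ℂ) d / d) := by
    intro a b
    have e : c * (starRingEnd ℂ) d - d * (starRingEnd ℂ) c = 2 * Complex.I * Δ := by
      apply Complex.ext <;> simp [hΔ] <;> ring
    rw [hm]
    field_simp
    linear_combination (-b) * e
  set B : Set ℂ := {w : ℂ | w.re ∈ {t : ℝ | |t - g| ≤ k} ∧
    w.im ∈ {t : ℝ | t / (2 * Δ) ∈ Set.Ico (0 : ℝ) 1}} with hB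
  have hBm : MeasurableSet B := by
    have h1 : MeasurableSet {t : ℝ | |t - g| ≤ k} :=
      measurableSet_le (by fun_prop) measurable_const
    have h2 : MeasurableSet {t : ℝ | t / (2 * Δ) ∈ Set.Ico (0 : ℝ) 1} :=
      (measurable_id.div_const _) measurableSet_Ico
    exact (Complex.measurable_re h1).inter (Complex.measurable_im h2)
  have hBv : volume B = ENNReal.ofReal (2 * k) * ENNReal.ofReal (2 * |Δ|) := by
    rw [hB, volume_re_mem_im_mem, volume_abs_sub_le,
      volume_div_mem_Ico (mul_ne_zero two_ne_zero h), abs_mul, abs_two]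
  set R : Set (ℂ × ℂ) := {p | p.1 ∈ Metric.closedBall f k ∧
    m * p.2 + p.1 * ((starRingEnd ℂ) d / d) ∈ B} with hR
  have hRm : MeasurableSet R := by
    refine MeasurableSet.inter (measurable_fst measurableSet_closedBall) ?_
    exact (by fun_prop : Measurable fun p : ℂ × ℂ =>
      m * p.2 + p.1 * ((starRingEnd ℂ) d / d)) hBm
  set L : ℂ × ℂ → ℂ × ℂ := fun p => (d * p.1 + p.2 * c, p.2) with hL
  have hLm : Measurable L := by fun_prop
  have hsub : reducedHeads k c d f g = L ⁻¹' R := by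
    ext ⟨a, b⟩
    have k1 := key a b
    rw [mul_comm d a] at k1
    simp only [reducedHeads, hR, hL, hB, Set.mem_ofPred_eq, Set.mem_preimage,
      mem_closedBall_iff_norm, mul_comm d a, ← hΔ, ← k1]
    tauto
  rw [hsub, Measure.volume_eq_prod, Measure.prod_apply_symm (hLm hRm)]
  have s1 : ∀ b : ℂ, volume ((fun a => (a, b)) ⁻¹' (L ⁻¹' R)) =
      ENNReal.ofReal (1 / Complex.normSq d) * volume ((fun u => (u, b)) ⁻¹' R) := by
    intro b
    rw [← volume_preimage_mul_add hd (b * c)]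
    rfl
  simp only [s1]
  rw [lintegral_const_mul _ (measurable_measure_prodMk_right hRm), ← Measure.prod_apply_symm hRm,
    Measure.prod_apply hRm]
  have s2 : ∀ u : ℂ, volume (Prod.mk u ⁻¹' R) = (Metric.closedBall f k).indicator
      (fun _ => ENNReal.ofReal (1 / Complex.normSq m) * volume B) u := by
    intro u
    by_cases hu : u ∈ Metric.closedBall f k
    · rw [Set.indicator_of_mem hu, ← volume_preimage_mul_add hm0 (u * ((starRingEnd ℂ) d / d))]
      congr 1
      ext b
      simp only [hR, Set.mem_preimage, Set.mem_ofPred_eq, hu, true_and]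
    · rw [Set.indicator_of_notMem hu]
      have : Prod.mk u ⁻¹' R = ∅ := by
        ext b
        simp only [hR, Set.mem_preimage, Set.mem_ofPred_eq, hu, false_and, Set.mem_empty_iff_false]
      rw [this, measure_empty]
  simp only [s2]
  rw [lintegral_indicator measurableSet_closedBall, setLIntegral_const, hBv, ← mul_assoc]
  gcongr
  have p1 : 0 ≤ 1 / Complex.normSq d := one_div_nonneg.mpr hdd.le
  have p2 : 0 ≤ 1 / Complex.normSq m := one_div_nonneg.mpr (Complex.normSq_nonneg m)
  rw [← ENNReal.ofReal_mul (by positivity), ← ENNReal.ofReal_mul p2, ← ENNReal.ofReal_mul p1]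
  apply le_of_eq
  congr 1
  have ha : 0 < |Δ| := abs_pos.mpr h
  rw [hmn, ← sq_abs Δ]
  field_simp
  norm_num

end ComplexMeasure

/-! ### The integral over reduced pairs `(c, d)` -/

section PairIntegral

open MeasureTheory

theorem lintegral_norm_rpow_lt_top {E : Type*} [NormedAddCommGroup E] [NormedSpace ℝ E]
    [FiniteDimensional ℝ E] [MeasurableSpace E] [BorelSpace E] (μ : Measure E)
    [μ.IsAddHaarMeasure] {r m : ℝ} (hm : 0 < m) (hr : (Module.finrank ℝ E : ℝ) < r) :
    ∫⁻ x in {x : E | m ≤ ‖x‖}, ENNReal.ofReal (‖x‖ ^ (-r)) ∂μ < ⊤ := by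
  have hr0 : 0 ≤ r := (Nat.cast_nonneg _).trans hr.le
  have hset : MeasurableSet {x : E | m ≤ ‖x‖} := measurableSet_le measurable_const measurable_norm
  have h := finite_integral_one_add_norm (μ := μ) hr
  have hle : ∀ x ∈ {x : E | m ≤ ‖x‖}, ENNReal.ofReal (‖x‖ ^ (-r)) ≤
      ENNReal.ofReal ((1 + 1 / m) ^ r) * ENNReal.ofReal ((1 + ‖x‖) ^ (-r)) := by
    intro x hx
    have hx : m ≤ ‖x‖ := hx
    have hx0 : 0 < ‖x‖ := hm.trans_le hx
    rw [← ENNReal.ofReal_mul (by positivity)]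
    apply ENNReal.ofReal_le_ofReal
    have h1 : (1 + ‖x‖) ≤ (1 + 1 / m) * ‖x‖ := by
      have : 1 ≤ (1 / m) * ‖x‖ := by
        rw [one_div, inv_mul_eq_div, one_le_div hm]
        exact hx
      linarith
    have h2 : (1 + ‖x‖) ^ r ≤ (1 + 1 / m) ^ r * ‖x‖ ^ r := by
      rw [← Real.mul_rpow (by positivity) hx0.le]
      exact Real.rpow_le_rpow (by positivity) h1 hr0
    rw [Real.rpow_neg hx0.le, Real.rpow_neg (by positivity), ← div_eq_mul_inv,
      inv_eq_one_div, div_le_div_iff₀ (by positivity) (by positivity)]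
    linarith
  calc ∫⁻ x in {x : E | m ≤ ‖x‖}, ENNReal.ofReal (‖x‖ ^ (-r)) ∂μ
      ≤ ∫⁻ x in {x : E | m ≤ ‖x‖},
        ENNReal.ofReal ((1 + 1 / m) ^ r) * ENNReal.ofReal ((1 + ‖x‖) ^ (-r)) ∂μ :=
        setLIntegral_mono' hset hle
    _ ≤ ∫⁻ x, ENNReal.ofReal ((1 + 1 / m) ^ r) * ENNReal.ofReal ((1 + ‖x‖) ^ (-r)) ∂μ :=
        setLIntegral_le_lintegral _ _
    _ = ENNReal.ofReal ((1 + 1 / m) ^ r) * ∫⁻ x, ENNReal.ofReal ((1 + ‖x‖) ^ (-r)) ∂μ :=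
        lintegral_const_mul' _ _ ENNReal.ofReal_ne_top
    _ < ⊤ := ENNReal.mul_lt_top ENNReal.ofReal_lt_top h

theorem lintegral_normSq_rpow_lt_top {c₀ κ : ℝ} (hc₀ : 0 < c₀) (hκ : 2 < κ) :
    ∫⁻ w : ℂ, {w : ℂ | c₀ ≤ Complex.normSq w}.indicator
      (fun w => ENNReal.ofReal (Complex.normSq w ^ (1 - κ))) w < ⊤ := by
  have h := lintegral_norm_rpow_lt_top (volume : Measure ℂ) (r := 2 * κ - 2)
    (Real.sqrt_pos.mpr hc₀) (by rw [Complex.finrank_real_complex]; push_cast; linarith)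
  have hset : MeasurableSet {w : ℂ | c₀ ≤ Complex.normSq w} :=
    measurableSet_le measurable_const Complex.continuous_normSq.measurable
  rw [lintegral_indicator hset]
  have e : {w : ℂ | c₀ ≤ Complex.normSq w} = {w : ℂ | Real.sqrt c₀ ≤ ‖w‖} := by
    ext w
    change c₀ ≤ Complex.normSq w ↔ Real.sqrt c₀ ≤ ‖w‖
    rw [Complex.normSq_eq_norm_sq, Real.sqrt_le_left (norm_nonneg _)]
  rw [e]
  refine lt_of_le_of_lt (le_of_eq (lintegral_congr fun w => ?_)) h
  rw [Complex.normSq_eq_norm_sq, ← Real.rpow_natCast, ← Real.rpow_mul (norm_nonneg _)]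
  congr 2
  push_cast
  ring

theorem lintegral_strip_lt_top :
    ∫⁻ τ : ℂ, {τ : ℂ | |τ.re| ≤ 1 / 2 ∧ 1 / 2 ≤ |τ.im|}.indicator
      (fun τ => ENNReal.ofReal (|τ.im| ^ (-2 : ℝ))) τ < ⊤ := by
  have hA : MeasurableSet {t : ℝ | |t| ≤ 1 / 2} := measurableSet_le (by fun_prop) measurable_const
  have hB : MeasurableSet {t : ℝ | 1 / 2 ≤ |t|} := measurableSet_le measurable_const (by fun_prop)
  have h := lintegral_norm_rpow_lt_top (volume : Measure ℝ) (r := 2) (m := 1 / 2) (by norm_num)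
    (by rw [Module.finrank_self]; norm_num)
  have e : ∀ τ : ℂ, {τ : ℂ | |τ.re| ≤ 1 / 2 ∧ 1 / 2 ≤ |τ.im|}.indicator
      (fun τ => ENNReal.ofReal (|τ.im| ^ (-2 : ℝ))) τ =
      (fun p : ℝ × ℝ => {t : ℝ | |t| ≤ 1 / 2}.indicator 1 p.1 *
        {t : ℝ | 1 / 2 ≤ |t|}.indicator (fun t => ENNReal.ofReal (|t| ^ (-2 : ℝ))) p.2)
        (Complex.measurableEquivRealProd τ) := by
    intro τ
    simp only [Set.indicator, Set.mem_ofPred_eq, Complex.measurableEquivRealProd_apply,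
      Pi.one_apply]
    split_ifs <;> simp_all
  simp only [e]
  rw [Complex.volume_preserving_equiv_real_prod.lintegral_comp_emb
    Complex.measurableEquivRealProd.measurableEmbedding
    (fun p : ℝ × ℝ => {t : ℝ | |t| ≤ 1 / 2}.indicator 1 p.1 *
        {t : ℝ | 1 / 2 ≤ |t|}.indicator (fun t => ENNReal.ofReal (|t| ^ (-2 : ℝ))) p.2),
    Measure.volume_eq_prod, lintegral_prod_mul (measurable_one.indicator hA).aemeasurable
      ((by fun_prop : Measurable fun t : ℝ =>
        ENNReal.ofReal (|t| ^ (-2 : ℝ))).indicator hB).aemeasurable,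
    lintegral_indicator_one hA, lintegral_indicator hB]
  refine ENNReal.mul_lt_top ?_ h
  have : {t : ℝ | |t| ≤ 1 / 2} = {t : ℝ | |t - 0| ≤ 1 / 2} := by simp
  rw [this, volume_abs_sub_le]
  exact ENNReal.ofReal_lt_top

theorem measurableSet_reducedPairs (c₀ : ℝ) : MeasurableSet (reducedPairs c₀) := by
  have hn : Measurable Complex.normSq := Complex.continuous_normSq.measurable
  have hr : Measurable Complex.re := Complex.measurable_re
  have hi : Measurable Complex.im := Complex.measurable_im
  have hc : Measurable (starRingEnd ℂ) := Complex.continuous_conj.measurable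
  have hm : Measurable fun p : ℂ × ℂ => p.1 * (starRingEnd ℂ) p.2 :=
    measurable_fst.mul (hc.comp measurable_snd)
  have h1 : MeasurableSet {p : ℂ × ℂ | Complex.normSq p.2 ≤ Complex.normSq p.1} :=
    measurableSet_le (hn.comp measurable_snd) (hn.comp measurable_fst)
  have h2 : MeasurableSet {p : ℂ × ℂ | 2 * |(p.1 * (starRingEnd ℂ) p.2).re| ≤
      Complex.normSq p.2} :=
    measurableSet_le (measurable_const.mul (continuous_abs.measurable.comp (hr.comp hm)))
      (hn.comp measurable_snd)
  have h3 : MeasurableSet {p : ℂ × ℂ | c₀ ≤ |(p.1 * (starRingEnd ℂ) p.2).im|} :=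
    measurableSet_le measurable_const (continuous_abs.measurable.comp (hi.comp hm))
  exact h1.inter (h2.inter h3)

/-- With `c = d τ` the conditions become `|τ| ≥ 1`, `|Re τ| ≤ 1/2` and `|d|² |Im τ| ≥ c₀`. The crude
consequence `|Im τ| ≥ 1/2` is enough for convergence. -/
theorem mul_mem_reducedPairs {c₀ : ℝ} (hc₀ : 0 < c₀) {τ d : ℂ}
    (h : (d * τ, d) ∈ reducedPairs c₀) :
    d ≠ 0 ∧ (|τ.re| ≤ 1 / 2 ∧ 1 / 2 ≤ |τ.im|) ∧ c₀ ≤ Complex.normSq d * |τ.im| := by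
  obtain ⟨h1, h2, h3⟩ := h
  simp only at h1 h2 h3
  have hd : d ≠ 0 := by
    rintro rfl
    simp at h3
    linarith
  have hdd : 0 < Complex.normSq d := Complex.normSq_pos.mpr hd
  have e : d * τ * (starRingEnd ℂ) d = (Complex.normSq d : ℝ) * τ := by
    rw [← Complex.mul_conj]
    ring
  rw [e, Complex.re_ofReal_mul, abs_mul, abs_of_pos hdd] at h2
  rw [e, Complex.im_ofReal_mul, abs_mul, abs_of_pos hdd] at h3
  rw [Complex.normSq_mul] at h1
  have h4 : |τ.re| ≤ 1 / 2 := by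
    by_contra! hc
    nlinarith
  have h5 : 1 ≤ Complex.normSq τ := by
    by_contra! hc
    nlinarith
  refine ⟨hd, ⟨h4, ?_⟩, h3⟩
  by_contra! hc
  rw [Complex.normSq_apply, ← abs_mul_abs_self τ.re, ← abs_mul_abs_self τ.im] at h5
  nlinarith [abs_nonneg τ.re, abs_nonneg τ.im]

/-- Substitute `c = d τ`, with Jacobian `|d|²`, and then `w = √|Im τ| · d`. The integral is bounded
by the product of `∫ |w|^(2-2κ)` away from the origin of `ℂ`, finite for `κ > 2`, and `∫ |Im τ|⁻²`
over the strip. -/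
theorem lintegral_reducedPairs_lt_top {c₀ κ : ℝ} (hc₀ : 0 < c₀) (hκ : 2 < κ) :
    ∫⁻ p in reducedPairs c₀, ENNReal.ofReal (|(p.1 * (starRingEnd ℂ) p.2).im| ^ (-κ)) < ⊤ := by
  set h : ℂ → ENNReal := {w : ℂ | c₀ ≤ Complex.normSq w}.indicator
      (fun w => ENNReal.ofReal (Complex.normSq w ^ (1 - κ))) with hh
  have hfin := lintegral_normSq_rpow_lt_top hc₀ hκ
  set G : ℂ × ℂ → ENNReal := (reducedPairs c₀).indicator
    (fun p => ENNReal.ofReal (|(p.1 * (starRingEnd ℂ) p.2).im| ^ (-κ))) with hG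
  have hc : Measurable (starRingEnd ℂ) := Complex.continuous_conj.measurable
  have hGm : Measurable G := by
    refine Measurable.indicator ?_ (measurableSet_reducedPairs c₀)
    refine ENNReal.measurable_ofReal.comp (Measurable.pow_const ?_ _)
    exact continuous_abs.measurable.comp (Complex.measurable_im.comp
      (measurable_fst.mul (hc.comp measurable_snd)))
  rw [← lintegral_indicator (measurableSet_reducedPairs c₀), ← hG, Measure.volume_eq_prod,
    lintegral_prod_symm _ hGm.aemeasurable]
  have s1 : ∀ d : ℂ, ∫⁻ c, G (c, d) =
      ∫⁻ τ, ENNReal.ofReal (Complex.normSq d) * G (d * τ, d) := by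
    intro d
    rw [lintegral_const_mul' _ _ ENNReal.ofReal_ne_top]
    by_cases hd : d = 0
    · have : ∀ c, G (c, 0) = 0 := by
        intro c
        refine Set.indicator_of_notMem ?_ _
        rintro ⟨-, -, h3⟩
        simp at h3
        linarith
      simp [hd, this]
    · exact lintegral_comp_mul_left hd fun c => G (c, d)
  simp only [s1]
  rw [lintegral_lintegral_swap]
  swap
  · refine Measurable.aemeasurable (Measurable.mul ?_ (hGm.comp ?_))
    · exact ENNReal.measurable_ofReal.comp
        (Complex.continuous_normSq.measurable.comp measurable_fst)
    · fun_prop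
  -- Here `|d|² (|d|² |v|)^(-κ) = |v|⁻¹ (|d|² |v|)^(1-κ)` for `v = Im τ`; a second factor `|v|⁻¹`
  -- comes from the substitution for `d`.
  have s2 : ∀ τ d : ℂ, ENNReal.ofReal (Complex.normSq d) * G (d * τ, d) ≤
      {τ : ℂ | |τ.re| ≤ 1 / 2 ∧ 1 / 2 ≤ |τ.im|}.indicator
        (fun τ => ENNReal.ofReal |τ.im|⁻¹ * h ((Real.sqrt |τ.im| : ℝ) * d)) τ := by
    intro τ d
    by_cases hp : (d * τ, d) ∈ reducedPairs c₀
    · obtain ⟨hd, hτ, h3⟩ := mul_mem_reducedPairs hc₀ hp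
      have hdd : 0 < Complex.normSq d := Complex.normSq_pos.mpr hd
      have hv : 0 < |τ.im| := by linarith [hτ.2]
      have e : d * τ * (starRingEnd ℂ) d = (Complex.normSq d : ℝ) * τ := by
        rw [← Complex.mul_conj]
        ring
      have en : Complex.normSq ((Real.sqrt |τ.im| : ℝ) * d) = Complex.normSq d * |τ.im| := by
        rw [Complex.normSq_mul, Complex.normSq_ofReal, Real.mul_self_sqrt hv.le, mul_comm]
      rw [Set.indicator_of_mem (show τ ∈ {τ : ℂ | |τ.re| ≤ 1 / 2 ∧ 1 / 2 ≤ |τ.im|} from hτ),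
        hh, Set.indicator_of_mem (by change c₀ ≤ _; rw [en]; exact h3), hG,
        Set.indicator_of_mem hp, ← ENNReal.ofReal_mul hdd.le, ← ENNReal.ofReal_mul (by positivity)]
      apply ENNReal.ofReal_le_ofReal
      rw [en, e, Complex.im_ofReal_mul, abs_mul, abs_of_pos hdd, sub_eq_add_neg,
        Real.rpow_add (by positivity), Real.rpow_one]
      apply le_of_eq
      field_simp
    · rw [hG, Set.indicator_of_notMem hp, mul_zero]
      exact zero_le
  have s3 : ∀ τ : ℂ, ∫⁻ d, ENNReal.ofReal (Complex.normSq d) * G (d * τ, d) ≤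
      {τ : ℂ | |τ.re| ≤ 1 / 2 ∧ 1 / 2 ≤ |τ.im|}.indicator
        (fun τ => ENNReal.ofReal (|τ.im| ^ (-2 : ℝ))) τ * ∫⁻ w, h w := by
    intro τ
    refine (lintegral_mono (s2 τ)).trans ?_
    by_cases hτ : τ ∈ {τ : ℂ | |τ.re| ≤ 1 / 2 ∧ 1 / 2 ≤ |τ.im|}
    · simp only [Set.indicator_of_mem hτ]
      have hv : 0 < |τ.im| := by
        have := hτ.2
        linarith
      rw [lintegral_const_mul' _ _ ENNReal.ofReal_ne_top,
        lintegral_comp_mul_left (w := (Real.sqrt |τ.im| : ℝ)) (by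
          simpa using (Real.sqrt_pos.mpr hv).ne') h, Complex.normSq_ofReal,
        Real.mul_self_sqrt hv.le, ← mul_assoc, ← ENNReal.ofReal_mul (by positivity)]
      gcongr
      rw [← Real.rpow_neg_one]
      nth_rewrite 3 [← Real.rpow_one |τ.im|]
      rw [← Real.rpow_add hv]
      norm_num
    · simp only [Set.indicator_of_notMem hτ, lintegral_zero, zero_mul, le_refl]
  refine lt_of_le_of_lt (lintegral_mono s3) ?_
  rw [lintegral_mul_const' _ _ hfin.ne]
  exact ENNReal.mul_lt_top lintegral_strip_lt_top hfin

end PairIntegral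

/-! ### The integral over the fundamental set -/

section FundamentalSetIntegral

open MeasureTheory

variable {n : ℕ} {S : Matrix (Fin n) (Fin n) ℤ}

/-- The coordinates of `ℂ^(n+4)` grouped as `((c, d), z, (a, b))` for `x = (a, b, z, c, d)`. -/
noncomputable def coordEquiv (n : ℕ) :
    (Idx1 n → ℂ) ≃L[ℝ] (ℂ × ℂ) × (Fin n → ℂ) × (ℂ × ℂ) :=
  LinearEquiv.toContinuousLinearEquiv
    { toFun := fun x => ((last (mid x), last x), mid (mid x), (head x, head (mid x)))
      invFun := fun y => Sum.elim (fun _ => y.2.2.1)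
        (Sum.elim (Sum.elim (fun _ => y.2.2.2) (Sum.elim y.2.1 fun _ => y.1.1)) fun _ => y.1.2)
      map_add' := fun _ _ => rfl
      map_smul' := fun _ _ => rfl
      left_inv := fun x => by
        refine ends_ext rfl (ends_ext rfl rfl rfl) rfl
      right_inv := fun _ => rfl }

/-- The set `fundamentalSet` in the coordinates of `coordEquiv`. -/
def fundamentalProd (S : Matrix (Fin n) (Fin n) ℤ) (k c₀ : ℝ) :
    Set ((ℂ × ℂ) × (Fin n → ℂ) × (ℂ × ℂ)) :=
  {y | y.1 ∈ reducedPairs c₀ ∧ y.2.1 ∈ reducedVectors n y.1.1 y.1.2 ∧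
    y.2.2 ∈ reducedHeads k y.1.1 y.1.2
      ((1 / 2) * (y.2.1 ⬝ᵥ (S.map (fun k : ℤ => (k : ℂ)) *ᵥ y.2.1)))
      ((1 / 2) * ((fun i => (y.2.1 i).re) ⬝ᵥ (S.map (fun k : ℤ => (k : ℝ)) *ᵥ
        fun i => (y.2.1 i).re) + (fun i => (y.2.1 i).im) ⬝ᵥ
        (S.map (fun k : ℤ => (k : ℝ)) *ᵥ fun i => (y.2.1 i).im)))}

theorem measurableSet_fundamentalProd (k c₀ : ℝ) :
    MeasurableSet (fundamentalProd S k c₀) := by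
  have hc : Measurable (starRingEnd ℂ) := Complex.continuous_conj.measurable
  have hn : Measurable Complex.normSq := Complex.continuous_normSq.measurable
  have hquad : ∀ (R : Type) [CommRing R] [TopologicalSpace R] [IsTopologicalRing R]
      (A : Matrix (Fin n) (Fin n) R), Continuous fun z : Fin n → R => z ⬝ᵥ (A *ᵥ z) := by
    intro R _ _ _ A
    fun_prop
  have h1 : MeasurableSet {y : (ℂ × ℂ) × (Fin n → ℂ) × (ℂ × ℂ) | y.1 ∈ reducedPairs c₀} :=
    measurable_fst (measurableSet_reducedPairs c₀)
  have h2 : MeasurableSet {y : (ℂ × ℂ) × (Fin n → ℂ) × (ℂ × ℂ) |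
      y.2.1 ∈ reducedVectors n y.1.1 y.1.2} := by
    have : {y : (ℂ × ℂ) × (Fin n → ℂ) × (ℂ × ℂ) | y.2.1 ∈ reducedVectors n y.1.1 y.1.2} =
        ⋂ i, ({y | (y.2.1 i * (starRingEnd ℂ) y.1.2).im / (y.1.1 * (starRingEnd ℂ) y.1.2).im ∈
          Set.Ico (0 : ℝ) 1} ∩ {y | (y.2.1 i * (starRingEnd ℂ) y.1.2).re / Complex.normSq y.1.2 ∈
          Set.Ico (0 : ℝ) 1}) := by
      ext y
      simp [reducedVectors]
    rw [this]
    refine MeasurableSet.iInter fun i => MeasurableSet.inter ?_ ?_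
    · have hf : Measurable fun y : (ℂ × ℂ) × (Fin n → ℂ) × (ℂ × ℂ) =>
          (y.2.1 i * (starRingEnd ℂ) y.1.2).im / (y.1.1 * (starRingEnd ℂ) y.1.2).im := by
        fun_prop
      exact hf measurableSet_Ico
    · have hf : Measurable fun y : (ℂ × ℂ) × (Fin n → ℂ) × (ℂ × ℂ) =>
          (y.2.1 i * (starRingEnd ℂ) y.1.2).re / Complex.normSq y.1.2 := by
        fun_prop
      exact hf measurableSet_Ico
  have h3 : MeasurableSet {y : (ℂ × ℂ) × (Fin n → ℂ) × (ℂ × ℂ) |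
      (y.2.2.1 * (starRingEnd ℂ) y.1.2 + y.2.2.2 * (starRingEnd ℂ) y.1.1).im /
        (2 * (y.1.1 * (starRingEnd ℂ) y.1.2).im) ∈ Set.Ico (0 : ℝ) 1} := by
    have hf : Measurable fun y : (ℂ × ℂ) × (Fin n → ℂ) × (ℂ × ℂ) =>
        (y.2.2.1 * (starRingEnd ℂ) y.1.2 + y.2.2.2 * (starRingEnd ℂ) y.1.1).im /
        (2 * (y.1.1 * (starRingEnd ℂ) y.1.2).im) := by
      fun_prop
    exact hf measurableSet_Ico
  have h4 : MeasurableSet {y : (ℂ × ℂ) × (Fin n → ℂ) × (ℂ × ℂ) |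
      ‖y.2.2.1 * y.1.2 + y.2.2.2 * y.1.1 -
        ((1 / 2) * (y.2.1 ⬝ᵥ (S.map (fun k : ℤ => (k : ℂ)) *ᵥ y.2.1)))‖ ≤ k} := by
    refine measurableSet_le (Measurable.norm (Measurable.sub (by fun_prop)
      (measurable_const.mul ?_))) measurable_const
    exact (hquad ℂ _).measurable.comp (by fun_prop : Measurable fun y :
      (ℂ × ℂ) × (Fin n → ℂ) × (ℂ × ℂ) => y.2.1)
  have h5 : MeasurableSet {y : (ℂ × ℂ) × (Fin n → ℂ) × (ℂ × ℂ) |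
      |(y.2.2.1 * (starRingEnd ℂ) y.1.2 + y.2.2.2 * (starRingEnd ℂ) y.1.1).re -
        ((1 / 2) * ((fun i => (y.2.1 i).re) ⬝ᵥ (S.map (fun k : ℤ => (k : ℝ)) *ᵥ
        fun i => (y.2.1 i).re) + (fun i => (y.2.1 i).im) ⬝ᵥ
        (S.map (fun k : ℤ => (k : ℝ)) *ᵥ fun i => (y.2.1 i).im)))| ≤ k} := by
    refine measurableSet_le (continuous_abs.measurable.comp (Measurable.sub (by fun_prop)
      (measurable_const.mul (Measurable.add ?_ ?_)))) measurable_const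
    · exact (hquad ℝ _).measurable.comp (by fun_prop : Measurable fun y :
        (ℂ × ℂ) × (Fin n → ℂ) × (ℂ × ℂ) => fun i => (y.2.1 i).re)
    · exact (hquad ℝ _).measurable.comp (by fun_prop : Measurable fun y :
        (ℂ × ℂ) × (Fin n → ℂ) × (ℂ × ℂ) => fun i => (y.2.1 i).im)
  exact h1.inter (h2.inter (h3.inter (h4.inter h5)))

theorem measurableSet_fundamentalSet (k c₀ : ℝ) : MeasurableSet (fundamentalSet S k c₀) :=
  (coordEquiv n).continuous.measurable (measurableSet_fundamentalProd k c₀)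

theorem volume_fiber_fundamentalProd_le {k c₀ : ℝ} (hk : 0 ≤ k) (hc₀ : 0 < c₀) {p : ℂ × ℂ}
    (hp : p ∈ reducedPairs c₀) :
    volume (Prod.mk p ⁻¹' fundamentalProd S k c₀) ≤
      ENNReal.ofReal |(p.1 * (starRingEnd ℂ) p.2).im| ^ n *
      (ENNReal.ofReal (k / |(p.1 * (starRingEnd ℂ) p.2).im|) *
        volume (Metric.closedBall (0 : ℂ) k)) := by
  have hΔ : (p.1 * (starRingEnd ℂ) p.2).im ≠ 0 := by
    intro h
    have := hp.2.2
    rw [h, abs_zero] at this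
    linarith
  rw [Measure.volume_eq_prod,
    Measure.prod_apply (measurable_prodMk_left (measurableSet_fundamentalProd k c₀))]
  calc _ ≤ ∫⁻ z, (reducedVectors n p.1 p.2).indicator (fun _ =>
        ENNReal.ofReal (k / |(p.1 * (starRingEnd ℂ) p.2).im|) *
        volume (Metric.closedBall (0 : ℂ) k)) z := by
        refine lintegral_mono fun z => ?_
        by_cases hz : z ∈ reducedVectors n p.1 p.2
        · rw [Set.indicator_of_mem hz]
          refine le_trans (measure_mono ?_) ((volume_reducedHeads_le hk hΔ
            ((1 / 2) * (z ⬝ᵥ (S.map (fun k : ℤ => (k : ℂ)) *ᵥ z)))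
            ((1 / 2) * ((fun i => (z i).re) ⬝ᵥ (S.map (fun k : ℤ => (k : ℝ)) *ᵥ
              fun i => (z i).re) + (fun i => (z i).im) ⬝ᵥ
              (S.map (fun k : ℤ => (k : ℝ)) *ᵥ fun i => (z i).im)))).trans (le_of_eq ?_))
          · rintro q ⟨-, -, h⟩
            exact h
          · rw [Measure.addHaar_closedBall_center]
        · rw [Set.indicator_of_notMem hz]
          have : Prod.mk z ⁻¹' (Prod.mk p ⁻¹' fundamentalProd S k c₀) = ∅ := by
            ext q
            simp only [Set.mem_preimage, Set.mem_empty_iff_false, iff_false]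
            rintro ⟨-, h, -⟩
            exact hz h
          rw [this, measure_empty]
    _ ≤ _ := by
        refine (lintegral_indicator_const_le _ _).trans (le_of_eq ?_)
        rw [volume_reducedVectors n hΔ, mul_comm]

/-- The fibre over `(c, d)` has volume at most a constant times `|Δ|^n · |Δ|⁻¹`. This turns the
exponent `-σ` into `-κ` with `κ = σ - n + 1`, and `κ > 2` is the hypothesis `σ > n + 1`. -/
theorem lintegral_fundamentalSet_lt_top {k c₀ σ : ℝ} (hk : 0 ≤ k) (hc₀ : 0 < c₀)
    (hσ : (n : ℝ) + 1 < σ) :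
    ∫⁻ x in fundamentalSet S k c₀, ENNReal.ofReal (|delta x| ^ (-σ)) < ⊤ := by
  set e := (coordEquiv n).toHomeomorph.toMeasurableEquiv with he
  set f : (ℂ × ℂ) × (Fin n → ℂ) × (ℂ × ℂ) → ENNReal := fun y =>
    ENNReal.ofReal (|(y.1.1 * (starRingEnd ℂ) y.1.2).im| ^ (-σ)) with hf
  have hfm : Measurable f := by
    have hc : Measurable (starRingEnd ℂ) := Complex.continuous_conj.measurable
    have : Measurable fun y : (ℂ × ℂ) × (Fin n → ℂ) × (ℂ × ℂ) =>
      (y.1.1 * (starRingEnd ℂ) y.1.2).im := by fun_prop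
    exact ENNReal.measurable_ofReal.comp ((continuous_abs.measurable.comp this).pow_const _)
  have s1 : ∫⁻ x in fundamentalSet S k c₀, ENNReal.ofReal (|delta x| ^ (-σ)) =
      ∫⁻ y in fundamentalProd S k c₀, f y ∂(Measure.map e volume) := by
    rw [e.restrict_map, lintegral_map_equiv]
    refine lintegral_congr fun x => ?_
    rw [delta_eq_im]
    rfl
  -- Both measures are Haar measures, so they differ by a finite constant, whose value is irrelevant
  -- for finiteness.
  have : (Measure.map e (volume : Measure (Idx1 n → ℂ))).IsAddHaarMeasure :=
    (coordEquiv n).isAddHaarMeasure_map volume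
  have i1 : (volume : Measure (ℂ × ℂ)).IsAddHaarMeasure :=
    Measure.prod.instIsAddHaarMeasure volume volume
  have i2 : (volume : Measure ((Fin n → ℂ) × (ℂ × ℂ))).IsAddHaarMeasure :=
    Measure.prod.instIsAddHaarMeasure volume volume
  have i3 : (volume : Measure ((ℂ × ℂ) × (Fin n → ℂ) × (ℂ × ℂ))).IsAddHaarMeasure :=
    Measure.prod.instIsAddHaarMeasure volume volume
  rw [s1, Measure.isAddLeftInvariant_eq_smul (Measure.map e volume)
    (volume : Measure ((ℂ × ℂ) × (Fin n → ℂ) × (ℂ × ℂ))), Measure.restrict_smul,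
    lintegral_smul_measure]
  refine ENNReal.mul_lt_top ENNReal.coe_lt_top ?_
  set C := volume (Metric.closedBall (0 : ℂ) k) with hC
  have hCfin : C < ⊤ := measure_closedBall_lt_top
  rw [← lintegral_indicator (measurableSet_fundamentalProd k c₀), Measure.volume_eq_prod]
  refine (lintegral_prod_le _).trans_lt ?_
  have s2 : ∀ p : ℂ × ℂ, ∫⁻ q, (fundamentalProd S k c₀).indicator f (p, q) ≤
      (reducedPairs c₀).indicator (fun p =>
        ENNReal.ofReal (|(p.1 * (starRingEnd ℂ) p.2).im| ^ (-(σ - n + 1)))) p *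
        (ENNReal.ofReal k * C) := by
    intro p
    by_cases hp : p ∈ reducedPairs c₀
    · have hΔ : 0 < |(p.1 * (starRingEnd ℂ) p.2).im| := hc₀.trans_le hp.2.2
      rw [Set.indicator_of_mem hp]
      have e1 : ∀ q, (fundamentalProd S k c₀).indicator f (p, q) =
          (Prod.mk p ⁻¹' fundamentalProd S k c₀).indicator (fun _ =>
            ENNReal.ofReal (|(p.1 * (starRingEnd ℂ) p.2).im| ^ (-σ))) q := fun q => rfl
      simp only [e1]
      refine (lintegral_indicator_const_le _ _).trans
        ((mul_le_mul_right (volume_fiber_fundamentalProd_le hk hc₀ hp) _).trans (le_of_eq ?_))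
      rw [← mul_assoc, ← mul_assoc, ← mul_assoc, ← ENNReal.ofReal_pow hΔ.le,
        ← ENNReal.ofReal_mul (by positivity), ← ENNReal.ofReal_mul (by positivity),
        ← ENNReal.ofReal_mul (by positivity)]
      congr 2
      rw [show -(σ - n + 1) = -σ + n + (-1) by ring, Real.rpow_add hΔ, Real.rpow_add hΔ,
        Real.rpow_natCast, Real.rpow_neg_one]
      ring
    · rw [Set.indicator_of_notMem hp]
      have : ∀ q, (fundamentalProd S k c₀).indicator f (p, q) = 0 := fun q =>
        Set.indicator_of_notMem (fun h => hp h.1) _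
      simp [this]
  refine (lintegral_mono s2).trans_lt ?_
  rw [lintegral_mul_const' _ _ (ENNReal.mul_lt_top ENNReal.ofReal_lt_top hCfin).ne,
    lintegral_indicator (measurableSet_reducedPairs c₀)]
  exact ENNReal.mul_lt_top (lintegral_reducedPairs_lt_top hc₀ (by linarith))
    (ENNReal.mul_lt_top ENNReal.ofReal_lt_top hCfin)

end FundamentalSetIntegral

/-! ### Unfolding and absolute convergence -/

section Unfolding

open MeasureTheory

variable {n : ℕ} {S : Matrix (Fin n) (Fin n) ℤ}

theorem posDef_fin_two {M : Matrix (Fin 2) (Fin 2) ℝ} (hM : M.IsSymm) (h0 : 0 < M 0 0)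
    (hdet : 0 < M.det) : M.PosDef := by
  rw [posDef_iff_dotProduct_mulVec]
  refine ⟨by rw [IsHermitian, conjTranspose_eq_transpose_of_trivial]; exact hM, fun v hv => ?_⟩
  have h10 : M 1 0 = M 0 1 := hM.apply 0 1
  rw [det_fin_two, h10] at hdet
  simp only [dotProduct, mulVec, Fin.sum_univ_two, star_trivial, h10]
  by_contra! hc
  have key : M 0 0 * (v 0 * (M 0 0 * v 0 + M 0 1 * v 1) + v 1 * (M 0 1 * v 0 + M 1 1 * v 1)) =
      (M 0 0 * v 0 + M 0 1 * v 1) ^ 2 + (M 0 0 * M 1 1 - M 0 1 * M 0 1) * v 1 ^ 2 := by ring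
  have hle : (M 0 0 * v 0 + M 0 1 * v 1) ^ 2 + (M 0 0 * M 1 1 - M 0 1 * M 0 1) * v 1 ^ 2 ≤ 0 := by
    rw [← key]
    exact mul_nonpos_of_nonneg_of_nonpos h0.le hc
  have h1 : v 1 = 0 := by
    by_contra h
    have : 0 < v 1 ^ 2 := by positivity
    nlinarith [sq_nonneg (M 0 0 * v 0 + M 0 1 * v 1)]
  have h2 : v 0 = 0 := by
    rw [h1] at hle
    have : (M 0 0 * v 0) ^ 2 ≤ 0 := by nlinarith
    have := pow_eq_zero_iff (two_ne_zero) |>.mp (le_antisymm this (sq_nonneg _))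
    exact (mul_eq_zero.mp this).resolve_left h0.ne'
  apply hv
  funext i
  fin_cases i
  · exact h2
  · exact h1

theorem exists_closedBall_posDef (hS : S.IsSymm) {x : Idx1 n → ℂ}
    (hx : (bracket (S1 S ℝ) (reIm x)).PosDef) :
    ∃ r > 0, ∀ y ∈ Metric.closedBall x r, (bracket (S1 S ℝ) (reIm y)).PosDef := by
  have h1 : ∀ᶠ y in nhds x, 0 < bracket (S1 S ℝ) (reIm y) 0 0 :=
    (continuous_gram.matrix_elem 0 0).continuousAt.eventually_const_lt hx.diag_pos
  have h2 : ∀ᶠ y in nhds x, 0 < (bracket (S1 S ℝ) (reIm y)).det :=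
    continuous_gram.matrix_det.continuousAt.eventually_const_lt hx.det_pos
  obtain ⟨r, hr, h⟩ := Metric.nhds_basis_closedBall.eventually_iff.mp (h1.and h2)
  exact ⟨r, hr, fun y hy => posDef_fin_two (by
    rw [IsSymm, bracket_transpose (S1_isSymm hS ℝ)]) (h hy).1 (h hy).2⟩

theorem continuous_alpha : Continuous (alpha S) := by
  have : alpha S = fun x => (1 / 2) * (x ⬝ᵥ (S1 S ℂ *ᵥ x)) := funext alpha_eq
  rw [this]
  fun_prop

theorem continuous_eta (hS : S.IsSymm) : Continuous (eta S) := by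
  have : eta S = fun x => (1 / 2) * (bracket (S1 S ℝ) (reIm x)).trace := funext (eta_eq hS)
  rw [this]
  exact continuous_const.mul continuous_gram.matrix_trace

theorem continuous_cmul (g : Matrix (Idx1 n) (Idx1 n) ℝ) : Continuous (cmul g) := by
  unfold cmul
  fun_prop

theorem continuous_delta : Continuous (delta : (Idx1 n → ℂ) → ℝ) := by
  unfold delta last mid
  fun_prop

theorem det_toReal (γ : GammaS S) : (toReal γ).det = 1 := by
  have h := (RingHom.map_det (Int.castRingHom ℝ)
    (γ : SpecialLinearGroup (Idx1 n) ℤ).1).symm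
  rw [(γ : SpecialLinearGroup (Idx1 n) ℤ).2, map_one] at h
  exact h

/-- The real determinant of a complex linear map is the norm of its complex determinant, which is 1
here. -/
theorem lintegral_comp_cmul (γ : GammaS S) {f : (Idx1 n → ℂ) → ENNReal} (hf : Measurable f) :
    ∫⁻ x, f (cmul (toReal γ) x) = ∫⁻ x, f x := by
  set g : (Idx1 n → ℂ) →ₗ[ℝ] (Idx1 n → ℂ) :=
    (Matrix.toLin' ((toReal γ).map (fun t : ℝ => (t : ℂ)))).restrictScalars ℝ with hg
  have hdet : LinearMap.det g = 1 := by
    have h := (RingHom.map_det Complex.ofRealHom (toReal γ)).symm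
    rw [det_toReal, map_one] at h
    rw [hg, LinearMap.det_restrictScalars, LinearMap.det_toLin']
    change Algebra.norm ℝ ((Complex.ofRealHom.mapMatrix (toReal γ)).det) = 1
    rw [h, map_one]
  have hmap := Measure.map_linearMap_addHaar_eq_smul_addHaar
    (volume : Measure (Idx1 n → ℂ)) (f := g) (by rw [hdet]; exact one_ne_zero)
  rw [hdet, inv_one, abs_one, ENNReal.ofReal_one, one_smul] at hmap
  have h2 : ∫⁻ x, f x ∂(Measure.map (cmul (toReal γ)) volume) = ∫⁻ x, f x :=
    congrArg (fun μ => ∫⁻ x, f x ∂μ) hmap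
  rw [← h2, lintegral_map hf (continuous_cmul _).measurable]

instance countable_GammaS : Countable (GammaS S) := by
  have : Countable (Matrix (Idx1 n) (Idx1 n) ℤ) :=
    inferInstanceAs (Countable (Idx1 n → Idx1 n → ℤ))
  have : Countable (SpecialLinearGroup (Idx1 n) ℤ) :=
    inferInstanceAs (Countable {A : Matrix (Idx1 n) (Idx1 n) ℤ // A.det = 1})
  infer_instance

theorem cmul_inv_cmul (γ : GammaS S) (x : Idx1 n → ℂ) :
    cmul (toReal γ⁻¹) (cmul (toReal γ) x) = x := by
  rw [← cmul_mul, toReal_inv_mul, cmul_one]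

theorem cmul_cmul_inv (γ : GammaS S) (x : Idx1 n → ℂ) :
    cmul (toReal γ) (cmul (toReal γ⁻¹) x) = x := by
  rw [← cmul_mul, toReal_mul_inv, cmul_one]

/-- If `γ₀⁻¹ y` and `γ⁻¹ y` both lie in `K`, then `γ⁻¹ γ₀` maps one point of `K` to another. So the
translates of `K` cover `y` at most as often as there are overlapping elements. -/
theorem tsum_indicator_cmul_inv_le {K : Set (Idx1 n → ℂ)}
    (hfin : {γ : GammaS S | ∃ x ∈ K, cmul (toReal γ) x ∈ K}.Finite) (y : Idx1 n → ℂ) :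
    ∑' γ : GammaS S, K.indicator (1 : (Idx1 n → ℂ) → ENNReal) (cmul (toReal γ⁻¹) y) ≤
      ({γ : GammaS S | ∃ x ∈ K, cmul (toReal γ) x ∈ K}.ncard : ENNReal) := by
  set A : Set (GammaS S) := {γ | cmul (toReal γ⁻¹) y ∈ K} with hA
  set O := {γ : GammaS S | ∃ x ∈ K, cmul (toReal γ) x ∈ K} with hO
  have h1 : ∑' γ : GammaS S, K.indicator (1 : (Idx1 n → ℂ) → ENNReal) (cmul (toReal γ⁻¹) y) =
      A.encard := by
    rw [← ENNReal.tsum_set_one]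
    exact (tsum_subtype A (fun _ => (1 : ENNReal))).symm
  have h2 : A.encard ≤ O.encard := by
    rcases A.eq_empty_or_nonempty with h | ⟨γ₀, h₀⟩
    · rw [h, Set.encard_empty]
      exact zero_le
    · have hinj : Function.Injective fun γ : GammaS S => γ⁻¹ * γ₀ := fun a b h =>
        inv_injective (mul_right_cancel h)
      rw [← hinj.encard_image A]
      refine Set.encard_le_encard ?_
      rintro _ ⟨γ, hγ, rfl⟩
      refine ⟨cmul (toReal γ₀⁻¹) y, h₀, ?_⟩
      change cmul (toReal (γ⁻¹ * γ₀)) _ ∈ K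
      rw [toReal_mul, cmul_mul, cmul_cmul_inv]
      exact hγ
  rw [h1, ← ENat.toENNReal_coe, hfin.cast_ncard_eq]
  exact ENat.toENNReal_le.mpr h2

/-- Move `γ` from the integrand to the indicator of `K` by invariance of the measure, and sum the
indicators: the result is at most the overlap number times `∫ φ`. -/
theorem lintegral_tsum_cmul_lt_top {K : Set (Idx1 n → ℂ)} (hK : MeasurableSet K)
    (hfin : {γ : GammaS S | ∃ x ∈ K, cmul (toReal γ) x ∈ K}.Finite)
    {φ : (Idx1 n → ℂ) → ENNReal} (hφ : Measurable φ) (hint : ∫⁻ x, φ x < ⊤) :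
    ∫⁻ x in K, ∑' γ : GammaS S, φ (cmul (toReal γ) x) < ⊤ := by
  have hm : ∀ γ : GammaS S, Measurable fun x => φ (cmul (toReal γ) x) := fun γ =>
    hφ.comp (continuous_cmul _).measurable
  have hind : ∀ γ : GammaS S, Measurable fun y : Idx1 n → ℂ =>
      K.indicator (1 : (Idx1 n → ℂ) → ENNReal) (cmul (toReal γ) y) := fun γ =>
    (measurable_one.indicator hK).comp (continuous_cmul _).measurable
  have hprod : ∀ γ : GammaS S, Measurable fun y : Idx1 n → ℂ =>
      K.indicator (1 : (Idx1 n → ℂ) → ENNReal) (cmul (toReal γ⁻¹) y) * φ y := fun γ =>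
    (hind γ⁻¹).mul hφ
  rw [lintegral_tsum fun γ => (hm γ).aemeasurable]
  have h1 : ∀ γ : GammaS S, ∫⁻ x in K, φ (cmul (toReal γ) x) =
      ∫⁻ y, K.indicator (1 : (Idx1 n → ℂ) → ENNReal) (cmul (toReal γ⁻¹) y) * φ y := by
    intro γ
    rw [← lintegral_comp_cmul γ (hprod γ), ← lintegral_indicator hK]
    refine lintegral_congr fun x => ?_
    simp only [cmul_inv_cmul]
    by_cases hx : x ∈ K
    · simp [hx]
    · simp [hx]
  simp only [h1]
  rw [← lintegral_tsum fun γ => (hprod γ).aemeasurable]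
  simp only [ENNReal.tsum_mul_right]
  refine (lintegral_mono fun y => mul_le_mul_left (tsum_indicator_cmul_inv_le hfin y) _).trans_lt ?_
  rw [lintegral_const_mul _ hφ]
  exact ENNReal.mul_lt_top (ENNReal.natCast_lt_top _) hint

theorem mk_out_smul_GammaSJ {p : GammaS S} (hp : p ∈ GammaSJ S) (q : Cosets S) :
    (Quotient.mk (QuotientGroup.rightRel (GammaSJ S)) (p * q.out)) = q := by
  conv_rhs => rw [← q.out_eq]
  refine Quotient.sound ?_
  rw [← Quotient.eq_iff_equiv, Quotient.eq, QuotientGroup.rightRel_apply]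
  rw [_root_.mul_inv_rev, ← mul_assoc, mul_inv_cancel, one_mul]
  exact inv_mem hp

theorem summable_abs_delta_rpow (hS : S.IsSymm)
    (hpos : (S.map (fun k : ℤ => (k : ℝ))).PosDef)
    (heven : ∀ x : Fin n → ℤ, Even (x ⬝ᵥ Matrix.mulVec S x))
    {x₀ : Idx1 n → ℂ} (hx₀ : (bracket (S1 S ℝ) (reIm x₀)).PosDef)
    {σ : ℝ} (hσ : (n : ℝ) + 1 < σ) :
    Summable fun q : Cosets S => |delta (cmul (toReal q.out) x₀)| ^ (-σ) := by
  have hσ0 : 0 ≤ σ := by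
    have : (0 : ℝ) ≤ n := Nat.cast_nonneg n
    linarith
  obtain ⟨r, hr, hK⟩ := exists_closedBall_posDef hS hx₀
  set K := Metric.closedBall x₀ r with hKdef
  have hKc : IsCompact K := isCompact_closedBall x₀ r
  obtain ⟨c₀, hc₀, C, hC, hlow, hcomp⟩ := delta_bounds hS hpos hKc hK
  have hfin := finite_overlap hS hpos hKc hK
  obtain ⟨k₁, hk₁⟩ := hKc.exists_bound_of_continuousOn (continuous_alpha (S := S)).continuousOn
  obtain ⟨k₂, hk₂⟩ := hKc.exists_bound_of_continuousOn (continuous_eta hS).continuousOn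
  have hx₀K : x₀ ∈ K := Metric.mem_closedBall_self hr.le
  -- A common bound for `α` and `η` on `K`; by invariance it holds at `γx` for every `γ`.
  set k := max k₁ k₂ with hk
  have hk0 : 0 ≤ k := (norm_nonneg _).trans ((hk₁ x₀ hx₀K).trans (le_max_left _ _))
  set φ : (Idx1 n → ℂ) → ENNReal := (fundamentalSet S k c₀).indicator
    (fun x => ENNReal.ofReal (|delta x| ^ (-σ))) with hφ
  have hφm : Measurable φ := by
    refine Measurable.indicator ?_ (measurableSet_fundamentalSet k c₀)
    exact ENNReal.measurable_ofReal.comp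
      ((continuous_abs.measurable.comp continuous_delta.measurable).pow_const _)
  have hφint : ∫⁻ x, φ x < ⊤ := by
    rw [hφ, lintegral_indicator (measurableSet_fundamentalSet k c₀)]
    exact lintegral_fundamentalSet_lt_top hk0 hc₀ hσ
  have hI := lintegral_tsum_cmul_lt_top Metric.isClosed_closedBall.measurableSet hfin hφm hφint
  have hmeas : Measurable fun x => ∑' γ : GammaS S, φ (cmul (toReal γ) x) :=
    Measurable.tsum fun γ => hφm.comp (continuous_cmul _).measurable
  have hne : (volume.restrict K) ≠ 0 := by
    rw [Ne, Measure.restrict_eq_zero]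
    exact (Metric.measure_closedBall_pos volume x₀ hr).ne'
  have : NeZero (volume.restrict K) := ⟨hne⟩
  -- A finite integral gives finiteness almost everywhere, and `K` has positive measure. One good `x
  -- ∈ K` suffices, because `|Δ(γx)|` and `|Δ(γx₀)|` are uniformly comparable.
  obtain ⟨x, hx, hxK⟩ := ((ae_lt_top hmeas hI.ne).and
    (ae_restrict_mem Metric.isClosed_closedBall.measurableSet)).exists
  have hex : ∀ q : Cosets S, ∃ p ∈ GammaSJ S,
      cmul (toReal (p * q.out)) x ∈ fundamentalSet S k c₀ := by
    intro q
    have hb := bracket_toReal q.out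
    obtain ⟨p, hp, h⟩ := exists_mem_fundamentalSet hS heven hc₀ (k := k)
      (x := cmul (toReal q.out) x)
      (by rw [alpha_cmul hb]; exact (hk₁ x hxK).trans (le_max_left _ _))
      (by rw [eta_cmul hS hb]; exact (hk₂ x hxK).trans (le_max_right _ _))
      (hlow x hxK _)
    exact ⟨p, hp, by rwa [toReal_mul, cmul_mul]⟩
  choose p hp hmem using hex
  -- Each coset has a representative moving `x` into the fundamental set, and distinct cosets have
  -- distinct representatives. So the sum over cosets is dominated by the sum over the whole group.
  have hinj : Function.Injective fun q : Cosets S => p q * q.out := by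
    intro q₁ q₂ h
    rw [← mk_out_smul_GammaSJ (hp q₁) q₁, ← mk_out_smul_GammaSJ (hp q₂) q₂]
    exact congrArg _ h
  have hsum : ∑' q : Cosets S, ENNReal.ofReal (|delta (cmul (toReal q.out) x)| ^ (-σ)) < ⊤ := by
    refine lt_of_le_of_lt (le_of_eq (tsum_congr fun q => ?_))
      ((ENNReal.tsum_comp_le_tsum_of_injective hinj
        (fun γ => φ (cmul (toReal γ) x))).trans_lt hx)
    rw [hφ, Set.indicator_of_mem (hmem q), toReal_mul, cmul_mul, abs_delta_cmul _ (hp q)]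
  have hsx : Summable fun q : Cosets S => |delta (cmul (toReal q.out) x)| ^ (-σ) := by
    refine (ENNReal.summable_toReal hsum.ne).congr fun q => ?_
    exact ENNReal.toReal_ofReal (by positivity)
  refine Summable.of_nonneg_of_le (fun q => by positivity) (fun q => ?_) (hsx.mul_left (C ^ σ))
  have h1 := hcomp x hxK x₀ hx₀K q.out
  have hp1 := hc₀.trans_le (hlow x hxK q.out)
  have hp2 := hc₀.trans_le (hlow x₀ hx₀K q.out)
  rw [Real.rpow_neg hp1.le, Real.rpow_neg hp2.le, ← div_eq_mul_inv, inv_eq_one_div,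
    div_le_div_iff₀ (by positivity) (by positivity), one_mul, ← Real.mul_rpow hC.le hp2.le]
  exact Real.rpow_le_rpow hp1.le h1 hσ0

end Unfolding

/-! ### Comparison of the three series -/

section Series

variable {n : ℕ} {S : Matrix (Fin n) (Fin n) ℤ}

theorem detBracket_cosetToX (hS : S.IsSymm)
    (hpos : (S.map (fun k : ℤ => (k : ℝ))).PosDef) {Z : Idx0 n → ℂ} (hZ : Z ∈ tubeDomain S)
    (q : Cosets S) :
    detBracket S (majorantOf S (reIm (hat S Z))) (cosetToX S q) =
      (imTau S Z q.out / heightQ S Z q.out) ^ 2 := by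
  have hQ : 0 < Q0 S (imPart Z) := hZ.2
  rw [(height_quotient hS hpos hZ q.out).2.2]
  change (bracket (majorantOf S (reIm (hat S Z)))
    ((planeCols q.out).map (fun k : ℤ => (k : ℝ)))).det = _
  rw [det_bracket_planeCols hS, bracket_hat hS, det_smul, det_one, Fintype.card_fin, div_pow,
    sq_abs]
  field_simp
  ring

theorem summable_height_cpow (hS : S.IsSymm)
    (hpos : (S.map (fun k : ℤ => (k : ℝ))).PosDef)
    (heven : ∀ x : Fin n → ℤ, Even (x ⬝ᵥ Matrix.mulVec S x)) {Z : Idx0 n → ℂ}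
    (hZ : Z ∈ tubeDomain S) {s : ℂ} (hs : (n : ℝ) + 1 < s.re) :
    Summable fun q : Cosets S => ((heightQ S Z q.out / imTau S Z q.out : ℝ) : ℂ) ^ s := by
  have hQ : 0 < Q0 S (imPart Z) := hZ.2
  have h := summable_abs_delta_rpow hS hpos heven (posDef_bracket_hat hS hQ) hs
  -- The absolute value of a summand is `Q₀[Im Z]^σ |Δ|^(-σ)` with `σ = Re s`.
  refine Summable.of_norm ((h.mul_left (Q0 S (imPart Z) ^ s.re)).congr fun q => ?_)
  obtain ⟨h1, h2, h3⟩ := height_quotient hS hpos hZ q.out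
  rw [Complex.norm_cpow_eq_rpow_re_of_pos (div_pos h1 h2), ← inv_div (imTau S Z q.out), h3, inv_div,
    Real.div_rpow hQ.le (abs_nonneg _), Real.rpow_neg (abs_nonneg _), div_eq_mul_inv]

theorem ofReal_cpow_neg_inv {r : ℝ} (hr : 0 < r) (s : ℂ) :
    ((r⁻¹ : ℝ) : ℂ) ^ (-s) = (r : ℂ) ^ s := by
  rw [Complex.ofReal_inv, Complex.inv_cpow _ _ (by
    rw [Complex.arg_ofReal_of_nonneg hr.le]; exact Real.pi_pos.ne), Complex.cpow_neg, inv_inv]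

theorem ofReal_sq_cpow_half {r : ℝ} (hr : 0 < r) (s : ℂ) :
    ((r ^ 2 : ℝ) : ℂ) ^ (s / 2) = (r : ℂ) ^ s := by
  rw [pow_two, Complex.ofReal_mul, Complex.mul_cpow_ofReal_nonneg hr.le hr.le,
    ← Complex.cpow_add _ _ (Complex.ofReal_ne_zero.mpr hr.ne'), add_halves]

end Series

end OrthogonalEisenstein

theorem proposition5p1 (n : ℕ) (hn : 1 ≤ n) (S : Matrix (Fin n) (Fin n) ℤ)
    (hsymm : S.IsSymm) (hpos : (S.map (fun k : ℤ => (k : ℝ))).PosDef)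
    (heven : ∀ x : Fin n → ℤ, Even (x ⬝ᵥ Matrix.mulVec S x))
    (hcusp : (oneDimCusps S).ncard = 1)
    (Z : Idx0 n → ℂ) (hZ : Z ∈ tubeDomain S) :
    -- the summand of the Eisenstein series depends only on the coset
    (∀ p ∈ GammaSJ S, ∀ γ : GammaS S,
      heightQ S Z (p * γ) / imTau S Z (p * γ) = heightQ S Z γ / imTau S Z γ) ∧
    ∃ R ∈ majorants S,
      -- the matrix `R_I[δ⁻¹]` exists and does not depend on the choice of `δ` with `δ⟨I⟩ = Z`
      transportedMajorants S Z = {R} ∧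
      ∀ s : ℂ, (n : ℝ) + 1 < s.re →
        HasSum (fun q : Cosets S => ((heightQ S Z q.out / imTau S Z q.out : ℝ) : ℂ) ^ s)
          (eisenstein S Z s) ∧
        HasSum (fun q : Cosets S => ((imTau S Z q.out / heightQ S Z q.out : ℝ) : ℂ) ^ (-s))
          (eisenstein S Z s) ∧
        HasSum (fun l : XModGL S => ((detBracket S R l : ℝ) : ℂ) ^ (-s / 2))
          (eisenstein S Z s) := by

  have hQ : 0 < Q0 S (imPart Z) := hZ.2
  refine ⟨height_quotient_coset hsymm hpos hZ, majorantOf S (reIm (hat S Z)),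
    majorantOf_mem hsymm hpos (posDef_bracket_hat hsymm hQ),
    transportedMajorants_eq hsymm hpos hZ, fun s hs => ?_⟩
  have h1 : HasSum (fun q : Cosets S => ((heightQ S Z q.out / imTau S Z q.out : ℝ) : ℂ) ^ s)
      (eisenstein S Z s) := (summable_height_cpow hsymm hpos heven hZ hs).hasSum
  have h2 : HasSum (fun q : Cosets S => ((imTau S Z q.out / heightQ S Z q.out : ℝ) : ℂ) ^ (-s))
      (eisenstein S Z s) := by
    refine h1.congr_fun fun q => ?_
    obtain ⟨p1, p2, -⟩ := height_quotient hsymm hpos hZ q.out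
    rw [← ofReal_cpow_neg_inv (div_pos p1 p2), inv_div]
  refine ⟨h1, h2, ?_⟩
  have hbij : Function.Bijective (cosetToX S) :=
    ⟨cosetToX_injective, cosetToX_surjective hsymm hpos hcusp⟩
  -- The sum over `X / GL₂(ℤ)` is reindexed by the cosets. There the determinant is the square of
  -- the positive quotient of heights, so the exponent `-s/2` becomes `-s`.
  rw [← (Equiv.ofBijective (cosetToX S) hbij).hasSum_iff]
  refine h2.congr_fun fun q => ?_
  obtain ⟨p1, p2, -⟩ := height_quotient hsymm hpos hZ q.out
  change ((detBracket S _ (cosetToX S q) : ℝ) : ℂ) ^ (-s / 2) = _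
  rw [detBracket_cosetToX hsymm hpos hZ,
    ofReal_sq_cpow_half (div_pos p2 p1)]
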